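/- **Theorem 6.5 (Irreducibility Criterion).** Let $n\ge 2$, let $F_q$ be a finite field of characteristic $p$, let $G=\mathrm{GL}_n(q)$, and let $\ell\neq p$ be a prime. Let $R$ be a local principal ideal domain of characteristic $0$ with maximal ideal $\ell R$ that contains a primitive $p$-th root of unity, and let $K=R/\ell R$. Let $B$ be the group of upper triangular matrices in $G$ and $U$ the group of those with all diagonal entries equal to $1$; a standard parabolic subgroup is a subgroup of $G$ containing $B$. View $S_n$ as the group of permutation matrices in $G$, put $$e=\Bigl(\sum_{\sigma\in S_n}\mathrm{sign}(\sigma)\,\sigma\Bigr)\sum_{b\in B}b\in RG,\qquad I=RGe,$$ and let $f:I\times I\to R$ be $1/|B|$ times the restriction to $I$ of the $R$-bilinear form on $RG$ given by $(g,h)\mapsto\delta_{g,h}$ for $g,h\in G$ (it takes values in $R$, and $f(e,e)=n!$). For $k\ge 0$ let $$I(k)=\{x\in I : f(x,I)\subseteq \ell^kR\},\qquad \overline{I(k)}=(I(k)+\ell I)/\ell I\subseteq \overline I=I/\ell I,\qquad M(k)=\overline{I(k)}/\overline{I(k+1)};$$ these are modules over $RG$, $KG$ and $KG$, respectively. For $1\le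 i<n$ let $X_i=\{1+aE^{i,i+1} : a\in F_q\}$ and let $w_i\in S_n$ be the transposition $(i,i+1)$. For a group homomorphism $\lambda:U\to R^*$ let $J(\lambda)$ be the set of all $i$ such that $\lambda$ is nontrivial on $X_i$, let $P_{J(\lambda)}$ be the subgroup of $G$ generated by $B$ and all $w_i$ with $i\in J(\lambda)$, and let $E_\lambda=\sum_{u\in U}\lambda(u)\,ue\in I$. We say that $\lambda$ is associated to the standard parabolic subgroup $P$ if $P_{J(\lambda)}=P$. Let $\nu_\ell$ denote the $\ell$-adic valuation. Then every standard parabolic subgroup has an associated homomorphism $\lambda:U\to R^*$, and $E_\lambda\in I(k)$ for every $\lambda:U\to R^*$, where $k=\nu_\ell([G:P_{J(\lambda)}])$. For every standard parabolic subgroup $P$ let $E_P=E_\lambda$ for some fixed (arbitrarily chosen) $\lambda$ associated to $P$. Let $k$ be an integer of the form $\nu_\ell([G:P_0])$ for some standard parabolic subgroup $P_0$. Then $M(k)$ is an irreducible $KG$-module if and only if there exists a standard parabolic subgroup $P$ with $\nu_\ell([G:P])=k$ such that, for every other standard parabolic subgroup $Q$ with $\nu_\ell([G:Q])=k$, the image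 of $E_P$ in $M(k)$ belongs to the $KG$-submodule of $M(k)$ generated by the image of $E_Q$. -/

import Mathlib

namespace SteinbergLattice

set_option linter.unusedSectionVars false

open Matrix

section Groups

variable (n : ℕ) (F : Type*) [Field F]

/-- The standard Borel subgroup `B = UH` of `GL_n(F)`: all invertible upper triangular matrices. -/
def borel : Subgroup (GL (Fin n) F) where
  carrier := {g | BlockTriangular (g : Matrix (Fin n) (Fin n) F) id}
  one_mem' := blockTriangular_one
  mul_mem' := fun {a b} ha hb => by
    simpa using BlockTriangular.mul (M := (a : Matrix (Fin n) (Fin n) F)) ha hb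
  inv_mem' := fun {a} ha => by
    have := blockTriangular_inv_of_blockTriangular (M := (a : Matrix (Fin n) (Fin n) F)) ha
    simpa using this

variable {n F} in
/-- Diagonal entries multiply for upper triangular matrices. -/
theorem diag_mul_of_upper {a b : GL (Fin n) F} (ha : a ∈ borel n F) (hb : b ∈ borel n F)
    (i : Fin n) :
    ((a * b : GL (Fin n) F) : Matrix (Fin n) (Fin n) F) i i
      = (a : Matrix (Fin n) (Fin n) F) i i * (b : Matrix (Fin n) (Fin n) F) i i := by
  rw [GeneralLinearGroup.coe_mul, Matrix.mul_apply]
  refine Finset.sum_eq_single i (fun j _ hj => ?_) (by simp)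
  rcases lt_or_gt_of_ne hj with h | h
  · rw [show (a : Matrix (Fin n) (Fin n) F) i j = 0 from ha h, zero_mul]
  · rw [show (b : Matrix (Fin n) (Fin n) F) j i = 0 from hb h, mul_zero]

/-- The group `U` of upper triangular matrices having `1`'s along the main diagonal. -/
def unitri : Subgroup (GL (Fin n) F) where
  carrier := {g | g ∈ borel n F ∧ ∀ i, (g : Matrix (Fin n) (Fin n) F) i i = 1}
  one_mem' := ⟨one_mem _, by simp⟩
  mul_mem' := fun {a b} ha hb => by
    refine ⟨mul_mem ha.1 hb.1, fun i => ?_⟩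
    rw [diag_mul_of_upper ha.1 hb.1, ha.2, hb.2, one_mul]
  inv_mem' := fun {a} ha => by
    have h := inv_mem ha.1
    refine ⟨h, fun i => ?_⟩
    have h1 := diag_mul_of_upper ha.1 h i
    rw [ha.2, one_mul, mul_inv_cancel] at h1
    simpa using h1.symm

/-- The embedding of `S_n` into `GL_n(F)` as permutation matrices: `σ` sends the basis vector
`e_j` to `e_{σ j}`. -/
def permGL : Equiv.Perm (Fin n) →* GL (Fin n) F :=
  (permMatrixHom (n := Fin n) (R := F)).toHomUnits

/-- The fundamental roots `[i, i+1]`, a root `[i, j]` being recorded as the pair `(i, j)`. -/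
def simpleRoots : Set (Fin n × Fin n) := {r | (r.1 : ℕ) + 1 = r.2}

/-- The subgroup `P_J` generated by `B` and the reflections `w_r`, `r ∈ J`. -/
def parabolic (J : Set (Fin n × Fin n)) : Subgroup (GL (Fin n) F) :=
  Subgroup.closure
    ((borel n F : Set (GL (Fin n) F)) ∪ {g | ∃ r ∈ J, g = permGL n F (Equiv.swap r.1 r.2)})

/-- `J(χ)`: the fundamental roots `r = [i, j]` such that `χ` is nontrivial on the root subgroup
`X_r = {1 + a E_{ij}}`. -/
def rootSupport {n : ℕ} {F : Type*} [Field F] {A : Type*} [Monoid A] (χ : unitri n F →* A) :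
    Set (Fin n × Fin n) :=
  {r | r ∈ simpleRoots n ∧ ∃ (a : F) (u : unitri n F),
    ((u : GL (Fin n) F) : Matrix (Fin n) (Fin n) F) = transvection r.1 r.2 a ∧ χ u ≠ 1}

end Groups

section Lattice

variable (n : ℕ) (F : Type*) [Field F] [Fintype F] (R : Type*) [CommRing R]

open Classical in
/-- Steinberg's element `e = (∑_{σ ∈ S_n} sign(σ) σ) (∑_{b ∈ B} b)` of `RG`, `G = GL_n(F)`. -/
noncomputable def steinbergElt : MonoidAlgebra R (GL (Fin n) F) :=
  (∑ σ : Equiv.Perm (Fin n),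
      MonoidAlgebra.single (permGL n F σ) (((Equiv.Perm.sign σ : ℤˣ) : ℤ) : R)) *
    ∑ b : borel n F, MonoidAlgebra.single (b : GL (Fin n) F) (1 : R)

/-- The left ideal `I = RGe` of `RG`. -/
noncomputable def lattice :
    Submodule (MonoidAlgebra R (GL (Fin n) F)) (MonoidAlgebra R (GL (Fin n) F)) :=
  Submodule.span _ {steinbergElt n F R}

/-- `e` as an element of `I`. -/
noncomputable def latticeGen : lattice n F R :=
  ⟨steinbergElt n F R, Submodule.mem_span_singleton_self _⟩

variable {n F R}

/-- Elements of `I` are constant on left cosets `gB`. -/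
theorem coeff_mul_borel {x : MonoidAlgebra R (GL (Fin n) F)} (hx : x ∈ lattice n F R)
    (g : GL (Fin n) F) {b : GL (Fin n) F} (hb : b ∈ borel n F) :
    x.coeff (g * b) = x.coeff g := by
  classical
  obtain ⟨a, rfl⟩ := Submodule.mem_span_singleton.1 hx
  have key : steinbergElt n F R * MonoidAlgebra.single b⁻¹ 1 = steinbergElt n F R := by
    unfold steinbergElt
    rw [mul_assoc]
    congr 1
    rw [Finset.sum_mul]
    refine Fintype.sum_equiv (Equiv.mulRight (⟨b, hb⟩ : borel n F)⁻¹) _ _ (fun c => ?_)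
    simp [MonoidAlgebra.single_mul_single]
  have h2 : (a * steinbergElt n F R) * MonoidAlgebra.single b⁻¹ 1 = a * steinbergElt n F R := by
    rw [mul_assoc, key]
  have h3 := congrArg (fun z => z.coeff g) h2
  simpa using h3

/-- Reindexing a sum over `G/B` of a function that is constant on cosets. -/
theorem sum_coset_smul [Fintype (GL (Fin n) F ⧸ borel n F)] (φ : GL (Fin n) F → R)
    (hφ : ∀ g, ∀ b ∈ borel n F, φ (g * b) = φ g) (g : GL (Fin n) F) :
    ∑ c : GL (Fin n) F ⧸ borel n F, φ (g * c.out) = ∑ c : GL (Fin n) F ⧸ borel n F, φ c.out := by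
  refine Fintype.sum_equiv (MulAction.toPerm g) _ _ (fun c => ?_)
  have h : ((g * c.out : GL (Fin n) F) : GL (Fin n) F ⧸ borel n F) = g • c := by
    conv_rhs => rw [← QuotientGroup.out_eq' c]
    rfl
  obtain ⟨b, hb⟩ := QuotientGroup.mk_out_eq_mul (borel n F) (g * c.out)
  rw [MulAction.toPerm_apply, ← h, hb, hφ _ _ b.2]

open Classical in
/-- The form `f : I × I → R`: the restriction to `I` of the canonical form
`(g, h) ↦ δ_{g,h}` of `RG`, divided by `|B|` (elements of `I` are constant on the cosets `gB`,
see `card_mul_gowForm`), so that `f(e, e) = |S_n|`. -/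
noncomputable def gowForm (x y : lattice n F R) : R :=
  ∑ c : GL (Fin n) F ⧸ borel n F,
    (x : MonoidAlgebra R (GL (Fin n) F)).coeff c.out *
      (y : MonoidAlgebra R (GL (Fin n) F)).coeff c.out

/-- `|B| f` is the restriction to `I` of the canonical form on `RG`. -/
theorem card_mul_gowForm [Fintype (GL (Fin n) F)] (x y : lattice n F R) :
    (Nat.card (borel n F) : R) * gowForm x y =
      ∑ g : GL (Fin n) F, (x : MonoidAlgebra R (GL (Fin n) F)).coeff g *
        (y : MonoidAlgebra R (GL (Fin n) F)).coeff g := by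
  classical
  have hbij : Function.Bijective
      (fun cb : (GL (Fin n) F ⧸ borel n F) × borel n F => cb.1.out * (cb.2 : GL (Fin n) F)) := by
    have hmk : ∀ (c : GL (Fin n) F ⧸ borel n F) (b : borel n F),
        ((c.out * (b : GL (Fin n) F) : GL (Fin n) F) : GL (Fin n) F ⧸ borel n F) = c := fun c b => by
      rw [QuotientGroup.mk_mul_of_mem _ b.2, QuotientGroup.out_eq']
    refine ⟨?_, fun g => ?_⟩
    · rintro ⟨c, b⟩ ⟨c', b'⟩ h
      have hc : c = c' := by
        rw [← hmk c b, ← hmk c' b']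
        exact congrArg _ h
      subst hc
      exact Prod.ext rfl (Subtype.ext (mul_left_cancel h))
    · obtain ⟨b, hb⟩ := QuotientGroup.mk_out_eq_mul (borel n F) g
      exact ⟨((g : GL (Fin n) F ⧸ borel n F), b⁻¹), by simp [hb]⟩
  rw [gowForm, Finset.mul_sum, ← hbij.sum_comp, Fintype.sum_prod_type]
  refine Finset.sum_congr (by ext; simp) fun c _ => ?_
  simp only [coeff_mul_borel x.2 _ (Subtype.prop _), coeff_mul_borel y.2 _ (Subtype.prop _)]
  simp

theorem gowForm_add_left (x x' y : lattice n F R) :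
    gowForm (x + x') y = gowForm x y + gowForm x' y := by
  simp [gowForm, add_mul, Finset.sum_add_distrib]

theorem gowForm_single_smul (g : GL (Fin n) F) (r : R) (x y : lattice n F R) :
    gowForm ((MonoidAlgebra.single g r : MonoidAlgebra R (GL (Fin n) F)) • x) y =
      r * gowForm x ((MonoidAlgebra.single g⁻¹ 1 : MonoidAlgebra R (GL (Fin n) F)) • y) := by
  classical
  unfold gowForm
  rw [← sum_coset_smul (fun h => (((MonoidAlgebra.single g r : MonoidAlgebra R (GL (Fin n) F)) • x :
    lattice n F R) : MonoidAlgebra R (GL (Fin n) F)).coeff h *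
      (y : MonoidAlgebra R (GL (Fin n) F)).coeff h) _ g, Finset.mul_sum]
  · refine Finset.sum_congr rfl fun c _ => ?_
    simp [mul_assoc]
  · intro h b hb
    rw [coeff_mul_borel (Subtype.prop _) _ hb, coeff_mul_borel (Subtype.prop _) _ hb]

variable (n F R) in
/-- The `RG`-submodule `I(k) = {x ∈ I | f(x, I) ⊆ ℓ^k R}` of `I`. -/
noncomputable def filt (ℓ k : ℕ) : Submodule (MonoidAlgebra R (GL (Fin n) F)) (lattice n F R) where
  carrier := {x | ∀ y, (ℓ : R) ^ k ∣ gowForm x y}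
  zero_mem' := fun y => by simp [gowForm]
  add_mem' := fun {a b} ha hb y => by
    rw [gowForm_add_left]
    exact dvd_add (ha y) (hb y)
  smul_mem' := fun a x hx => by
    induction a using MonoidAlgebra.induction_linear with
    | zero => intro y; simp [gowForm]
    | add a b ha hb =>
      intro y
      rw [add_smul, gowForm_add_left]
      exact dvd_add (ha y) (hb y)
    | single g r =>
      intro y
      rw [gowForm_single_smul]
      exact Dvd.dvd.mul_left (hx _) r

variable (n F R)

/-- The submodule `ℓ I` of `I`. -/
noncomputable def ellMul (ℓ : ℕ) : Submodule (MonoidAlgebra R (GL (Fin n) F)) (lattice n F R) where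
  carrier := {x | ∃ y : lattice n F R, x = ℓ • y}
  zero_mem' := ⟨0, by simp⟩
  add_mem' := by
    rintro _ _ ⟨x, rfl⟩ ⟨y, rfl⟩
    exact ⟨x + y, by simp⟩
  smul_mem' := by
    rintro a _ ⟨x, rfl⟩
    exact ⟨a • x, smul_comm _ _ _⟩

/-- The reduction `Ī = I/ℓI`. -/
def Red (ℓ : ℕ) : Type _ := lattice n F R ⧸ ellMul n F R ℓ

noncomputable instance (ℓ : ℕ) : AddCommGroup (Red n F R ℓ) :=
  inferInstanceAs (AddCommGroup (lattice n F R ⧸ ellMul n F R ℓ))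

/-- `Ī` as an `RG`-module. -/
noncomputable instance (ℓ : ℕ) : Module (MonoidAlgebra R (GL (Fin n) F)) (Red n F R ℓ) :=
  inferInstanceAs (Module _ (lattice n F R ⧸ ellMul n F R ℓ))

/-- The map `x ↦ x̄` from `I` to `Ī`. -/
noncomputable def toRed (ℓ : ℕ) :
    lattice n F R →ₗ[MonoidAlgebra R (GL (Fin n) F)] Red n F R ℓ :=
  (ellMul n F R ℓ).mkQ

/-- `K = R/ℓR`. -/
abbrev Res (R : Type*) [CommRing R] (ℓ : ℕ) : Type _ := R ⧸ Ideal.span {(ℓ : R)}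

/-- Coefficientwise reduction `RG → KG`. -/
noncomputable def redAlg (ℓ : ℕ) :
    MonoidAlgebra R (GL (Fin n) F) →+* MonoidAlgebra (Res R ℓ) (GL (Fin n) F) :=
  MonoidAlgebra.mapRingHom _ (Ideal.Quotient.mk (Ideal.span {(ℓ : R)}))

theorem redAlg_surjective (ℓ : ℕ) : Function.Surjective (redAlg n F R ℓ) := by
  intro a
  induction a using MonoidAlgebra.induction_linear with
  | zero => exact ⟨0, map_zero _⟩
  | add a b ha hb =>
    obtain ⟨x, rfl⟩ := ha
    obtain ⟨y, rfl⟩ := hb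
    exact ⟨x + y, map_add _ _ _⟩
  | single g r =>
    obtain ⟨s, rfl⟩ := Ideal.Quotient.mk_surjective r
    exact ⟨MonoidAlgebra.single g s, by simp [redAlg]⟩

theorem redAlg_ker (ℓ : ℕ) :
    RingHom.ker (redAlg n F R ℓ) ≤
      RingHom.ker (Module.toAddMonoidEnd (MonoidAlgebra R (GL (Fin n) F)) (Red n F R ℓ)) := by
  intro a ha
  have h : ∀ g, ∃ s : R, a.coeff g = ℓ * s := by
    intro g
    have h1 := congrArg (fun z => z.coeff g) (RingHom.mem_ker.1 ha)
    simp only [redAlg, MonoidAlgebra.coeff_mapRingHom, MonoidAlgebra.coeff_zero,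
      Finsupp.coe_zero, Pi.zero_apply] at h1
    exact Ideal.mem_span_singleton.1 (Ideal.Quotient.eq_zero_iff_mem.1 h1)
  choose s hs using h
  obtain ⟨b, hb⟩ : ∃ b : MonoidAlgebra R (GL (Fin n) F), a = ℓ • b := by
    refine ⟨MonoidAlgebra.ofCoeff (Finsupp.equivFunOnFinite.symm s), ?_⟩
    ext g
    rw [MonoidAlgebra.coeff_smul, Finsupp.smul_apply, hs, nsmul_eq_mul]
    rfl
  refine RingHom.mem_ker.2 (AddMonoidHom.ext fun x => ?_)
  obtain ⟨y, rfl⟩ := Submodule.mkQ_surjective (ellMul n F R ℓ) x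
  change a • (ellMul n F R ℓ).mkQ y = 0
  rw [← map_smul, Submodule.mkQ_apply, Submodule.Quotient.mk_eq_zero]
  exact ⟨b • y, by rw [hb, smul_assoc]⟩

/-- The `KG`-module structure of `Ī`, induced by its `RG`-module structure
(see `redAlg_smul`). -/
noncomputable instance (ℓ : ℕ) : Module (MonoidAlgebra (Res R ℓ) (GL (Fin n) F)) (Red n F R ℓ) :=
  Module.compHom (Red n F R ℓ)
    ((redAlg n F R ℓ).liftOfSurjective (redAlg_surjective n F R ℓ)
      ⟨Module.toAddMonoidEnd (MonoidAlgebra R (GL (Fin n) F)) (Red n F R ℓ), redAlg_ker n F R ℓ⟩)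

theorem redAlg_smul (ℓ : ℕ) (a : MonoidAlgebra R (GL (Fin n) F)) (x : Red n F R ℓ) :
    redAlg n F R ℓ a • x = a • x := by
  have h := RingHom.liftOfRightInverse_comp_apply (redAlg n F R ℓ) _
    (Function.rightInverse_surjInv (redAlg_surjective n F R ℓ))
    ⟨Module.toAddMonoidEnd (MonoidAlgebra R (GL (Fin n) F)) (Red n F R ℓ), redAlg_ker n F R ℓ⟩ a
  exact congrArg (fun φ : AddMonoid.End (Red n F R ℓ) => φ x) h

/-- The `KG`-submodule `(I(k) + ℓI)/ℓI` of `Ī`. -/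
noncomputable def redFilt (ℓ k : ℕ) :
    Submodule (MonoidAlgebra (Res R ℓ) (GL (Fin n) F)) (Red n F R ℓ) where
  toAddSubmonoid := ((filt n F R ℓ k).map (toRed n F R ℓ)).toAddSubmonoid
  smul_mem' := fun a x hx => by
    obtain ⟨b, rfl⟩ := redAlg_surjective n F R ℓ a
    rw [redAlg_smul]
    exact ((filt n F R ℓ k).map (toRed n F R ℓ)).smul_mem b hx

/-- The factor `M(k)`, the quotient of `redFilt k` by `redFilt (k + 1)` (which is contained in
it), as a `KG`-module. -/
abbrev Factor (ℓ k : ℕ) : Type _ :=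
  redFilt n F R ℓ k ⧸ (redFilt n F R ℓ (k + 1)).submoduleOf (redFilt n F R ℓ k)

variable {n F R}

/-- The image in `M(k)` of an element of `I(k)`. -/
noncomputable def toFactor (ℓ k : ℕ) (x : lattice n F R) (hx : x ∈ filt n F R ℓ k) :
    Factor n F R ℓ k :=
  Submodule.Quotient.mk ⟨toRed n F R ℓ x, Submodule.mem_map_of_mem hx⟩

open Classical in
/-- The element `E_χ = ∑_{u ∈ U} χ(u) u e` of `I`. -/
noncomputable def charElt (χ : unitri n F →* Rˣ) : lattice n F R :=
  ∑ u : unitri n F,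
    (MonoidAlgebra.single (u : GL (Fin n) F) (χ u : R) : MonoidAlgebra R (GL (Fin n) F)) •
      latticeGen n F R

end Lattice

end SteinbergLattice

namespace SteinbergLattice

open Matrix

/-! ### Matrix identities in GL_n: permutations, shears, root elements, diagonal matrices -/

section MatrixGroups

variable {n : ℕ} {F : Type*} [Field F]

/-! The lattice I is spanned over R by the elements ue with u ∈ U (`unitriSpan_eq_top`), so the
operator ∑ χ(u)u maps I into R·E_χ. The value f(ue, e) counts the σ ∈ S_n with u ∈ σBσ⁻¹. Summing
against χ leaves those σ for which χ is trivial on U ∩ σBσ⁻¹, and the Bruhat decomposition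
identifies the resulting sum of the orders |U ∩ σBσ⁻¹| with [G : P_J(χ)]
(`gowForm_charElt_latticeGen`). Hence f(E_χ, I) = [G : P_J(χ)]R, so that E_χ ∈ I(k) exactly when ℓ^k
divides the index, and f(E_χ, E_{χ⁻¹}) = |U|[G : P_J(χ)], where |U| is a unit of R.

The form ℓ^{-k}f descends to an invariant form on M(k), and the images of E_χ and E_{χ⁻¹} pair to a
nonzero value when ν_ℓ([G : P_J(χ)]) = k. In particular these images are nonzero, so each of them
generates M(k) if M(k) is irreducible. This is one direction.

For the other, every nonzero representation of GL_n in which q is invertible contains a nonzero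
vector on which U acts by a linear character (`exists_unitri_eigenvector`). Such a vector in a
nonzero submodule N of M(k), lifted to I(k) and hit by ∑ χ(u)u, yields a unit multiple of some E_χ
with index of valuation k (`exists_toFactor_charElt_mem`). The diagonal matrices fix e and permute
transitively the χ with given J(χ), so N contains some E_Q and then, by hypothesis, E_P. Thus E_P
lies in all nonzero submodules. If it generated a proper submodule S, then S^⊥ would be a nonzero
submodule by dimension, hence would contain E_P. But E_P pairs nontrivially with the element E_{χ⁻¹}
for the inverse character, a torus translate of E_P and so an element of S. Therefore S = M(k), and
M(k) is irreducible (`isSimpleModule_of_form`). -/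

theorem mem_borel {g : GL (Fin n) F} :
    g ∈ borel n F ↔ ∀ i j, j < i → (g : Matrix (Fin n) (Fin n) F) i j = 0 :=
  ⟨fun h _ _ hij => h hij, fun h i j hij => h i j hij⟩

theorem mem_unitri {g : GL (Fin n) F} :
    g ∈ unitri n F ↔ (∀ i j, j < i → (g : Matrix (Fin n) (Fin n) F) i j = 0) ∧
      ∀ i, (g : Matrix (Fin n) (Fin n) F) i i = 1 :=
  and_congr_left fun _ => mem_borel

theorem permGL_apply (σ : Equiv.Perm (Fin n)) (a b : Fin n) :
    (permGL n F σ : Matrix (Fin n) (Fin n) F) a b = if a = σ b then 1 else 0 := by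
  change (permMatrixHom (R := F) σ) a b = _
  simp [Equiv.Perm.permMatrix, PEquiv.toMatrix_apply, Equiv.symm_apply_eq, Equiv.Perm.inv_def,
    Equiv.toPEquiv]

theorem permGL_mul_apply (σ : Equiv.Perm (Fin n)) (g : GL (Fin n) F) (a b : Fin n) :
    ((permGL n F σ * g : GL (Fin n) F) : Matrix (Fin n) (Fin n) F) a b =
      (g : Matrix (Fin n) (Fin n) F) (σ⁻¹ a) b := by
  rw [GeneralLinearGroup.coe_mul, Matrix.mul_apply, Finset.sum_eq_single (σ⁻¹ a)]
  · simp [permGL_apply]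
  · intro c _ hc
    rw [permGL_apply, if_neg, zero_mul]
    rintro rfl
    simp at hc
  · simp

theorem mul_permGL_apply (σ : Equiv.Perm (Fin n)) (g : GL (Fin n) F) (a b : Fin n) :
    ((g * permGL n F σ : GL (Fin n) F) : Matrix (Fin n) (Fin n) F) a b =
      (g : Matrix (Fin n) (Fin n) F) a (σ b) := by
  rw [GeneralLinearGroup.coe_mul, Matrix.mul_apply, Finset.sum_eq_single (σ b)]
  · simp [permGL_apply]
  · intro c _ hc
    rw [permGL_apply, if_neg hc, mul_zero]
  · simp

/-- Permutation matrices only relabel rows and columns, so membership of σ⁻¹gτ in B or in P_J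
becomes the vanishing of certain entries of g. -/
theorem permGL_inv_mul_mul_apply (σ τ : Equiv.Perm (Fin n)) (g : GL (Fin n) F) (a b : Fin n) :
    (((permGL n F σ)⁻¹ * g * permGL n F τ : GL (Fin n) F) : Matrix (Fin n) (Fin n) F) a b =
      (g : Matrix (Fin n) (Fin n) F) (σ a) (τ b) := by
  rw [mul_permGL_apply, ← map_inv, permGL_mul_apply, inv_inv]

/-- The element `1 + u wᵗ` of `GL_n(F)`, where `w · u = 0`. -/
def shear (u w : Fin n → F) (h : w ⬝ᵥ u = 0) : GL (Fin n) F where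
  val := 1 + vecMulVec u w
  inv := 1 - vecMulVec u w
  val_inv := by
    rw [mul_sub, mul_one, add_mul, one_mul, vecMulVec_mul_vecMulVec, h]
    simp
  inv_val := by
    rw [mul_add, mul_one, sub_mul, one_mul, vecMulVec_mul_vecMulVec, h]
    simp

theorem shear_apply (u w : Fin n → F) (h : w ⬝ᵥ u = 0) (a b : Fin n) :
    (shear u w h : Matrix (Fin n) (Fin n) F) a b = (1 : Matrix (Fin n) (Fin n) F) a b + u a * w b :=
  rfl

theorem shear_mul_apply (u w : Fin n → F) (h : w ⬝ᵥ u = 0) (g : GL (Fin n) F) (a b : Fin n) :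
    ((shear u w h * g : GL (Fin n) F) : Matrix (Fin n) (Fin n) F) a b =
      (g : Matrix (Fin n) (Fin n) F) a b + u a * (w ᵥ* (g : Matrix (Fin n) (Fin n) F)) b := by
  rw [GeneralLinearGroup.coe_mul]
  change ((1 + vecMulVec u w) * (g : Matrix (Fin n) (Fin n) F)) a b = _
  rw [add_mul, one_mul, vecMulVec_mul, Matrix.add_apply, vecMulVec_apply]

theorem shear_zero (w : Fin n → F) (h : w ⬝ᵥ 0 = 0) : shear 0 w h = 1 := by
  ext a b
  simp [shear_apply]

theorem shear_mul_shear (u u' w : Fin n → F) (h : w ⬝ᵥ u = 0) (h' : w ⬝ᵥ u' = 0) :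
    shear u w h * shear u' w h' = shear (u + u') w (by rw [dotProduct_add, h, h', add_zero]) := by
  apply Units.ext
  change (1 + vecMulVec u w) * (1 + vecMulVec u' w) = 1 + vecMulVec (u + u') w
  rw [add_mul, mul_add, mul_add, vecMulVec_mul_vecMulVec, h', add_vecMulVec]
  simp
  abel

theorem shear_inv (u w : Fin n → F) (h : w ⬝ᵥ u = 0) :
    (shear u w h)⁻¹ = shear (-u) w (by rw [dotProduct_neg, h, neg_zero]) := by
  rw [inv_eq_iff_mul_eq_one, shear_mul_shear]
  simp only [add_neg_cancel]
  exact shear_zero _ _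

/-- Conjugating `1 + c eᵗ` by `1 + u wᵗ`, when `e · u = 0`. -/
theorem shear_mul_comm (u w c e : Fin n → F) (h : w ⬝ᵥ u = 0) (h' : e ⬝ᵥ c = 0)
    (heu : e ⬝ᵥ u = 0) :
    shear u w h * shear c e h' =
      shear (c + (w ⬝ᵥ c) • u) e (by rw [dotProduct_add, dotProduct_smul, h', heu]; simp) *
        shear u w h := by
  apply Units.ext
  change (1 + vecMulVec u w) * (1 + vecMulVec c e) =
    (1 + vecMulVec (c + (w ⬝ᵥ c) • u) e) * (1 + vecMulVec u w)
  rw [add_mul, mul_add, mul_add, add_mul, mul_add, mul_add, vecMulVec_mul_vecMulVec,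
    vecMulVec_mul_vecMulVec, heu, add_vecMulVec, smul_vecMulVec, vecMulVec_smul]
  simp
  abel

theorem single_dotProduct_eq_zero {j : Fin n} {c : Fin n → F} (hc : ∀ i, j ≤ i → c i = 0) :
    Pi.single j 1 ⬝ᵥ c = 0 := by
  rw [single_dotProduct, one_mul, hc j le_rfl]

theorem shear_single_mem_unitri {j : Fin n} {c : Fin n → F} (hc : ∀ i, j ≤ i → c i = 0) :
    shear c (Pi.single j 1) (single_dotProduct_eq_zero hc) ∈ unitri n F := by
  rw [mem_unitri]
  refine ⟨fun a b hab => ?_, fun a => ?_⟩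
  · rw [shear_apply, one_apply_ne hab.ne']
    rcases eq_or_ne b j with rfl | hb
    · rw [hc a hab.le]; simp
    · simp [hb]
  · rw [shear_apply, one_apply_eq]
    rcases eq_or_ne a j with rfl | hb
    · rw [hc a le_rfl]; simp
    · simp [hb]

/-- `U` is generated by the elements that differ from `1` in a single column. -/
theorem unitri_le_of_shear_mem {S : Subgroup (GL (Fin n) F)}
    (hS : ∀ (j : Fin n) (c : Fin n → F) (hc : ∀ i, j ≤ i → c i = 0),
      shear c (Pi.single j 1) (single_dotProduct_eq_zero hc) ∈ S) : unitri n F ≤ S := by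
  -- Induction on the number m of leading columns that may differ from those of the identity.
  have key : ∀ m ≤ n, ∀ u ∈ unitri n F,
      (∀ i j : Fin n, m ≤ j → (u : Matrix (Fin n) (Fin n) F) i j =
        (1 : Matrix (Fin n) (Fin n) F) i j) → u ∈ S := by
    intro m
    induction m with
    | zero =>
      intro _ u _ h
      have : u = 1 := by
        ext i j
        exact h i j (Nat.zero_le _)
      exact this ▸ one_mem S
    | succ m ih =>
      intro hm u hu h
      let k : Fin n := ⟨m, hm⟩
      -- Left multiplication by the inverse shear subtracts c times row k. That row vanishes to the
      -- left of k, and also to the right of k since the later columns are those of the identity, so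
      -- only column k changes and it is cleared.
      let c : Fin n → F := fun i => if i < k then (u : Matrix (Fin n) (Fin n) F) i k else 0
      have hc : ∀ i, k ≤ i → c i = 0 := fun i hi => if_neg hi.not_gt
      have hmem := hS k c hc
      rw [← Subgroup.mul_mem_cancel_left S (inv_mem hmem)]
      have hu' := mem_unitri.1 hu
      refine ih (by omega) _ (mul_mem (inv_mem (shear_single_mem_unitri hc)) hu) fun i j hj => ?_
      rw [shear_inv, shear_mul_apply, single_one_vecMul, Pi.neg_apply]
      rcases (show k ≤ j from hj).eq_or_lt with rfl | hkj
      · change _ + -c i * (u : Matrix (Fin n) (Fin n) F) k k = _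
        rw [hu'.2]
        rcases lt_trichotomy i k with hik | rfl | hik
        · simp [c, hik, one_apply_ne hik.ne]
        · simp [c, hu'.2]
        · simp [c, hu'.1 i k hik, hik.not_gt, one_apply_ne hik.ne']
      · change _ + -c i * (u : Matrix (Fin n) (Fin n) F) k j = _
        rw [h k j hkj, one_apply_ne hkj.ne, mul_zero, add_zero, h i j hkj]
  intro u hu
  exact key n le_rfl u hu fun i j hj => absurd j.2 (by omega)

/-- The root element `1 + a E_{ij}`. -/
def rootElt (i j : Fin n) (hij : i ≠ j) (a : F) : GL (Fin n) F :=
  shear (Pi.single i a) (Pi.single j 1) (by simp [hij])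

theorem coe_rootElt (i j : Fin n) (hij : i ≠ j) (a : F) :
    (rootElt i j hij a : Matrix (Fin n) (Fin n) F) = transvection i j a := by
  ext p q
  rw [rootElt, shear_apply, transvection, Matrix.add_apply, Matrix.single_apply, Pi.single_apply,
    Pi.single_apply]
  grind

theorem rootElt_apply (i j : Fin n) (hij : i ≠ j) (a : F) (p q : Fin n) :
    (rootElt i j hij a : Matrix (Fin n) (Fin n) F) p q =
      (1 : Matrix (Fin n) (Fin n) F) p q + if p = i ∧ q = j then a else 0 := by
  rw [coe_rootElt, transvection, Matrix.add_apply, Matrix.single_apply]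
  simp only [eq_comm]

theorem rootElt_mul_rootElt (i j : Fin n) (hij : i ≠ j) (a b : F) :
    rootElt i j hij a * rootElt i j hij b = rootElt i j hij (a + b) := by
  rw [rootElt, rootElt, shear_mul_shear, rootElt]
  simp only [Pi.single_add]

theorem rootElt_zero (i j : Fin n) (hij : i ≠ j) : rootElt i j hij (0 : F) = 1 := by
  ext p q
  simp [rootElt_apply]

theorem rootElt_mem_unitri {i j : Fin n} (hij : i < j) (a : F) :
    rootElt i j hij.ne a ∈ unitri n F :=
  shear_single_mem_unitri fun k hk => by simp [(hij.trans_le hk).ne']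

theorem unitri_le_borel : unitri n F ≤ borel n F := fun _ h => h.1

/-- The diagonal matrices as elements of `GL_n(F)`. -/
def diagGL (d : Fin n → Fˣ) : GL (Fin n) F where
  val := diagonal fun i => (d i : F)
  inv := diagonal fun i => ((d i)⁻¹ : Fˣ)
  val_inv := by simp
  inv_val := by simp

theorem diagGL_apply (d : Fin n → Fˣ) (a b : Fin n) :
    (diagGL d : Matrix (Fin n) (Fin n) F) a b = if a = b then (d a : F) else 0 :=
  diagonal_apply _ _ _

theorem diagGL_mul_apply (d : Fin n → Fˣ) (g : GL (Fin n) F) (a b : Fin n) :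
    ((diagGL d * g : GL (Fin n) F) : Matrix (Fin n) (Fin n) F) a b =
      d a * (g : Matrix (Fin n) (Fin n) F) a b :=
  diagonal_mul _ _ _ _

theorem mul_diagGL_apply (d : Fin n → Fˣ) (g : GL (Fin n) F) (a b : Fin n) :
    ((g * diagGL d : GL (Fin n) F) : Matrix (Fin n) (Fin n) F) a b =
      (g : Matrix (Fin n) (Fin n) F) a b * d b :=
  mul_diagonal _ _ _ _

theorem diagGL_inv (d : Fin n → Fˣ) : (diagGL d : GL (Fin n) F)⁻¹ = diagGL d⁻¹ := rfl

theorem diagGL_mem_borel (d : Fin n → Fˣ) : (diagGL d : GL (Fin n) F) ∈ borel n F :=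
  mem_borel.2 fun i j hij => by rw [diagGL_apply, if_neg hij.ne']

theorem diag_ne_zero_of_mem_borel {b : GL (Fin n) F} (hb : b ∈ borel n F) (i : Fin n) :
    (b : Matrix (Fin n) (Fin n) F) i i ≠ 0 := by
  intro h
  have h1 := diag_mul_of_upper hb (inv_mem hb) i
  rw [mul_inv_cancel, h, zero_mul] at h1
  simp at h1

theorem exists_unitri_mul_diagGL {b : GL (Fin n) F} (hb : b ∈ borel n F) :
    ∃ u ∈ unitri n F, ∃ d, b = u * diagGL d := by
  let d : Fin n → Fˣ := fun i => Units.mk0 _ (diag_ne_zero_of_mem_borel hb i)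
  refine ⟨b * diagGL d⁻¹, mem_unitri.2 ⟨fun i j hij => ?_, fun i => ?_⟩, d, ?_⟩
  · rw [mul_diagGL_apply, mem_borel.1 hb i j hij, zero_mul]
  · rw [mul_diagGL_apply]
    simp only [Pi.inv_apply, Units.val_inv_eq_inv_val]
    exact mul_inv_cancel₀ (diag_ne_zero_of_mem_borel hb i)
  · rw [← diagGL_inv, inv_mul_cancel_right]

/-- An element supported on the diagonal and one position `(i, j)` stays upper triangular under
conjugation by permutations `σ` with `σ⁻¹ i < σ⁻¹ j`. -/
theorem permGL_conj_mem_borel {i j : Fin n} {y : GL (Fin n) F}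
    (hy : ∀ p q, (y : Matrix (Fin n) (Fin n) F) p q ≠ 0 → p = q ∨ p = i ∧ q = j)
    {σ : Equiv.Perm (Fin n)} (hσ : σ⁻¹ i < σ⁻¹ j) :
    (permGL n F σ)⁻¹ * y * permGL n F σ ∈ borel n F := by
  refine mem_borel.2 fun a b hab => ?_
  rw [permGL_inv_mul_mul_apply]
  by_contra h
  rcases hy _ _ h with h | ⟨rfl, rfl⟩
  · exact hab.ne' (σ.injective h)
  · simp at hσ
    exact lt_asymm hab hσ

theorem rootElt_support {i j : Fin n} (hij : i ≠ j) (a : F) (p q : Fin n)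
    (h : (rootElt i j hij a : Matrix (Fin n) (Fin n) F) p q ≠ 0) : p = q ∨ p = i ∧ q = j := by
  by_contra! hpq
  apply h
  rw [rootElt_apply, one_apply_ne hpq.1, if_neg (by tauto), add_zero]

set_option linter.unusedSimpArgs false in
/-- The rank one relation between a root element and the corresponding reflection. -/
theorem swap_mul_rootElt_mul_swap {i j : Fin n} (hij : i ≠ j) {a : F} (ha : a ≠ 0) :
    ∃ y : GL (Fin n) F,
      (∀ p q, (y : Matrix (Fin n) (Fin n) F) p q ≠ 0 → p = q ∨ p = i ∧ q = j) ∧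
      permGL n F (Equiv.swap i j) * rootElt i j hij a * permGL n F (Equiv.swap i j) =
        rootElt i j hij a⁻¹ * permGL n F (Equiv.swap i j) * y := by
  -- In the 2 × 2 block this is [[1, 0], [a, 1]] = [[1, a⁻¹], [0, 1]] · s · y with y = diag(a, −a⁻¹)
  -- · [[1, a⁻¹], [0, 1]].
  let d : Fin n → Fˣ := fun k =>
    if k = i then Units.mk0 a ha else if k = j then -(Units.mk0 a ha)⁻¹ else 1
  refine ⟨diagGL d * rootElt i j hij a⁻¹, fun p q h => ?_, ?_⟩
  · rw [diagGL_mul_apply] at h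
    exact rootElt_support hij _ p q (right_ne_zero_of_mul h)
  · ext p q
    have hs : (Equiv.swap i j)⁻¹ = Equiv.swap i j := Equiv.swap_inv i j
    rw [mul_permGL_apply, permGL_mul_apply, hs, mul_assoc, rootElt.eq_1 i j hij a⁻¹, shear_mul_apply,
      single_one_vecMul, Matrix.row, permGL_mul_apply, permGL_mul_apply, hs,
      Equiv.swap_apply_right, ← rootElt.eq_1 i j hij a⁻¹, diagGL_mul_apply, diagGL_mul_apply,
      rootElt_apply, rootElt_apply, rootElt_apply]
    have hji := hij.symm
    by_cases hpi : p = i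
    · subst hpi
      by_cases hqi : q = p
      · subst hqi
        simp [d, hij, hji, one_apply, ha]
      · by_cases hqj : q = j
        · subst hqj
          simp [d, hij, hji, one_apply, ha]
        · rw [Equiv.swap_apply_of_ne_of_ne hqi hqj]
          simp [d, hij, hji, one_apply, ha, hqi, hqj, Ne.symm hqi, Ne.symm hqj]
    · by_cases hpj : p = j
      · subst hpj
        by_cases hqi : q = i
        · subst hqi
          simp [d, hij, hji, one_apply, ha]
        · by_cases hqj : q = p
          · subst hqj
            simp [d, hij, hji, one_apply, ha]
          · rw [Equiv.swap_apply_of_ne_of_ne hqi hqj]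
            simp [d, hij, hji, one_apply, ha, hqi, hqj, Ne.symm hqi, Ne.symm hqj]
      · rw [Equiv.swap_apply_of_ne_of_ne hpi hpj]
        by_cases hqi : q = i
        · subst hqi
          simp [d, hij, hji, one_apply, ha, hpi, hpj]
        · by_cases hqj : q = j
          · subst hqj
            simp [d, hij, hji, one_apply, ha, hpi, hpj]
          · rw [Equiv.swap_apply_of_ne_of_ne hqi hqj]
            simp [d, hij, hji, one_apply, ha, hpi, hpj, hqi, hqj]

end MatrixGroups

/-! ### Coset representatives in the symmetric group -/

section Weyl

variable {n : ℕ}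

theorem lt_of_mem_simpleRoots {r : Fin n × Fin n} (hr : r ∈ simpleRoots n) : r.1 < r.2 := by
  have : (r.1 : ℕ) + 1 = r.2 := hr
  exact Fin.lt_def.2 (by omega)

/-- The subgroup `W_J` of `S_n` generated by the reflections `w_r`, `r ∈ J`. -/
def reflSubgroup (J : Set (Fin n × Fin n)) : Subgroup (Equiv.Perm (Fin n)) :=
  Subgroup.closure {σ | ∃ r ∈ J, σ = Equiv.swap r.1 r.2}

theorem swap_mem_reflSubgroup {J : Set (Fin n × Fin n)} {r : Fin n × Fin n} (hr : r ∈ J) :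
    Equiv.swap r.1 r.2 ∈ reflSubgroup J :=
  Subgroup.subset_closure ⟨r, hr, rfl⟩

/-- The rearrangement inequality. The sum ∑ a·τ(a) serves as a potential that grows when a descent
is removed. -/
theorem sum_lt_sum_mul_swap {τ : Equiv.Perm (Fin n)} {i j : Fin n} (hij : i < j)
    (h : τ j < τ i) :
    ∑ a : Fin n, ((a : ℕ) : ℤ) * (τ a : ℕ) < ∑ a : Fin n, ((a : ℕ) : ℤ) * ((τ * Equiv.swap i j) a : ℕ) := by
  have h1 : ∑ a : Fin n, ((a : ℕ) : ℤ) * ((τ * Equiv.swap i j) a : ℕ) =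
      ∑ a : Fin n, ((Equiv.swap i j a : ℕ) : ℤ) * (τ a : ℕ) :=
    Fintype.sum_equiv (Equiv.swap i j) _ _ fun a => by simp
  rw [h1, ← sub_pos, ← Finset.sum_sub_distrib, Finset.sum_eq_add i j hij.ne]
  · simp only [Equiv.swap_apply_left, Equiv.swap_apply_right]
    have h2 : ((i : ℕ) : ℤ) < (j : ℕ) := by exact_mod_cast hij
    have h3 : ((τ j : ℕ) : ℤ) < (τ i : ℕ) := by exact_mod_cast h
    nlinarith
  · intro c _ hc
    rw [Equiv.swap_apply_of_ne_of_ne hc.1 hc.2, sub_self]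
  · simp
  · simp

/-- Each coset `σ W_J` has an element that is increasing along the roots in `J`. -/
theorem exists_increasing {J : Set (Fin n × Fin n)} (hJ : J ⊆ simpleRoots n)
    (σ : Equiv.Perm (Fin n)) :
    ∃ w ∈ reflSubgroup J, ∀ r ∈ J, (σ * w) r.1 < (σ * w) r.2 := by
  -- At a maximum of the potential over the coset there is no descent along J, since multiplying by
  -- w_r would raise it.
  obtain ⟨w, hw⟩ := Finite.exists_max
    (fun w : reflSubgroup J => ∑ a : Fin n, ((a : ℕ) : ℤ) * ((σ * (w : Equiv.Perm (Fin n))) a : ℕ))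
  refine ⟨w, w.2, fun r hr => ?_⟩
  have hlt := lt_of_mem_simpleRoots (hJ hr)
  by_contra! h
  have h' := h.lt_of_ne fun he => hlt.ne ((σ * (w : Equiv.Perm (Fin n))).injective he.symm)
  have := hw ⟨w * Equiv.swap r.1 r.2, mul_mem w.2 (swap_mem_reflSubgroup hr)⟩
  exact absurd (sum_lt_sum_mul_swap hlt h') (by simpa only [mul_assoc] using this.not_gt)

theorem perm_eq_one_of_strictMono {σ : Equiv.Perm (Fin n)} (h : StrictMono σ) : σ = 1 :=
  Equiv.ext fun a => congrFun
    ((h.range_inj strictMono_id).1 (by rw [σ.surjective.range_eq, Set.range_id])) a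

open Classical in
/-- The number of the block of `a` in the block decomposition defined by `J`. -/
noncomputable def block (J : Set (Fin n × Fin n)) (a : Fin n) : ℕ :=
  (Finset.univ.filter fun r : Fin n × Fin n => r ∈ simpleRoots n ∧ r ∉ J ∧ r.2 ≤ a).card

theorem block_mono (J : Set (Fin n × Fin n)) : Monotone (block J) := by
  classical
  intro a b hab
  refine Finset.card_le_card fun r => ?_
  simp only [Finset.mem_filter, Finset.mem_univ, true_and]
  exact fun h => ⟨h.1, h.2.1, h.2.2.trans hab⟩

theorem block_lt_of_notMem {J : Set (Fin n × Fin n)} {r : Fin n × Fin n}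
    (hr : r ∈ simpleRoots n) (hJ : r ∉ J) : block J r.1 < block J r.2 := by
  classical
  refine Finset.card_lt_card ⟨fun s => ?_, fun h => ?_⟩
  · simp only [Finset.mem_filter, Finset.mem_univ, true_and]
    exact fun h => ⟨h.1, h.2.1, h.2.2.trans (lt_of_mem_simpleRoots hr).le⟩
  · have := h (Finset.mem_filter.2 ⟨Finset.mem_univ r, hr, hJ, le_rfl⟩)
    exact (Finset.mem_filter.1 this).2.2.2.not_gt (lt_of_mem_simpleRoots hr)

theorem block_eq_of_mem {J : Set (Fin n × Fin n)} {r : Fin n × Fin n}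
    (hr : r ∈ simpleRoots n) (hJ : r ∈ J) : block J r.1 = block J r.2 := by
  classical
  refine (block_mono J (lt_of_mem_simpleRoots hr).le).antisymm (Finset.card_le_card fun s => ?_)
  simp only [Finset.mem_filter, Finset.mem_univ, true_and]
  rintro ⟨h1, h2, h3⟩
  refine ⟨h1, h2, ?_⟩
  have h4 : (s.1 : ℕ) + 1 = s.2 := h1
  have h5 : (r.1 : ℕ) + 1 = r.2 := hr
  rcases h3.eq_or_lt with h | h
  · have : s = r := Prod.ext (Fin.ext (by rw [h] at h4; omega)) h
    exact absurd hJ (this ▸ h2)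
  · exact Fin.le_def.2 (by have := Fin.lt_def.1 h; omega)

/-- All fundamental roots between two indices of one block belong to J, so the inequalities along J
chain together. -/
theorem lt_of_increasing_of_block_eq {J : Set (Fin n × Fin n)} {τ : Equiv.Perm (Fin n)}
    (hτ : ∀ r ∈ J, τ r.1 < τ r.2) {a b : Fin n} (hab : a < b) (hbl : block J a = block J b) :
    τ a < τ b := by
  obtain ⟨b, hb⟩ := b
  induction b with
  | zero => exact absurd hab (Nat.not_lt_zero _)
  | succ m ih =>
    have hr : ((⟨m, by omega⟩, ⟨m + 1, hb⟩) : Fin n × Fin n) ∈ simpleRoots n := rfl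
    have hle : a ≤ ⟨m, by omega⟩ := Fin.le_def.2 (Nat.lt_succ_iff.1 hab)
    have hmem : ((⟨m, by omega⟩, ⟨m + 1, hb⟩) : Fin n × Fin n) ∈ J := by
      by_contra hJ
      have h1 := block_lt_of_notMem hr hJ
      have h2 := block_mono J hle
      dsimp only at h1
      omega
    rcases hle.eq_or_lt with h | h
    · exact h ▸ hτ _ hmem
    · exact (ih (by omega) h (hbl.trans (block_eq_of_mem hr hmem).symm)).trans (hτ _ hmem)

/-- The permutation τ⁻¹σ preserves every block and is increasing inside each, so it is strictly
monotone on `Fin n`. This is the uniqueness of J-increasing coset representatives. -/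
theorem perm_eq_of_increasing {J : Set (Fin n × Fin n)} {σ τ : Equiv.Perm (Fin n)}
    (hσ : ∀ r ∈ J, σ r.1 < σ r.2) (hτ : ∀ r ∈ J, τ r.1 < τ r.2)
    (h : ∀ a, block J (τ⁻¹ a) = block J (σ⁻¹ a)) : σ = τ := by
  have hbl : ∀ a, block J ((τ⁻¹ * σ) a) = block J a := fun a => by
    have := h (σ a)
    simpa using this
  have hmono : StrictMono ⇑(τ⁻¹ * σ) := by
    intro a b hab
    rcases (block_mono J hab.le).lt_or_eq with hlt | heq
    · refine lt_of_not_ge fun hle => ?_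
      have := block_mono J hle
      rw [hbl, hbl] at this
      omega
    · have h1 := lt_of_increasing_of_block_eq hσ hab heq
      by_contra! hle
      rcases hle.eq_or_lt with he | hlt
      · exact hab.ne ((τ⁻¹ * σ).injective he).symm
      · have h2 := lt_of_increasing_of_block_eq hτ hlt (by rw [hbl, hbl, heq])
        exact lt_asymm h1 (by simpa using h2)
  have := perm_eq_one_of_strictMono hmono
  rwa [inv_mul_eq_one, eq_comm] at this

theorem perm_eq_one_of_increasing {σ : Equiv.Perm (Fin n)}
    (hσ : ∀ r ∈ simpleRoots n, σ r.1 < σ r.2) : σ = 1 :=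
  perm_eq_of_increasing hσ (fun _ hr => lt_of_mem_simpleRoots hr) fun a => by
    have : ∀ c d : Fin n, block (simpleRoots n) c = block (simpleRoots n) d := fun c d => by
      classical
      unfold block
      congr 1
      ext r
      simp only [Finset.mem_filter]
      tauto
    exact this _ _

theorem reflSubgroup_simpleRoots : reflSubgroup (simpleRoots n) = ⊤ := by
  rw [eq_top_iff]
  intro σ _
  obtain ⟨w, hw, h⟩ := exists_increasing subset_rfl σ
  rw [eq_inv_of_mul_eq_one_left (perm_eq_one_of_increasing h)]
  exact inv_mem hw

end Weyl

/-! ### Parabolic subgroups and the Bruhat decomposition -/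

section Parabolic

variable {n : ℕ} {F : Type*} [Field F]

theorem borel_le_parabolic (J : Set (Fin n × Fin n)) : borel n F ≤ parabolic n F J :=
  fun _ h => Subgroup.subset_closure (Or.inl h)

theorem permGL_swap_mem_parabolic {J : Set (Fin n × Fin n)} {r : Fin n × Fin n} (hr : r ∈ J) :
    permGL n F (Equiv.swap r.1 r.2) ∈ parabolic n F J :=
  Subgroup.subset_closure (Or.inr ⟨r, hr, rfl⟩)

theorem permGL_mem_parabolic {J : Set (Fin n × Fin n)} {w : Equiv.Perm (Fin n)}
    (hw : w ∈ reflSubgroup J) : permGL n F w ∈ parabolic n F J := by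
  have : reflSubgroup J ≤ (parabolic n F J).comap (permGL n F) := by
    rw [reflSubgroup, Subgroup.closure_le]
    rintro _ ⟨r, hr, rfl⟩
    exact permGL_swap_mem_parabolic hr
  exact this hw

/-- Elements of `P_J` are block upper triangular. -/
theorem apply_eq_zero_of_mem_parabolic {J : Set (Fin n × Fin n)} (hJ : J ⊆ simpleRoots n)
    {g : GL (Fin n) F} (hg : g ∈ parabolic n F J) :
    BlockTriangular (g : Matrix (Fin n) (Fin n) F) (block J) := by
  induction hg using Subgroup.closure_induction with
  | mem g hg =>
    rcases hg with hg | ⟨r, hr, rfl⟩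
    · intro i j hij
      exact hg (lt_of_not_ge fun h => (block_mono J h).not_gt hij)
    · intro i j hij
      rw [permGL_apply, if_neg]
      rintro rfl
      have h := block_eq_of_mem (hJ hr) hr
      rcases eq_or_ne j r.1 with rfl | h1
      · rw [Equiv.swap_apply_left] at hij
        omega
      · rcases eq_or_ne j r.2 with rfl | h2
        · rw [Equiv.swap_apply_right] at hij
          omega
        · rw [Equiv.swap_apply_of_ne_of_ne h1 h2] at hij
          omega
  | one => exact blockTriangular_one
  | mul a b _ _ ha hb => simpa using BlockTriangular.mul ha hb
  | inv a _ ha => simpa using blockTriangular_inv_of_blockTriangular ha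

/-- For r ∉ J the matrix w_r has a 1 at (r.2, r.1), below the block diagonal. -/
theorem mem_of_permGL_swap_mem_parabolic {J : Set (Fin n × Fin n)} (hJ : J ⊆ simpleRoots n)
    {r : Fin n × Fin n} (hr : r ∈ simpleRoots n)
    (h : permGL n F (Equiv.swap r.1 r.2) ∈ parabolic n F J) : r ∈ J := by
  by_contra hrJ
  have := apply_eq_zero_of_mem_parabolic hJ h (block_lt_of_notMem hr hrJ)
  rw [permGL_apply, Equiv.swap_apply_left, if_pos rfl] at this
  exact one_ne_zero this

theorem parabolic_injective {J J' : Set (Fin n × Fin n)} (hJ : J ⊆ simpleRoots n)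
    (hJ' : J' ⊆ simpleRoots n) (h : parabolic n F J = parabolic n F J') : J = J' :=
  Set.Subset.antisymm
    (fun _ hr => mem_of_permGL_swap_mem_parabolic hJ' (hJ hr) (h ▸ permGL_swap_mem_parabolic hr))
    (fun _ hr => mem_of_permGL_swap_mem_parabolic hJ (hJ' hr) (h ▸ permGL_swap_mem_parabolic hr))

/-- A subgroup containing B and σ contains σBσ⁻¹, and y lies in it. -/
theorem mem_of_permGL_mem {H : Subgroup (GL (Fin n) F)} (hB : borel n F ≤ H)
    {i j : Fin n} {y : GL (Fin n) F}
    (hy : ∀ p q, (y : Matrix (Fin n) (Fin n) F) p q ≠ 0 → p = q ∨ p = i ∧ q = j)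
    {σ : Equiv.Perm (Fin n)} (hσ : permGL n F σ ∈ H) (h : σ⁻¹ i < σ⁻¹ j) : y ∈ H := by
  have h1 := hB (permGL_conj_mem_borel hy h)
  rwa [Subgroup.mul_mem_cancel_right _ hσ, Subgroup.mul_mem_cancel_left _ (inv_mem hσ)] at h1

/-- `P_J = G` when `J` consists of all fundamental roots. -/
theorem parabolic_simpleRoots : parabolic n F (simpleRoots n) = ⊤ := by
  have hperm : ∀ σ, permGL n F σ ∈ parabolic n F (simpleRoots n) := fun σ =>
    permGL_mem_parabolic (by rw [reflSubgroup_simpleRoots]; trivial)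
  have hroot : ∀ (i j : Fin n) (hij : i ≠ j) (a : F),
      rootElt i j hij a ∈ parabolic n F (simpleRoots n) := by
    intro i j hij a
    rcases lt_or_gt_of_ne hij with h | h
    · exact borel_le_parabolic _ (unitri_le_borel (rootElt_mem_unitri h a))
    -- A root element below the diagonal is conjugate into B by the transposition (i j).
    · exact mem_of_permGL_mem (borel_le_parabolic _) (rootElt_support hij a)
        (hperm (Equiv.swap i j)) (by simpa using h)
  rw [eq_top_iff]
  intro g _
  have key : ∃ g' ∈ parabolic n F (simpleRoots n),
      (g' : Matrix (Fin n) (Fin n) F) = (g : Matrix (Fin n) (Fin n) F) := by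
    refine diagonal_transvection_induction_of_det_ne_zero
      (fun M => ∃ g' ∈ parabolic n F (simpleRoots n), (g' : Matrix (Fin n) (Fin n) F) = M) _
      (GeneralLinearGroup.det_ne_zero g) (fun D hD => ?_) (fun t => ?_) ?_
    · rw [det_diagonal, Finset.prod_ne_zero_iff] at hD
      exact ⟨diagGL fun i => Units.mk0 (D i) (hD i (Finset.mem_univ i)),
        borel_le_parabolic _ (diagGL_mem_borel _), rfl⟩
    · exact ⟨rootElt t.i t.j t.hij t.c, hroot _ _ _ _, coe_rootElt _ _ _ _⟩
    · rintro _ _ _ _ ⟨a, ha, rfl⟩ ⟨b, hb, rfl⟩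
      exact ⟨a * b, mul_mem ha hb, rfl⟩
  obtain ⟨g', hg', h⟩ := key
  exact Units.ext h ▸ hg'

theorem permGL_swap_inv (i j : Fin n) :
    (permGL n F (Equiv.swap i j))⁻¹ = permGL n F (Equiv.swap i j) := by
  rw [← map_inv, Equiv.swap_inv]

/-- The induction principle given by the generation of `GL_n(F)` by `B` and the fundamental
reflections. -/
theorem induction_left {p : GL (Fin n) F → Prop} (one : p 1)
    (borel_mul : ∀ b ∈ borel n F, ∀ g, p g → p (b * g))
    (swap_mul : ∀ r ∈ simpleRoots n, ∀ g, p g → p (permGL n F (Equiv.swap r.1 r.2) * g))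
    (g : GL (Fin n) F) : p g := by
  have hg : g ∈ parabolic n F (simpleRoots n) := by rw [parabolic_simpleRoots]; trivial
  rw [parabolic] at hg
  induction hg using Subgroup.closure_induction_left with
  | one => exact one
  | mul_left x hx y _ hy =>
    rcases hx with hx | ⟨r, hr, rfl⟩
    · exact borel_mul x hx y hy
    · exact swap_mul r hr y hy
  | inv_mul_cancel x hx y _ hy =>
    rcases hx with hx | ⟨r, hr, rfl⟩
    · exact borel_mul _ (inv_mem hx) y hy
    · rw [permGL_swap_inv]
      exact swap_mul r hr y hy

/-- Splitting off the root element of a fundamental root from an element of `U`. -/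
theorem exists_unitri_eq_mul_rootElt {r : Fin n × Fin n} (hr : r ∈ simpleRoots n)
    {u : GL (Fin n) F} (hu : u ∈ unitri n F) :
    ∃ v ∈ unitri n F, ∃ a, u = v * rootElt r.1 r.2 (lt_of_mem_simpleRoots hr).ne a ∧
      permGL n F (Equiv.swap r.1 r.2) * v * permGL n F (Equiv.swap r.1 r.2) ∈ unitri n F := by
  obtain ⟨i, j⟩ := r
  have hij : i < j := lt_of_mem_simpleRoots hr
  have hr' : (i : ℕ) + 1 = j := hr
  dsimp only
  set a := (u : Matrix (Fin n) (Fin n) F) i j with ha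
  have hv : u * rootElt i j hij.ne (-a) ∈ unitri n F := mul_mem hu (rootElt_mem_unitri hij _)
  -- As j = i + 1, the entry at (i, j) is the only one above the diagonal that conjugation by w_r
  -- moves below it.
  have hv0 : ((u * rootElt i j hij.ne (-a) : GL (Fin n) F) : Matrix (Fin n) (Fin n) F) i j = 0 := by
    rw [GeneralLinearGroup.coe_mul, coe_rootElt, mul_transvection_apply_same, (mem_unitri.1 hu).2 i,
      ← ha]
    ring
  refine ⟨_, hv, a, by rw [mul_assoc, rootElt_mul_rootElt, neg_add_cancel, rootElt_zero, mul_one],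
    ?_⟩
  generalize u * rootElt i j hij.ne (-a) = v at hv hv0
  have happ := fun p q => permGL_inv_mul_mul_apply (Equiv.swap i j) (Equiv.swap i j) v p q
  rw [permGL_swap_inv] at happ
  have hv' := mem_unitri.1 hv
  refine mem_unitri.2 ⟨fun p q hpq => ?_, fun p => ?_⟩
  · rw [happ]
    rcases eq_or_ne p j with rfl | hpj
    · rcases eq_or_ne q i with rfl | hqi
      · simpa using hv0
      · have : q < i := lt_of_le_of_ne (Fin.le_def.2 (by have := Fin.lt_def.1 hpq; omega)) hqi
        rw [Equiv.swap_apply_right, Equiv.swap_apply_of_ne_of_ne hqi hpq.ne]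
        exact hv'.1 _ _ this
    · apply hv'.1
      rcases eq_or_ne p i with rfl | hpi
      · rw [Equiv.swap_apply_left, Equiv.swap_apply_of_ne_of_ne hpq.ne (hpq.trans hij).ne]
        exact hpq.trans hij
      · rw [Equiv.swap_apply_of_ne_of_ne hpi hpj]
        rcases eq_or_ne q i with rfl | hqi
        · rw [Equiv.swap_apply_left]
          exact lt_of_le_of_ne (Fin.le_def.2 (by have := Fin.lt_def.1 hpq; omega)) hpj.symm
        · rcases eq_or_ne q j with rfl | hqj
          · rw [Equiv.swap_apply_right]
            exact hij.trans hpq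
          · rwa [Equiv.swap_apply_of_ne_of_ne hqi hqj]
  · rw [happ]
    exact hv'.2 _

/-- The Bruhat decomposition `G = U W B`. -/
theorem exists_bruhat (g : GL (Fin n) F) :
    ∃ u ∈ unitri n F, ∃ σ, ∃ b ∈ borel n F, g = u * permGL n F σ * b := by
  -- The permutation matrices normalize the diagonal torus, so a diagonal factor passes through σ
  -- into B.
  have torus : ∀ (d : Fin n → Fˣ) (σ : Equiv.Perm (Fin n)), ∃ b ∈ borel n F,
      diagGL d * permGL n F σ = permGL n F σ * b := fun d σ => by
    refine ⟨(permGL n F σ)⁻¹ * diagGL d * permGL n F σ, mem_borel.2 fun p q hpq => ?_, by group⟩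
    rw [permGL_inv_mul_mul_apply, diagGL_apply, if_neg fun h => hpq.ne' (σ.injective h)]
  have borel_mul : ∀ c ∈ borel n F, ∀ g : GL (Fin n) F,
      (∃ u ∈ unitri n F, ∃ σ, ∃ b ∈ borel n F, g = u * permGL n F σ * b) →
      ∃ u ∈ unitri n F, ∃ σ, ∃ b ∈ borel n F, c * g = u * permGL n F σ * b := by
    rintro c hc _ ⟨u, hu, σ, b, hb, rfl⟩
    obtain ⟨v, hv, d, hvd⟩ := exists_unitri_mul_diagGL (mul_mem hc (unitri_le_borel hu))
    obtain ⟨b', hb', h'⟩ := torus d σ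
    refine ⟨v, hv, σ, b' * b, mul_mem hb' hb, ?_⟩
    calc c * (u * permGL n F σ * b) = (c * u) * permGL n F σ * b := by group
      _ = v * (diagGL d * permGL n F σ) * b := by rw [hvd]; group
      _ = v * permGL n F σ * (b' * b) := by rw [h']; group
  refine induction_left ⟨1, one_mem _, 1, 1, one_mem _, by simp⟩ borel_mul ?_ g
  rintro ⟨i, j⟩ hr _ ⟨u, hu, σ, b, hb, rfl⟩
  have hij : i < j := lt_of_mem_simpleRoots hr
  dsimp only
  set s := permGL n F (Equiv.swap i j) with hs
  have hss : s * s = 1 := by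
    rw [hs, ← map_mul, Equiv.swap_mul_self, map_one]
  obtain ⟨v, hv, a, rfl, hsv⟩ := exists_unitri_eq_mul_rootElt hr hu
  dsimp only at hsv
  rw [← hs] at hsv
  have e : s * (v * rootElt i j hij.ne a * permGL n F σ * b) =
      (s * v * s) * (s * rootElt i j hij.ne a * permGL n F σ * b) := by
    simp only [mul_assoc, ← mul_assoc s s, hss, one_mul]
  rw [e]
  refine borel_mul _ (unitri_le_borel hsv) _ ?_
  -- If σ⁻¹ keeps i before j, the root element x passes through σ into B and the cell is that of sσ.
  -- Otherwise, for x ≠ 1, write sxs = x'sy by the rank one relation; y passes through sσ into B,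
  -- and the cell is that of σ.
  by_cases hσ : σ⁻¹ i < σ⁻¹ j
  · refine ⟨1, one_mem _, Equiv.swap i j * σ, _,
      mul_mem (permGL_conj_mem_borel (rootElt_support hij.ne a) hσ) hb, ?_⟩
    rw [map_mul, ← hs]
    group
  · by_cases ha : a = 0
    · subst ha
      exact ⟨1, one_mem _, Equiv.swap i j * σ, b, hb, by
        rw [rootElt_zero, map_mul, ← hs]; group⟩
    · obtain ⟨y, hy, hyeq⟩ := swap_mul_rootElt_mul_swap hij.ne ha
      rw [← hs] at hyeq
      have hlt : (Equiv.swap i j * σ)⁻¹ i < (Equiv.swap i j * σ)⁻¹ j := by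
        rw [_root_.mul_inv_rev, Equiv.swap_inv]
        simpa using lt_of_le_of_ne (not_lt.1 hσ) fun h => hij.ne (σ⁻¹.injective h.symm)
      refine ⟨rootElt i j hij.ne a⁻¹, rootElt_mem_unitri hij _, σ, _,
        mul_mem (permGL_conj_mem_borel hy hlt) hb, ?_⟩
      rw [map_mul, ← hs]
      calc s * rootElt i j hij.ne a * permGL n F σ * b
          = (s * rootElt i j hij.ne a * s) * (s * permGL n F σ) * b := by
            simp only [mul_assoc, ← mul_assoc s s, hss, one_mul]
        _ = _ := by
          rw [hyeq]
          have : s⁻¹ = s := permGL_swap_inv i j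
          simp only [_root_.mul_inv_rev, this, mul_assoc, mul_inv_cancel_left]

/-- Every subgroup of `G` containing `B` is of the form `P_J`. -/
theorem eq_parabolic_of_borel_le {P : Subgroup (GL (Fin n) F)} (hP : borel n F ≤ P) :
    parabolic n F {r | r ∈ simpleRoots n ∧ permGL n F (Equiv.swap r.1 r.2) ∈ P} = P := by
  set J := {r | r ∈ simpleRoots n ∧ permGL n F (Equiv.swap r.1 r.2) ∈ P}
  have hJ : J ⊆ simpleRoots n := fun r hr => hr.1
  have hle : parabolic n F J ≤ P := by
    rw [parabolic, Subgroup.closure_le]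
    rintro _ (h | ⟨r, hr, rfl⟩)
    · exact hP h
    · exact hr.2
  refine le_antisymm hle fun g hg => ?_
  obtain ⟨u, hu, σ, b, hb, rfl⟩ := exists_bruhat g
  have hu' := unitri_le_borel hu
  rw [Subgroup.mul_mem_cancel_right _ (hP hb), Subgroup.mul_mem_cancel_left _ (hP hu')] at hg
  refine mul_mem (mul_mem (borel_le_parabolic J hu') ?_) (borel_le_parabolic J hb)
  -- It suffices that the J-increasing representative τ of σ⁻¹W_J is 1, for then σ = w ∈ W_J.
  obtain ⟨w, hw, h⟩ := exists_increasing hJ σ⁻¹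
  set τ := σ⁻¹ * w with hτ
  have hτP : permGL n F τ ∈ P := by
    rw [hτ, map_mul, map_inv]
    exact mul_mem (inv_mem hg) (hle (permGL_mem_parabolic hw))
  have hτ1 : τ = 1 := by
    refine perm_eq_one_of_increasing fun r hr => ?_
    by_contra! hlt
    have hr' := lt_of_mem_simpleRoots hr
    have hlt' := hlt.lt_of_ne fun he => hr'.ne (τ.injective he.symm)
    refine absurd hlt' (lt_asymm (h r ⟨hr, ?_⟩))
    -- A descent of τ along r puts the root elements of the opposite root into P. The rank one
    -- relation sxs = x'sy then gives s ∈ P, that is r ∈ J, along which τ increases.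
    obtain ⟨i, j⟩ := r
    dsimp only at hr' hlt' ⊢
    obtain ⟨y, hy, hyeq⟩ := swap_mul_rootElt_mul_swap hr'.ne (one_ne_zero (α := F))
    set s := permGL n F (Equiv.swap i j) with hs
    have hyP : y ∈ P := mem_of_permGL_mem hP hy (σ := 1) (by simp) hr'
    have hz : s * rootElt i j hr'.ne 1 * s ∈ P := by
      refine mem_of_permGL_mem hP (i := j) (j := i) (fun p q hpq => ?_) (inv_mem hτP)
        (σ := τ⁻¹) (by simpa using hlt')
      rw [mul_permGL_apply, permGL_mul_apply, Equiv.swap_inv] at hpq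
      refine (rootElt_support hr'.ne 1 _ _ hpq).imp (fun h => (Equiv.swap i j).injective h) ?_
      rintro ⟨h1, h2⟩
      exact ⟨by rw [← Equiv.swap_apply_self i j p, h1, Equiv.swap_apply_left],
        by rw [← Equiv.swap_apply_self i j q, h2, Equiv.swap_apply_right]⟩
    rwa [hyeq, Subgroup.mul_mem_cancel_right _ hyP, Subgroup.mul_mem_cancel_left _
      (hP (unitri_le_borel (rootElt_mem_unitri hr' _)))] at hz
  rw [show σ = w by rw [hτ, inv_mul_eq_one] at hτ1; exact hτ1]
  exact permGL_mem_parabolic hw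

end Parabolic

/-! ### The index of a parabolic subgroup as a sum over permutations -/

section Index

variable {n : ℕ} {F : Type*} [Field F]

/-- The subgroup `U ∩ σBσ⁻¹` of `U`. -/
def unitriConj (F : Type*) [Field F] (σ : Equiv.Perm (Fin n)) : Subgroup (unitri n F) :=
  ((borel n F).comap (MulAut.conj (permGL n F σ)⁻¹).toMonoidHom).subgroupOf (unitri n F)

theorem mem_unitriConj_iff_conj {σ : Equiv.Perm (Fin n)} {u : unitri n F} :
    u ∈ unitriConj F σ ↔ (permGL n F σ)⁻¹ * (u : GL (Fin n) F) * permGL n F σ ∈ borel n F := by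
  simp [unitriConj, Subgroup.mem_subgroupOf]

theorem mem_unitriConj {σ : Equiv.Perm (Fin n)} {u : unitri n F} :
    u ∈ unitriConj F σ ↔ ∀ a b, a < b → σ⁻¹ b < σ⁻¹ a →
      ((u : GL (Fin n) F) : Matrix (Fin n) (Fin n) F) a b = 0 := by
  rw [mem_unitriConj_iff_conj, mem_borel]
  constructor
  · intro h a b _ hab
    have := h _ _ hab
    rw [permGL_inv_mul_mul_apply] at this
    simpa using this
  · intro h a b hab
    rw [permGL_inv_mul_mul_apply]
    rcases lt_trichotomy (σ a) (σ b) with hlt | heq | hlt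
    · exact h _ _ hlt (by simpa using hab)
    · exact absurd (σ.injective heq) hab.ne'
    · exact (mem_unitri.1 u.2).1 _ _ hlt

/-- The pairs `a < b` whose order is preserved by `σ⁻¹`. -/
def coinversions (σ : Equiv.Perm (Fin n)) : Finset (Fin n × Fin n) :=
  Finset.univ.filter fun p => p.1 < p.2 ∧ σ⁻¹ p.1 < σ⁻¹ p.2

/-- The pairs `a < b` whose order is reversed by `σ⁻¹`. -/
def inversions (σ : Equiv.Perm (Fin n)) : Finset (Fin n × Fin n) :=
  Finset.univ.filter fun p => p.1 < p.2 ∧ σ⁻¹ p.2 < σ⁻¹ p.1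

theorem mem_coinversions {σ : Equiv.Perm (Fin n)} {p : Fin n × Fin n} :
    p ∈ coinversions σ ↔ p.1 < p.2 ∧ σ⁻¹ p.1 < σ⁻¹ p.2 := by
  simp [coinversions]

theorem mem_inversions {σ : Equiv.Perm (Fin n)} {p : Fin n × Fin n} :
    p ∈ inversions σ ↔ p.1 < p.2 ∧ σ⁻¹ p.2 < σ⁻¹ p.1 := by
  simp [inversions]

theorem card_inversions_add_card_coinversions (σ : Equiv.Perm (Fin n)) :
    (inversions σ).card + (coinversions σ).card =
      (coinversions (1 : Equiv.Perm (Fin n))).card := by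
  rw [← Finset.card_union_of_disjoint]
  · congr 1
    ext p
    simp only [Finset.mem_union, mem_inversions, mem_coinversions, inv_one, Equiv.Perm.one_apply,
      and_self]
    constructor
    · rintro (h | h) <;> exact h.1
    · intro h
      have : σ⁻¹ p.1 ≠ σ⁻¹ p.2 := fun he => h.ne (σ⁻¹.injective he)
      rcases lt_or_gt_of_ne this with h' | h'
      · exact Or.inr ⟨h, h'⟩
      · exact Or.inl ⟨h, h'⟩
  · rw [Finset.disjoint_left]
    intro p h1 h2
    exact lt_asymm (mem_inversions.1 h1).2 (mem_coinversions.1 h2).2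

/-- The entries at coinversions are free coordinates, and those at inversions are forced to vanish.
-/
theorem card_unitriConj [Finite F] (σ : Equiv.Perm (Fin n)) :
    Nat.card (unitriConj F σ) = Nat.card F ^ (coinversions σ).card := by
  let φ : unitriConj F σ → (coinversions σ → F) := fun u p =>
    (((u : unitri n F) : GL (Fin n) F) : Matrix (Fin n) (Fin n) F) (p : Fin n × Fin n).1
      (p : Fin n × Fin n).2
  have hφ : Function.Bijective φ := by
    constructor
    · intro u v huv
      apply Subtype.ext
      apply Subtype.ext
      ext a b
      have hu := mem_unitri.1 (u : unitri n F).2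
      have hv := mem_unitri.1 (v : unitri n F).2
      rcases lt_trichotomy a b with hlt | rfl | hlt
      · have hne : σ⁻¹ a ≠ σ⁻¹ b := fun he => hlt.ne (σ⁻¹.injective he)
        rcases lt_or_gt_of_ne hne with h | h
        · exact congrFun huv ⟨(a, b), mem_coinversions.2 ⟨hlt, h⟩⟩
        · rw [mem_unitriConj.1 u.2 a b hlt h, mem_unitriConj.1 v.2 a b hlt h]
      · rw [hu.2, hv.2]
      · rw [hu.1 a b hlt, hv.1 a b hlt]
    · intro f
      classical
      let M : Matrix (Fin n) (Fin n) F := fun a b =>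
        if a = b then 1 else if h : (a, b) ∈ coinversions σ then f ⟨(a, b), h⟩ else 0
      have hM : ∀ a b, b < a → M a b = 0 := fun a b hab => by
        have : (a, b) ∉ coinversions σ := fun h => lt_asymm hab (mem_coinversions.1 h).1
        simp [M, hab.ne', this]
      have hdet : M.det = 1 := by
        rw [det_of_isUpperTriangular fun a b hab => hM a b hab]
        simp [M]
      let g : GL (Fin n) F := GeneralLinearGroup.mkOfDetNeZero M (by rw [hdet]; exact one_ne_zero)
      have hg : g ∈ unitri n F := mem_unitri.2 ⟨hM, fun i => if_pos rfl⟩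
      refine ⟨⟨⟨g, hg⟩, mem_unitriConj.2 fun a b hab hba => ?_⟩, ?_⟩
      · change M a b = 0
        have : (a, b) ∉ coinversions σ := fun h => lt_asymm hba (mem_coinversions.1 h).2
        simp [M, hab.ne, this]
      · ext p
        change M p.1.1 p.1.2 = f p
        have h1 := (mem_coinversions.1 p.2).1
        simp [M, h1.ne]
  rw [Nat.card_congr (Equiv.ofBijective φ hφ), Nat.card_fun]
  simp

theorem card_unitri [Finite F] :
    Nat.card (unitri n F) = Nat.card F ^ (coinversions (1 : Equiv.Perm (Fin n))).card := by
  have : unitriConj F (1 : Equiv.Perm (Fin n)) = ⊤ := by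
    rw [eq_top_iff]
    intro u _
    exact mem_unitriConj.2 fun a b hab hba => absurd hab (lt_asymm (by simpa using hba))
  rw [← card_unitriConj, this, Subgroup.card_top]

/-- The entry of σ⁻¹uτ at (σ⁻¹a, τ⁻¹a) is u_aa = 1, so this position is not below the block
diagonal. -/
theorem block_le_of_conj_mem_parabolic {J : Set (Fin n × Fin n)} (hJ : J ⊆ simpleRoots n)
    {σ τ : Equiv.Perm (Fin n)} {u : GL (Fin n) F} (hu : u ∈ unitri n F)
    (h : (permGL n F σ)⁻¹ * u * permGL n F τ ∈ parabolic n F J) (a : Fin n) :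
    block J (σ⁻¹ a) ≤ block J (τ⁻¹ a) := by
  by_contra! hlt
  have := apply_eq_zero_of_mem_parabolic hJ h hlt
  rw [permGL_inv_mul_mul_apply] at this
  simp [(mem_unitri.1 hu).2] at this

/-- Disjointness of the Bruhat cells: the case J = ∅ of the block comparison, applied to the element
and to its inverse. -/
theorem perm_eq_of_conj_mem_borel {σ τ : Equiv.Perm (Fin n)} {u : GL (Fin n) F}
    (hu : u ∈ unitri n F) (h : (permGL n F σ)⁻¹ * u * permGL n F τ ∈ borel n F) : σ = τ := by
  have h' : (permGL n F τ)⁻¹ * u⁻¹ * permGL n F σ ∈ borel n F := by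
    have := inv_mem h
    simpa only [_root_.mul_inv_rev, inv_inv, mul_assoc] using this
  have hJ := Set.empty_subset (simpleRoots n)
  exact perm_eq_of_increasing (J := ∅) (by simp) (by simp) fun a =>
    (block_le_of_conj_mem_parabolic hJ (inv_mem hu) (borel_le_parabolic _ h') a).antisymm
      (block_le_of_conj_mem_parabolic hJ hu (borel_le_parabolic _ h) a)

theorem smul_permGL_eq_iff {J : Set (Fin n × Fin n)} {σ τ : Equiv.Perm (Fin n)}
    {u v : unitri n F} :
    u • (permGL n F σ : GL (Fin n) F ⧸ parabolic n F J) =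
      v • (permGL n F τ : GL (Fin n) F ⧸ parabolic n F J) ↔
    (permGL n F σ)⁻¹ * ((u⁻¹ * v : unitri n F) : GL (Fin n) F) * permGL n F τ ∈
      parabolic n F J := by
  change (((u : GL (Fin n) F) * permGL n F σ : GL (Fin n) F) : GL (Fin n) F ⧸ parabolic n F J) =
    (((v : GL (Fin n) F) * permGL n F τ : GL (Fin n) F) : GL (Fin n) F ⧸ parabolic n F J) ↔ _
  rw [QuotientGroup.eq]
  simp only [_root_.mul_inv_rev, Subgroup.coe_mul, Subgroup.coe_inv, mul_assoc]

/-- Enlarging B to P_J does not enlarge the stabilizer. An inversion of τ joins two different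
blocks, because τ increases inside blocks, and there block triangularity already forces the entry to
vanish. -/
theorem stabilizer_permGL {J : Set (Fin n × Fin n)} (hJ : J ⊆ simpleRoots n)
    {τ : Equiv.Perm (Fin n)} (hτ : ∀ r ∈ J, τ r.1 < τ r.2) :
    MulAction.stabilizer (unitri n F) (permGL n F τ : GL (Fin n) F ⧸ parabolic n F J) =
      unitriConj F τ := by
  ext u
  have h1 : u • (permGL n F τ : GL (Fin n) F ⧸ parabolic n F J) = permGL n F τ ↔
      (permGL n F τ)⁻¹ * (u : GL (Fin n) F) * permGL n F τ ∈ parabolic n F J := by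
    have h := smul_permGL_eq_iff (J := J) (σ := τ) (τ := τ) (u := (1 : unitri n F)) (v := u)
    rw [one_smul, inv_one, one_mul, eq_comm] at h
    exact h
  rw [MulAction.mem_stabilizer_iff, h1]
  refine ⟨fun h => mem_unitriConj.2 fun a b hab hba => ?_,
    fun h => borel_le_parabolic J (mem_unitriConj_iff_conj.1 h)⟩
  rcases (block_mono J hba.le).lt_or_eq with hlt | heq
  · have := apply_eq_zero_of_mem_parabolic hJ h hlt
    rw [permGL_inv_mul_mul_apply] at this
    simpa using this
  · have := lt_of_increasing_of_block_eq hτ hba heq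
    exact absurd hab (lt_asymm (by simpa using this))

theorem exists_increasing_smul_eq {J : Set (Fin n × Fin n)} (hJ : J ⊆ simpleRoots n)
    (c : GL (Fin n) F ⧸ parabolic n F J) :
    ∃ τ : Equiv.Perm (Fin n), (∀ r ∈ J, τ r.1 < τ r.2) ∧
      c ∈ MulAction.orbit (unitri n F) (permGL n F τ : GL (Fin n) F ⧸ parabolic n F J) := by
  obtain ⟨g, rfl⟩ := QuotientGroup.mk_surjective c
  obtain ⟨u, hu, σ, b, hb, rfl⟩ := exists_bruhat g
  obtain ⟨w, hw, h⟩ := exists_increasing hJ σ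
  refine ⟨σ * w, h, ⟨u, hu⟩, ?_⟩
  change ((u * permGL n F (σ * w) : GL (Fin n) F) : GL (Fin n) F ⧸ parabolic n F J) = _
  rw [QuotientGroup.eq, map_mul]
  have : (u * (permGL n F σ * permGL n F w))⁻¹ * (u * permGL n F σ * b) =
      (permGL n F w)⁻¹ * b := by group
  rw [this]
  exact mul_mem (inv_mem (permGL_mem_parabolic hw)) (borel_le_parabolic J hb)

-- The U-orbits on G/P_J are represented by the J-increasing τ, and the orbit of τ has |U| / |U ∩
-- τBτ⁻¹| = q^inv points, where inv is the number of inversions.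
open Classical in
theorem index_parabolic [Finite F] {J : Set (Fin n × Fin n)} (hJ : J ⊆ simpleRoots n) :
    (parabolic n F J).index =
      ∑ τ : Equiv.Perm (Fin n) with ∀ r ∈ J, τ r.1 < τ r.2,
        Nat.card F ^ (inversions τ).card := by
  have := Fintype.ofFinite (GL (Fin n) F ⧸ parabolic n F J)
  choose t ht1 ht2 using exists_increasing_smul_eq (F := F) hJ
  rw [Subgroup.index, Nat.card_eq_fintype_card, ← Finset.card_univ,
    Finset.card_eq_sum_card_fiberwise (f := t)
      (t := Finset.univ.filter fun τ : Equiv.Perm (Fin n) => ∀ r ∈ J, τ r.1 < τ r.2)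
      (fun c _ => by simpa using fun a b h => ht1 c (a, b) h)]
  refine Finset.sum_congr rfl fun τ hτ => ?_
  have hτ : ∀ r ∈ J, τ r.1 < τ r.2 := (Finset.mem_filter.1 hτ).2
  have horb : (Finset.univ.filter fun c => t c = τ) =
      (MulAction.orbit (unitri n F)
        (permGL n F τ : GL (Fin n) F ⧸ parabolic n F J)).toFinset := by
    ext c
    simp only [Finset.mem_filter, Finset.mem_univ, true_and, Set.mem_toFinset]
    refine ⟨fun h => h ▸ ht2 c, ?_⟩
    rintro ⟨v, hv⟩
    obtain ⟨u, hu⟩ := ht2 c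
    have h1 := smul_permGL_eq_iff.1 (hu.trans hv.symm)
    have h2 := smul_permGL_eq_iff.1 (hv.trans hu.symm)
    exact perm_eq_of_increasing (ht1 c) hτ fun a =>
      (block_le_of_conj_mem_parabolic hJ (Subtype.prop _) h2 a).antisymm
        (block_le_of_conj_mem_parabolic hJ (Subtype.prop _) h1 a)
  rw [horb, Set.toFinset_card]
  have h := Nat.card_congr (MulAction.orbitProdStabilizerEquivGroup (unitri n F)
    (permGL n F τ : GL (Fin n) F ⧸ parabolic n F J))
  rw [Nat.card_prod, stabilizer_permGL hJ hτ, card_unitriConj, card_unitri,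
    ← card_inversions_add_card_coinversions τ, pow_add] at h
  rw [← Nat.card_eq_fintype_card]
  exact Nat.eq_of_mul_eq_mul_right (pow_pos Nat.card_pos _) h

/-- Passing to σ⁻¹ transports pairs along σ, and the reversal w₀ exchanges preserved and reversed
order. -/
theorem card_inversions_rev_mul_inv (σ : Equiv.Perm (Fin n)) :
    (inversions (Fin.revPerm * σ⁻¹)).card = (coinversions σ).card := by
  refine Finset.card_bij' (fun p _ => (σ p.2.rev, σ p.1.rev))
    (fun p _ => ((σ⁻¹ p.2).rev, (σ⁻¹ p.1).rev)) ?_ ?_ ?_ ?_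
  · intro p hp
    rw [mem_inversions] at hp
    rw [mem_coinversions]
    have h1 := hp.1
    have h2 := hp.2
    rw [_root_.mul_inv_rev, inv_inv] at h2
    exact ⟨h2, by simpa using h1⟩
  · intro p hp
    rw [mem_coinversions] at hp
    rw [mem_inversions, _root_.mul_inv_rev, inv_inv]
    refine ⟨by simpa using hp.2, ?_⟩
    change σ (Fin.rev (Fin.rev (σ⁻¹ p.1))) < σ (Fin.rev (Fin.rev (σ⁻¹ p.2)))
    simpa using hp.1
  · intro p _
    simp
  · intro p _
    simp

open Classical in
/-- The index of `P_J` as a sum over the `σ` such that no root subgroup `X_r`, `r ∈ J`, lies in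
`σBσ⁻¹`. -/
theorem index_parabolic_eq_sum_card [Finite F] {J : Set (Fin n × Fin n)}
    (hJ : J ⊆ simpleRoots n) :
    (parabolic n F J).index =
      ∑ σ : Equiv.Perm (Fin n) with ∀ r ∈ J, σ⁻¹ r.2 < σ⁻¹ r.1,
        Nat.card (unitriConj F σ) := by
  rw [index_parabolic hJ]
  symm
  -- The substitution τ = w₀σ⁻¹ turns "σ⁻¹ decreasing along J" into "τ increasing along J".
  refine Finset.sum_equiv ((Equiv.inv _).trans (Equiv.mulLeft Fin.revPerm)) (fun σ => ?_)
    fun σ _ => ?_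
  · simp
  · rw [card_unitriConj, ← card_inversions_rev_mul_inv]
    rfl

end Index

/-! ### Linear characters of U -/

section Characters

variable {n : ℕ} {F : Type*} [Field F]

/-- The coordinate of `c` just before position `j` (zero if there is none). -/
def prevCoord (j : Fin n) (c : Fin n → F) : F :=
  ∑ i : Fin n, if (i : ℕ) + 1 = j then c i else 0

theorem prevCoord_eq {i j : Fin n} (h : (i : ℕ) + 1 = j) (c : Fin n → F) :
    prevCoord j c = c i := by
  rw [prevCoord, Finset.sum_eq_single i]
  · rw [if_pos h]
  · intro k _ hk
    exact if_neg fun h' => hk (Fin.ext (by omega))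
  · simp

theorem prevCoord_eq_zero {j : Fin n} {c : Fin n → F} (h : ∀ i : Fin n, (i : ℕ) + 1 = j → c i = 0) :
    prevCoord j c = 0 :=
  Finset.sum_eq_zero fun i _ => ite_eq_right_iff.2 (h i)

theorem prevCoord_congr {j : Fin n} {c d : Fin n → F}
    (h : ∀ i : Fin n, (i : ℕ) + 1 = j → c i = d i) : prevCoord j c = prevCoord j d :=
  Finset.sum_congr rfl fun i _ => by
    split_ifs with hi
    · exact h i hi
    · rfl

/-- The linear combination `∑ b_j u_{j-1,j}` of the entries above the diagonal. -/
def superdiag (b : Fin n → F) (u : GL (Fin n) F) : F :=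
  ∑ j, b j * prevCoord j fun i => (u : Matrix (Fin n) (Fin n) F) i j

theorem superdiag_mul (b : Fin n → F) {u v : GL (Fin n) F} (hu : u ∈ unitri n F)
    (hv : v ∈ unitri n F) : superdiag b (u * v) = superdiag b u + superdiag b v := by
  rw [superdiag, superdiag, superdiag, ← Finset.sum_add_distrib]
  refine Finset.sum_congr rfl fun j _ => ?_
  rw [← mul_add, prevCoord, prevCoord, prevCoord, ← Finset.sum_add_distrib]
  congr 1
  refine Finset.sum_congr rfl fun i _ => ?_
  split_ifs with hij
  · have hlt : i < j := Fin.lt_def.2 (by omega)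
    rw [GeneralLinearGroup.coe_mul, Matrix.mul_apply, Finset.sum_eq_add i j hlt.ne]
    · rw [(mem_unitri.1 hu).2, (mem_unitri.1 hv).2]
      ring
    · intro k _ hk
      rcases lt_or_gt_of_ne hk.1 with h | h
      · rw [(mem_unitri.1 hu).1 i k h, zero_mul]
      · have : j < k := lt_of_le_of_ne (Fin.le_def.2 (by have := Fin.lt_def.1 h; omega)) hk.2.symm
        rw [(mem_unitri.1 hv).1 k j this, mul_zero]
    · simp
    · simp
  · simp

theorem superdiag_one (b : Fin n → F) : superdiag b 1 = 0 := by
  have := superdiag_mul b (one_mem (unitri n F)) (one_mem (unitri n F))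
  simpa using this

theorem superdiag_shear (b : Fin n → F) (j : Fin n) (c : Fin n → F)
    (h : Pi.single j 1 ⬝ᵥ c = 0) :
    superdiag b (shear c (Pi.single j 1) h) = b j * prevCoord j c := by
  rw [superdiag, Finset.sum_eq_single j]
  · congr 1
    refine prevCoord_congr fun i hi => ?_
    have : i ≠ j := fun h => by subst h; omega
    rw [shear_apply, one_apply_ne this]
    simp
  · intro k _ hk
    rw [prevCoord_eq_zero, mul_zero]
    intro i hi
    have : i ≠ k := fun h => by subst h; omega
    rw [shear_apply, one_apply_ne this]
    simp [hk]
  · simp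

variable {A : Type*} [CommRing A]

/-- The linear character `u ↦ ψ(∑ b_j u_{j-1,j})` of `U`. -/
def unitriChar (ψ : AddChar F A) (b : Fin n → F) : unitri n F →* Aˣ :=
  MonoidHom.toHomUnits
    { toFun := fun u => ψ (superdiag b (u : GL (Fin n) F))
      map_one' := by rw [Subgroup.coe_one, superdiag_one, AddChar.map_zero_eq_one]
      map_mul' := fun u v => by
        rw [Subgroup.coe_mul, superdiag_mul b u.2 v.2, AddChar.map_add_eq_mul] }

theorem coe_unitriChar (ψ : AddChar F A) (b : Fin n → F) (u : unitri n F) :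
    (unitriChar ψ b u : A) = ψ (superdiag b (u : GL (Fin n) F)) := rfl

theorem superdiag_rootElt (b : Fin n → F) {r : Fin n × Fin n} (hr : r ∈ simpleRoots n) (a : F) :
    superdiag b (rootElt r.1 r.2 (lt_of_mem_simpleRoots hr).ne a) = b r.2 * a := by
  rw [rootElt, superdiag_shear, prevCoord_eq hr, Pi.single_eq_same]

theorem rootSupport_subset (χ : unitri n F →* Aˣ) : rootSupport χ ⊆ simpleRoots n :=
  fun _ h => h.1

theorem mem_rootSupport {χ : unitri n F →* Aˣ} {r : Fin n × Fin n} (hr : r ∈ simpleRoots n) :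
    r ∈ rootSupport χ ↔ ∃ a : F, χ ⟨rootElt r.1 r.2 (lt_of_mem_simpleRoots hr).ne a,
      rootElt_mem_unitri (lt_of_mem_simpleRoots hr) a⟩ ≠ 1 := by
  constructor
  · rintro ⟨_, a, u, hu, h⟩
    refine ⟨a, ?_⟩
    convert h
    exact Units.ext ((coe_rootElt _ _ _ _).trans hu.symm)
  · rintro ⟨a, h⟩
    exact ⟨hr, a, _, coe_rootElt _ _ (lt_of_mem_simpleRoots hr).ne _, h⟩

/-- Otherwise the sum would be |F|. Nondegeneracy of ψ is carried as this orthogonality relation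
because the relation survives reduction modulo ℓ. -/
theorem exists_ne_one_of_sum_eq_zero [Fintype F] {ψ : AddChar F A}
    (hq : (Fintype.card F : A) ≠ 0)
    (hψ : ∀ x : F, x ≠ 0 → ∑ a, ψ (x * a) = 0) {x : F} (hx : x ≠ 0) : ∃ a, ψ (x * a) ≠ 1 := by
  by_contra! h
  have := hψ x hx
  simp only [h, Finset.sum_const, Finset.card_univ, nsmul_eq_mul, mul_one] at this
  exact hq this

theorem rootSupport_unitriChar [Fintype F] {ψ : AddChar F A} (hq : (Fintype.card F : A) ≠ 0)
    (hψ : ∀ x : F, x ≠ 0 → ∑ a, ψ (x * a) = 0) (b : Fin n → F) :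
    rootSupport (unitriChar ψ b) = {r | r ∈ simpleRoots n ∧ b r.2 ≠ 0} := by
  ext r
  by_cases hr : r ∈ simpleRoots n
  · rw [mem_rootSupport hr]
    simp only [ne_eq, Units.ext_iff, coe_unitriChar, superdiag_rootElt b hr, Units.val_one,
      Set.mem_ofPred_eq, hr, true_and]
    constructor
    · rintro ⟨a, ha⟩ h
      simp [h] at ha
    · exact fun h => exists_ne_one_of_sum_eq_zero hq hψ h
  · exact iff_of_false (fun h => hr h.1) fun h => hr h.1

/-- A homomorphism from `U` to an abelian group only depends on the entries just above the
diagonal. -/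
theorem map_shear_eq_map_rootElt {C : Type*} [CommGroup C] (χ : unitri n F →* C) {i j : Fin n}
    (hij : (i : ℕ) + 1 = j) {c : Fin n → F} (hc : ∀ k, j ≤ k → c k = 0) :
    χ ⟨shear c (Pi.single j 1) (single_dotProduct_eq_zero hc), shear_single_mem_unitri hc⟩ =
      χ ⟨rootElt i j (fun h => by subst h; omega) (c i),
        rootElt_mem_unitri (Fin.lt_def.2 (by omega)) (c i)⟩ := by
  have hlt : i < j := Fin.lt_def.2 (by omega)
  let d : Fin n → F := c - Pi.single i (c i)
  have hd : ∀ k, i ≤ k → d k = 0 := fun k hk => by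
    rcases hk.eq_or_lt with rfl | h
    · simp [d]
    · have : j ≤ k := Fin.le_def.2 (by have := Fin.lt_def.1 h; omega)
      simp [d, hc k this, h.ne']
  have hd' : ∀ k, j ≤ k → d k = 0 := fun k hk => hd k (hlt.le.trans hk)
  let x : unitri n F := ⟨shear d (Pi.single j 1) (single_dotProduct_eq_zero hd'),
    shear_single_mem_unitri hd'⟩
  let y : unitri n F := ⟨shear d (Pi.single i 1) (single_dotProduct_eq_zero hd),
    shear_single_mem_unitri hd⟩
  let z : unitri n F := ⟨rootElt i j hlt.ne 1, rootElt_mem_unitri hlt 1⟩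
  -- The part x of the column away from position i is a commutator of y and z, so every homomorphism
  -- to an abelian group kills it.
  have hcomm : y * z = z * x * y := by
    apply Subtype.ext
    change shear d (Pi.single i 1) (single_dotProduct_eq_zero hd) * rootElt i j hlt.ne 1 =
      rootElt i j hlt.ne 1 * shear d (Pi.single j 1) (single_dotProduct_eq_zero hd') *
        shear d (Pi.single i 1) (single_dotProduct_eq_zero hd)
    rw [rootElt, shear_mul_comm d (Pi.single i 1) (Pi.single i 1) (Pi.single j 1) _ _
      (single_dotProduct_eq_zero hd'), shear_mul_shear]
    simp
  have hx : χ x = 1 := by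
    have h := congrArg χ hcomm
    rw [map_mul, map_mul, map_mul, mul_comm (χ y), mul_left_inj, eq_comm] at h
    simpa using h
  have hprod : (⟨shear c (Pi.single j 1) (single_dotProduct_eq_zero hc),
      shear_single_mem_unitri hc⟩ : unitri n F) =
      x * ⟨rootElt i j hlt.ne (c i), rootElt_mem_unitri hlt (c i)⟩ := by
    apply Subtype.ext
    change _ = shear d (Pi.single j 1) (single_dotProduct_eq_zero hd') * rootElt i j hlt.ne (c i)
    rw [rootElt, shear_mul_shear]
    simp [d]
  rw [hprod, map_mul, hx, one_mul]

theorem unitri_hom_ext {C : Type*} [CommGroup C] {χ χ' : unitri n F →* C}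
    (h : ∀ (r : Fin n × Fin n) (hr : r ∈ simpleRoots n) (a : F),
      χ ⟨rootElt r.1 r.2 (lt_of_mem_simpleRoots hr).ne a,
          rootElt_mem_unitri (lt_of_mem_simpleRoots hr) a⟩ =
        χ' ⟨rootElt r.1 r.2 (lt_of_mem_simpleRoots hr).ne a,
          rootElt_mem_unitri (lt_of_mem_simpleRoots hr) a⟩) : χ = χ' := by
  have hle : unitri n F ≤ (MonoidHom.eqLocus χ χ').map (unitri n F).subtype := by
    refine unitri_le_of_shear_mem fun j c hc => ⟨⟨_, shear_single_mem_unitri hc⟩, ?_, rfl⟩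
    change χ _ = χ' _
    rcases Nat.eq_zero_or_pos (j : ℕ) with hj | hj
    · have hc0 : c = 0 := funext fun k => hc k (Fin.le_def.2 (by omega))
      subst hc0
      have : (⟨shear 0 (Pi.single j 1) (single_dotProduct_eq_zero hc),
          shear_single_mem_unitri hc⟩ : unitri n F) = 1 := Subtype.ext (shear_zero _ (single_dotProduct_eq_zero hc))
      rw [this, map_one, map_one]
    · have hij : ((⟨j - 1, by omega⟩ : Fin n) : ℕ) + 1 = j := by simp; omega
      rw [map_shear_eq_map_rootElt χ hij hc, map_shear_eq_map_rootElt χ' hij hc]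
      exact h (_, j) hij _
  ext1 u
  obtain ⟨v, hv, hvu⟩ := hle u.2
  rw [← Subtype.ext hvu]
  exact hv

/-- A character of the additive group of `F` is of the form `a ↦ ψ(x a)`. -/
theorem exists_addChar_eq [Fintype F] [IsDomain A] {ψ : AddChar F A}
    (hq : (Fintype.card F : A) ≠ 0)
    (hψ : ∀ x : F, x ≠ 0 → ∑ a, ψ (x * a) = 0) (φ : AddChar F A) :
    ∃ x : F, ∀ a, φ a = ψ (x * a) := by
  -- Summing over x first leaves only a = 0, so the double sum is |F|. Some x then has a nonzero
  -- inner sum, which forces the character a ↦ ψ(−xa)φ(a) to be trivial.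
  have h1 : ∑ x : F, ∑ a : F, ψ (-(x * a)) * φ a ≠ 0 := by
    rw [Finset.sum_comm]
    simp_rw [← Finset.sum_mul]
    rw [Finset.sum_eq_single 0]
    · simpa using hq
    · intro a _ ha
      have := hψ (-a) (neg_ne_zero.2 ha)
      rw [show ∑ x : F, ψ (-(x * a)) = 0 by
        rw [← this]; exact Finset.sum_congr rfl fun x _ => by ring_nf, zero_mul]
    · simp
  obtain ⟨x, _, hx⟩ := Finset.exists_ne_zero_of_sum_ne_zero h1
  refine ⟨x, fun a => ?_⟩
  let θ : AddChar F A := AddChar.mulShift ψ (-x) * φ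
  have hθ : θ = 1 := by
    by_contra hne
    apply hx
    rw [← AddChar.sum_eq_zero_of_ne_one hne]
    exact Finset.sum_congr rfl fun a _ => by simp [θ, AddChar.mulShift_apply]
  have h2 : ψ (-x * a) * φ a = 1 := by
    have := DFunLike.congr_fun hθ a
    simpa [θ, AddChar.mulShift_apply] using this
  have h3 : ψ (x * a) * ψ (-x * a) = 1 := by
    rw [← AddChar.map_add_eq_mul, neg_mul, add_neg_cancel, AddChar.map_zero_eq_one]
  calc φ a = (ψ (x * a) * ψ (-x * a)) * φ a := by rw [h3, one_mul]
    _ = ψ (x * a) := by rw [mul_assoc, h2, mul_one]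

theorem exists_eq_unitriChar [Fintype F] [IsDomain A] {ψ : AddChar F A}
    (hq : (Fintype.card F : A) ≠ 0)
    (hψ : ∀ x : F, x ≠ 0 → ∑ a, ψ (x * a) = 0) (χ : unitri n F →* Aˣ) :
    ∃ b, χ = unitriChar ψ b := by
  have h : ∀ j : Fin n, ∃ x : F, ∀ (i : Fin n) (hij : (i, j) ∈ simpleRoots n) (a : F),
      (χ ⟨rootElt i j (lt_of_mem_simpleRoots hij).ne a,
        rootElt_mem_unitri (lt_of_mem_simpleRoots hij) a⟩ : A) = ψ (x * a) := by
    intro j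
    by_cases hj : ∃ i, (i, j) ∈ simpleRoots n
    · obtain ⟨i, hij⟩ := hj
      have hlt : i < j := lt_of_mem_simpleRoots hij
      obtain ⟨x, hx⟩ := exists_addChar_eq hq hψ
        { toFun := fun a => (χ ⟨rootElt i j hlt.ne a, rootElt_mem_unitri hlt a⟩ : A)
          map_zero_eq_one' := by
            have : (⟨rootElt i j hlt.ne 0, rootElt_mem_unitri hlt 0⟩ : unitri n F) = 1 :=
              Subtype.ext (rootElt_zero _ _ hlt.ne)
            rw [this, map_one, Units.val_one]
          map_add_eq_mul' := fun a b => by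
            rw [← Units.val_mul, ← map_mul]
            congr 2
            exact Subtype.ext (rootElt_mul_rootElt _ _ hlt.ne _ _).symm }
      refine ⟨x, fun i' hij' a => ?_⟩
      have h1 : (i : ℕ) + 1 = j := hij
      have h2 : (i' : ℕ) + 1 = j := hij'
      obtain rfl : i = i' := Fin.ext (by omega)
      exact hx a
    · exact ⟨0, fun i hij => absurd ⟨i, hij⟩ hj⟩
  choose b hb using h
  refine ⟨b, unitri_hom_ext fun r hr a => Units.ext ?_⟩
  rw [coe_unitriChar, superdiag_rootElt b hr]
  exact hb r.2 r.1 hr a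

/-- A finite field has an additive character with values in `A` which satisfies the orthogonality
relations if `A` contains a primitive `p`-th root of unity. -/
theorem exists_addChar_sum_eq_zero (F : Type*) [Field F] [Fintype F] {p : ℕ} [CharP F p]
    [IsDomain A] {ζ : A} (hζ : IsPrimitiveRoot ζ p) :
    ∃ ψ : AddChar F A, ∀ x : F, x ≠ 0 → ∑ a, ψ (x * a) = 0 := by
  have hp : p.Prime := CharP.char_is_prime F p
  have : Fact p.Prime := ⟨hp⟩
  let _ : Algebra (ZMod p) F := ZMod.algebra F p
  let ψ₀ : AddChar (ZMod p) A := AddChar.zmodChar p hζ.pow_eq_one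
  have hψ₀ : ψ₀.IsPrimitive := AddChar.zmodChar_primitive_of_primitive_root p hζ
  -- The trace to the prime field is nonzero, so the composite is nontrivial, hence primitive since
  -- F is a field.
  let ψ : AddChar F A := ψ₀.compAddMonoidHom (Algebra.trace (ZMod p) F).toAddMonoidHom
  have hψ : ψ ≠ 1 := by
    obtain ⟨a, ha⟩ : ∃ a : F, Algebra.trace (ZMod p) F a ≠ 0 := by
      by_contra! h
      exact Algebra.trace_ne_zero (ZMod p) F (LinearMap.ext h)
    exact AddChar.ne_one_iff.2 ⟨a, fun h => ha ((hψ₀.zmod_char_eq_one_iff p _).1 h)⟩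
  refine ⟨ψ, fun x hx => ?_⟩
  exact AddChar.sum_eq_zero_of_ne_one (AddChar.IsPrimitive.of_ne_one hψ hx)

theorem diagGL_conj_mem_unitri (d : Fin n → Fˣ) {u : GL (Fin n) F} (hu : u ∈ unitri n F) :
    (diagGL d)⁻¹ * u * diagGL d ∈ unitri n F := by
  rw [diagGL_inv]
  refine mem_unitri.2 ⟨fun a b hab => ?_, fun a => ?_⟩
  · rw [mul_diagGL_apply, diagGL_mul_apply, (mem_unitri.1 hu).1 a b hab]
    simp
  · rw [mul_diagGL_apply, diagGL_mul_apply, (mem_unitri.1 hu).2]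
    simp

/-- The diagonal matrices act transitively on the characters with given support. -/
theorem exists_superdiag_conj {b b' : Fin n → F}
    (h : ∀ r ∈ simpleRoots n, b r.2 = 0 ↔ b' r.2 = 0) :
    ∃ d : Fin n → Fˣ, ∀ u : GL (Fin n) F,
      superdiag b ((diagGL d)⁻¹ * u * diagGL d) = superdiag b' u := by
  classical
  -- Conjugation by d multiplies u_{j−1,j} by d_j / d_{j−1}. This ratio is prescribed to be c_j =
  -- b'_j / b_j, and d is the product of these ratios. The default 1 is harmless, as it occurs where
  -- b_j and b'_j both vanish or where j has no predecessor.
  let c : Fin n → Fˣ := fun k =>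
    if hk : b k ≠ 0 ∧ b' k ≠ 0 then Units.mk0 (b' k) hk.2 / Units.mk0 (b k) hk.1 else 1
  let d : Fin n → Fˣ := fun j => ∏ k ∈ Finset.Iic j, c k
  refine ⟨d, fun u => Finset.sum_congr rfl fun j _ => ?_⟩
  by_cases hj : ∃ i : Fin n, (i : ℕ) + 1 = j
  · obtain ⟨i, hij⟩ := hj
    rw [prevCoord_eq hij, prevCoord_eq hij, diagGL_inv, mul_diagGL_apply, diagGL_mul_apply]
    have hd : d j = d i * c j := by
      have : Finset.Iic j = insert j (Finset.Iic i) := by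
        ext k
        simp only [Finset.mem_Iic, Finset.mem_insert, Fin.le_def, Fin.ext_iff]
        omega
      simp only [d]
      rw [this, Finset.prod_insert fun hk => by
        have := Fin.le_def.1 (Finset.mem_Iic.1 hk)
        omega, mul_comm]
    have hb : b j * c j = b' j := by
      have h1 := h (i, j) hij
      dsimp only at h1
      by_cases hbj : b j = 0
      · rw [hbj, h1.1 hbj, zero_mul]
      · have : b j ≠ 0 ∧ b' j ≠ 0 := ⟨hbj, fun h2 => hbj (h1.2 h2)⟩
        simp only [c, dif_pos this, Units.val_div_eq_div_val, Units.val_mk0]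
        field_simp
    rw [hd, ← hb]
    simp only [Pi.inv_apply, Units.val_mul, Units.val_inv_eq_inv_val]
    field_simp [(d i).ne_zero]
  · rw [prevCoord_eq_zero fun i hi => absurd ⟨i, hi⟩ hj,
      prevCoord_eq_zero fun i hi => absurd ⟨i, hi⟩ hj, mul_zero, mul_zero]

end Characters

/-! ### Existence of a vector on which U acts by a linear character -/

section Eigenvector

variable {n : ℕ} {F : Type*} [Field F] {K V : Type*} [CommRing K] [AddCommGroup V] [Module K V]

/-- The vectors on which the columns `j ≥ m` of `U` act by the character defined by `b`. -/
def columnEigenspace (ρ : GL (Fin n) F →* Module.End K V) (ψ : AddChar F K) (b : Fin n → F)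
    (m : ℕ) : Submodule K V where
  carrier := {v | ∀ (j : Fin n) (c : Fin n → F) (hc : ∀ i, j ≤ i → c i = 0), m ≤ j →
    ρ (shear c (Pi.single j 1) (single_dotProduct_eq_zero hc)) v = ψ (b j * prevCoord j c) • v}
  zero_mem' := fun j c hc _ => by simp
  add_mem' := fun {v w} hv hw j c hc hj => by
    rw [map_add, hv j c hc hj, hw j c hc hj, smul_add]
  smul_mem' := fun a v hv j c hc hj => by
    rw [map_smul, hv j c hc hj, smul_comm]

variable {ρ : GL (Fin n) F →* Module.End K V} {ψ : AddChar F K} {b : Fin n → F}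

/-- Since u vanishes from position j on, the shear normalizes the group of column-j elements and
acts on it by c ↦ c − (w·c)u. -/
theorem apply_apply_shear {u w c : Fin n → F} (hwu : w ⬝ᵥ u = 0) {j : Fin n}
    (hu : ∀ i, j ≤ i → u i = 0) (hc : ∀ i, j ≤ i → c i = 0) (v : V) :
    ρ (shear c (Pi.single j 1) (single_dotProduct_eq_zero hc)) (ρ (shear u w hwu) v) =
      ρ (shear u w hwu) (ρ (shear (c - (w ⬝ᵥ c) • u) (Pi.single j 1)
        (single_dotProduct_eq_zero fun i hi => by simp [hu i hi, hc i hi])) v) := by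
  rw [← Module.End.mul_apply, ← Module.End.mul_apply, ← map_mul, ← map_mul,
    shear_mul_comm _ _ _ _ _ _ (single_dotProduct_eq_zero hu)]
  congr 4
  simp [dotProduct_sub, hwu]

/-- The shear alters only coordinates below m, while in a column j ≥ m + 1 the character sees only
coordinate j − 1 ≥ m. -/
theorem shear_mem_columnEigenspace {m : ℕ} {u w : Fin n → F} (hwu : w ⬝ᵥ u = 0)
    (hu : ∀ i : Fin n, m ≤ i → u i = 0) {v : V} (hv : v ∈ columnEigenspace ρ ψ b (m + 1)) :
    ρ (shear u w hwu) v ∈ columnEigenspace ρ ψ b (m + 1) := by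
  intro j c hc hj
  have hu' : ∀ i, j ≤ i → u i = 0 := fun i hi => hu i (by have := Fin.le_def.1 hi; omega)
  rw [apply_apply_shear hwu hu' hc, hv _ _ (fun i hi => by simp [hu' i hi, hc i hi]) hj, map_smul, prevCoord_congr (c := c - (w ⬝ᵥ c) • u) (d := c) fun i hi => by
      simp [hu i (by omega)]]

theorem apply_ne_zero {v : V} (hv : v ≠ 0) (g : GL (Fin n) F) : ρ g v ≠ 0 := by
  intro h
  apply hv
  have h1 : ρ g⁻¹ (ρ g v) = v := by
    rw [← Module.End.mul_apply, ← map_mul, inv_mul_cancel, map_one, Module.End.one_apply]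
  rw [← h1, h, map_zero]

theorem sum_addChar_dotProduct [Fintype F] (hψ : ∀ x : F, x ≠ 0 → ∑ a, ψ (x * a) = 0)
    (c : Fin n → F) (hc : c ≠ 0) : ∑ a : Fin n → F, ψ (-(a ⬝ᵥ c)) = 0 := by
  classical
  obtain ⟨i, hi⟩ := Function.ne_iff.1 hc
  have h1 : ∀ a : Fin n → F, ψ (-(a ⬝ᵥ c)) = ∏ k, ψ (-c k * a k) := fun a => by
    rw [dotProduct, ← Finset.sum_neg_distrib]
    refine (map_prod ψ.toMonoidHom (fun k => Multiplicative.ofAdd (-(a k * c k))) _).trans ?_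
    exact Finset.prod_congr rfl fun k _ => congrArg ψ
      (by ring : -(a k * c k) = -c k * a k)
  simp_rw [h1]
  have h2 := Finset.prod_univ_sum (fun _ : Fin n => (Finset.univ : Finset F))
    fun k x => ψ (-c k * x)
  rw [Fintype.piFinset_univ] at h2
  rw [← h2]
  exact Finset.prod_eq_zero (Finset.mem_univ i) (hψ _ (neg_ne_zero.2 hi))

/-- The initial segment of length `j` of a vector. -/
def initSeg (j : Fin n) (c : Fin n → F) : Fin n → F := fun i => if i < j then c i else 0

theorem initSeg_eq_zero {j : Fin n} {c : Fin n → F} (i : Fin n) (hi : j ≤ i) :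
    initSeg j c i = 0 :=
  if_neg hi.not_gt

theorem initSeg_eq_self {j : Fin n} {c : Fin n → F} (hc : ∀ i, j ≤ i → c i = 0) :
    initSeg j c = c := by
  ext i
  rcases lt_or_ge i j with h | h
  · exact if_pos h
  · rw [initSeg_eq_zero i h, hc i h]

theorem initSeg_add (j : Fin n) (c d : Fin n → F) :
    initSeg j (c + d) = initSeg j c + initSeg j d := by
  ext i
  simp only [initSeg, Pi.add_apply]
  split_ifs <;> simp

/-- An abelian group of column elements acts on some vector of the representation by a character. -/
theorem exists_column_eigenvector [Fintype F] (hψ : ∀ x : F, x ≠ 0 → ∑ a, ψ (x * a) = 0)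
    (hq : IsUnit (Fintype.card F : K)) (j : Fin n) {W : Submodule K V}
    (hW : ∀ (c : Fin n → F) (hc : ∀ i, j ≤ i → c i = 0), ∀ v ∈ W,
      ρ (shear c (Pi.single j 1) (single_dotProduct_eq_zero hc)) v ∈ W)
    {v : V} (hv : v ∈ W) (hv0 : v ≠ 0) :
    ∃ v' ∈ W, v' ≠ 0 ∧ ∃ a : Fin n → F, ∀ (c : Fin n → F) (hc : ∀ i, j ≤ i → c i = 0),
      ρ (shear c (Pi.single j 1) (single_dotProduct_eq_zero hc)) v' = ψ (a ⬝ᵥ c) • v' := by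
  let A : (Fin n → F) → GL (Fin n) F := fun c => shear (initSeg j c) (Pi.single j 1)
    (single_dotProduct_eq_zero initSeg_eq_zero)
  have hA : ∀ c d, A c * A d = A (c + d) := fun c d => by
    simp only [A, shear_mul_shear, initSeg_add]
  have hA0 : A 0 = 1 := by
    have h := hA 0 0
    rw [add_zero] at h
    exact mul_eq_left.1 h
  -- Up to scalars, these are the projections of v to the eigenspaces of the abelian column group.
  -- By orthogonality they add up to q^n v ≠ 0, so one of them is nonzero.
  let ε : (Fin n → F) → V := fun a => ∑ c, ψ (-(a ⬝ᵥ c)) • ρ (A c) v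
  have hsum : ∑ a, ε a = (Fintype.card F : K) ^ n • v := by
    simp only [ε]
    rw [Finset.sum_comm]
    simp_rw [← Finset.sum_smul]
    rw [Finset.sum_eq_single 0]
    · simp [hA0]
    · intro c _ hc
      rw [sum_addChar_dotProduct hψ c hc, zero_smul]
    · simp
  have hne : ∑ a, ε a ≠ 0 := by
    rw [hsum]
    intro h
    exact hv0 (((hq.pow n).smul_eq_zero).1 h)
  obtain ⟨a, _, ha⟩ := Finset.exists_ne_zero_of_sum_ne_zero hne
  refine ⟨ε a, Submodule.sum_mem _ fun c _ => W.smul_mem _ (hW _ initSeg_eq_zero v hv), ha, a,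
    fun d hd => ?_⟩
  have hAd : shear d (Pi.single j 1) (single_dotProduct_eq_zero hd) = A d := by
    simp only [A, initSeg_eq_self hd]
  rw [hAd]
  simp only [ε, map_sum, map_smul, Finset.smul_sum]
  refine Fintype.sum_equiv (Equiv.addLeft d) _ _ fun c => ?_
  rw [← Module.End.mul_apply, ← map_mul, hA, Equiv.coe_addLeft, smul_smul,
    ← AddChar.map_add_eq_mul, dotProduct_add]
  congr 2
  ring

/-- Any nonzero representation of `GL_n(F)` over a ring in which `|F|` is invertible contains a
nonzero vector on which `U` acts by a linear character. -/
theorem exists_unitri_eigenvector [Fintype F] [Nontrivial V]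
    (ρ : GL (Fin n) F →* Module.End K V)
    (hψ : ∀ x : F, x ≠ 0 → ∑ a, ψ (x * a) = 0) (hq : IsUnit (Fintype.card F : K)) :
    ∃ v : V, v ≠ 0 ∧ ∃ b : Fin n → F, ∀ u ∈ unitri n F, ρ u v = ψ (superdiag b u) • v := by
  -- The columns are treated from the last to the first. After k of them, the columns j ≥ n − k act
  -- by the required character.
  have key : ∀ k ≤ n, ∃ b : Fin n → F, ∃ v ∈ columnEigenspace ρ ψ b (n - k), v ≠ 0 := by
    intro k
    induction k with
    | zero =>
      intro _
      obtain ⟨v, hv⟩ := exists_ne (0 : V)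
      exact ⟨0, v, fun j _ _ hj => absurd j.2 (by omega), hv⟩
    | succ k ih =>
      intro hk
      obtain ⟨b, v, hv, hv0⟩ := ih (by omega)
      obtain ⟨m, hm⟩ : ∃ m, n - (k + 1) = m := ⟨_, rfl⟩
      have hm1 : n - k = m + 1 := by omega
      rw [hm1] at hv
      rw [hm]
      let j : Fin n := ⟨m, by omega⟩
      have hjle : ∀ i : Fin n, m ≤ i → j ≤ i := fun i hi => hi
      -- it suffices to find an eigenvector for a functional concentrated in the last coordinate
      suffices h : ∃ v ∈ columnEigenspace ρ ψ b (m + 1), v ≠ 0 ∧ ∃ x : F,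
          ∀ (c : Fin n → F) (hc : ∀ i, j ≤ i → c i = 0),
          ρ (shear c (Pi.single j 1) (single_dotProduct_eq_zero hc)) v =
            ψ (x * prevCoord j c) • v by
        obtain ⟨v, hv, hv0, x, hx⟩ := h
        refine ⟨Function.update b j x, v, fun i c hc hi => ?_, hv0⟩
        rcases hi.eq_or_lt with h | h
        · obtain rfl : j = i := Fin.ext h
          rw [Function.update_self]
          exact hx c hc
        · rw [Function.update_of_ne (fun h' => by subst h'; exact lt_irrefl _ h)]
          exact hv i c hc h
      obtain ⟨v₁, hv₁, hv₁0, a, ha⟩ := exists_column_eigenvector (ρ := ρ) hψ hq j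
        (W := columnEigenspace ρ ψ b (m + 1))
        (fun c hc v hv => shear_mem_columnEigenspace _ (fun i hi => hc i (hjle i hi)) hv) hv hv0
      -- A shear replaces the functional a on column j by a − (a·u)w and keeps the eigenspace of the
      -- later columns. Such moves make a a multiple of coordinate j − 1.
      have move : ∀ {u w : Fin n → F} (hwu : w ⬝ᵥ u = 0) (hu : ∀ i, j ≤ i → u i = 0) {v : V}
          {a : Fin n → F}, (∀ (c : Fin n → F) (hc : ∀ i, j ≤ i → c i = 0),
            ρ (shear c (Pi.single j 1) (single_dotProduct_eq_zero hc)) v = ψ (a ⬝ᵥ c) • v) →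
          ∀ (c : Fin n → F) (hc : ∀ i, j ≤ i → c i = 0),
            ρ (shear c (Pi.single j 1) (single_dotProduct_eq_zero hc)) (ρ (shear u w hwu) v) =
              ψ ((a - (a ⬝ᵥ u) • w) ⬝ᵥ c) • ρ (shear u w hwu) v := by
        intro u w hwu hu v a ha c hc
        rw [apply_apply_shear hwu hu hc, ha _ fun i hi => by simp [hu i hi, hc i hi], map_smul]
        congr 2
        rw [dotProduct_sub, sub_dotProduct, dotProduct_smul, smul_dotProduct, smul_eq_mul,
          smul_eq_mul, mul_comm]
      by_cases hall : ∀ i, i < j → a i = 0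
      · refine ⟨v₁, hv₁, hv₁0, 0, fun c hc => ?_⟩
        rw [ha c hc, zero_mul, dotProduct, Finset.sum_eq_zero]
        intro i _
        rcases lt_or_ge i j with h | h
        · rw [hall i h, zero_mul]
        · rw [hc i h, mul_zero]
      push Not at hall
      obtain ⟨i, hij, hai⟩ := hall
      have hij' : (i : ℕ) < m := hij
      let l : Fin n := ⟨m - 1, by omega⟩
      have hlj : l < j := Fin.lt_def.2 (by change m - 1 < m; omega)
      have hl : (l : ℕ) + 1 = j := by change m - 1 + 1 = m; omega
      have hsingle : ∀ (i : Fin n) (x : F), i < j → ∀ k, j ≤ k →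
          (Pi.single i x : Fin n → F) k = 0 := fun i x hi k hk => by
        rw [Pi.single_eq_of_ne (hi.trans_le hk).ne']
      -- If a_l = 0, the move with u = e_i and w = e_l changes this coordinate to −a_i ≠ 0.
      obtain ⟨v₂, hv₂, hv₂0, a₂, ha₂, ha₂l⟩ : ∃ v ∈ columnEigenspace ρ ψ b (m + 1), v ≠ 0 ∧
          ∃ a : Fin n → F, (∀ (c : Fin n → F) (hc : ∀ i, j ≤ i → c i = 0),
            ρ (shear c (Pi.single j 1) (single_dotProduct_eq_zero hc)) v = ψ (a ⬝ᵥ c) • v) ∧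
            a l ≠ 0 := by
        by_cases hal : a l = 0
        · have hli : l ≠ i := fun h => hai (h ▸ hal)
          have hwu : (Pi.single l 1 : Fin n → F) ⬝ᵥ Pi.single i 1 = 0 := by simp [hli]
          refine ⟨_, shear_mem_columnEigenspace hwu
            (fun k hk => hsingle i 1 hij k (hjle k hk)) hv₁, apply_ne_zero hv₁0 _, _,
            move hwu (hsingle i 1 hij) ha, ?_⟩
          simpa [hal] using hai
        · exact ⟨v₁, hv₁, hv₁0, a, ha, hal⟩
      -- Chosen so that the move with u = e_l removes all coordinates of a₂ except the one at l.
      let w : Fin n → F := (a₂ l)⁻¹ • (a₂ - Pi.single l (a₂ l))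
      have hwu : w ⬝ᵥ Pi.single l 1 = 0 := by simp [w]
      refine ⟨_, shear_mem_columnEigenspace hwu (fun k hk => hsingle l 1 hlj k (hjle k hk)) hv₂,
        apply_ne_zero hv₂0 _, a₂ l, fun c hc => ?_⟩
      rw [move hwu (hsingle l 1 hlj) ha₂ c hc, prevCoord_eq hl]
      congr 2
      have : a₂ - (a₂ ⬝ᵥ Pi.single l 1) • w = Pi.single l (a₂ l) := by
        rw [dotProduct_single, mul_one, smul_smul, mul_inv_cancel₀ ha₂l, one_smul,
          sub_sub_cancel]
      rw [this, single_dotProduct]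
  obtain ⟨b, v, hv, hv0⟩ := key n le_rfl
  rw [Nat.sub_self] at hv
  refine ⟨v, hv0, b, fun u hu => ?_⟩
  let S : Subgroup (GL (Fin n) F) :=
    { carrier := {u | u ∈ unitri n F ∧ ρ u v = ψ (superdiag b u) • v}
      one_mem' := ⟨one_mem _, by simp [superdiag_one]⟩
      mul_mem' := fun {x y} hx hy => ⟨mul_mem hx.1 hy.1, by
        rw [map_mul, Module.End.mul_apply, hy.2, map_smul, hx.2, superdiag_mul b hx.1 hy.1,
          AddChar.map_add_eq_mul, smul_smul, mul_comm]⟩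
      inv_mem' := fun {x} hx => ⟨inv_mem hx.1, by
        have h1 : ρ x⁻¹ (ρ x v) = v := by
          rw [← Module.End.mul_apply, ← map_mul, inv_mul_cancel, map_one, Module.End.one_apply]
        rw [hx.2, map_smul] at h1
        have h2 : superdiag b x⁻¹ = -superdiag b x := by
          have h3 := superdiag_mul b (inv_mem hx.1) hx.1
          rw [inv_mul_cancel, superdiag_one] at h3
          exact eq_neg_of_add_eq_zero_left h3.symm
        rw [h2]
        conv_rhs => rw [← h1]
        rw [smul_smul, ← AddChar.map_add_eq_mul, neg_add_cancel, AddChar.map_zero_eq_one,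
          one_smul]⟩ }
  have hS : unitri n F ≤ S := unitri_le_of_shear_mem fun j c hc =>
    ⟨shear_single_mem_unitri hc, by
      rw [hv j c hc (Nat.zero_le _), superdiag_shear]⟩
  exact (hS hu).2

end Eigenvector

/-! ### The action of the torus, reflections and root elements on e -/

section CosetElements

variable {n : ℕ} {F : Type*} [Field F] [Fintype F] {R : Type*} [CommRing R]

open Classical in
/-- The sum in `RG` of the elements of the coset `gB`. -/
noncomputable def cosetElt (R : Type*) [CommRing R] (g : GL (Fin n) F) :
    MonoidAlgebra R (GL (Fin n) F) :=
  MonoidAlgebra.single g 1 * ∑ b : borel n F, MonoidAlgebra.single (b : GL (Fin n) F) (1 : R)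

theorem single_mul_cosetElt (g h : GL (Fin n) F) :
    MonoidAlgebra.single g 1 * cosetElt R h = cosetElt R (g * h) := by
  rw [cosetElt, cosetElt, ← mul_assoc, MonoidAlgebra.single_mul_single, one_mul]

theorem cosetElt_mul_of_mem (g : GL (Fin n) F) {b : GL (Fin n) F} (hb : b ∈ borel n F) :
    cosetElt R (g * b) = cosetElt R g := by
  classical
  rw [← single_mul_cosetElt, cosetElt, cosetElt]
  congr 1
  rw [Finset.mul_sum]
  refine Fintype.sum_equiv (Equiv.mulLeft (⟨b, hb⟩ : borel n F)) _ _ fun c => ?_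
  simp [MonoidAlgebra.single_mul_single]

theorem steinbergElt_eq_sum :
    steinbergElt n F R =
      ∑ σ : Equiv.Perm (Fin n), ((Equiv.Perm.sign σ : ℤ) : R) • cosetElt R (permGL n F σ) := by
  classical
  rw [steinbergElt, Finset.sum_mul]
  refine Finset.sum_congr rfl fun σ _ => ?_
  rw [cosetElt, ← smul_mul_assoc, MonoidAlgebra.smul_single]
  simp

theorem single_mul_steinbergElt (g : GL (Fin n) F) :
    MonoidAlgebra.single g 1 * steinbergElt n F R =
      ∑ σ : Equiv.Perm (Fin n), ((Equiv.Perm.sign σ : ℤ) : R) •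
        cosetElt R (g * permGL n F σ) := by
  rw [steinbergElt_eq_sum, Finset.mul_sum]
  refine Finset.sum_congr rfl fun σ _ => ?_
  rw [mul_smul_comm, single_mul_cosetElt]

theorem diagGL_mul_steinbergElt (d : Fin n → Fˣ) :
    MonoidAlgebra.single (diagGL d) 1 * steinbergElt n F R = steinbergElt n F R := by
  rw [single_mul_steinbergElt, steinbergElt_eq_sum]
  refine Finset.sum_congr rfl fun σ _ => ?_
  have h : (permGL n F σ)⁻¹ * diagGL d * permGL n F σ ∈ borel n F := mem_borel.2 fun p q hpq => by
    rw [permGL_inv_mul_mul_apply, diagGL_apply, if_neg fun h => hpq.ne' (σ.injective h)]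
  rw [← cosetElt_mul_of_mem (permGL n F σ) h]
  congr 2
  group

theorem cosetElt_mul_permGL {i j : Fin n} {y : GL (Fin n) F}
    (hy : ∀ p q, (y : Matrix (Fin n) (Fin n) F) p q ≠ 0 → p = q ∨ p = i ∧ q = j)
    {σ : Equiv.Perm (Fin n)} (hσ : σ⁻¹ i < σ⁻¹ j) (g : GL (Fin n) F) :
    cosetElt R (g * y * permGL n F σ) = cosetElt R (g * permGL n F σ) := by
  rw [← cosetElt_mul_of_mem (g * permGL n F σ) (permGL_conj_mem_borel hy hσ)]
  congr 1
  group

theorem swap_mul_steinbergElt {i j : Fin n} (hij : i ≠ j) :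
    MonoidAlgebra.single (permGL n F (Equiv.swap i j)) 1 * steinbergElt n F R =
      -steinbergElt n F R := by
  rw [single_mul_steinbergElt, steinbergElt_eq_sum, ← Finset.sum_neg_distrib]
  refine Fintype.sum_equiv (Equiv.mulLeft (Equiv.swap i j)) _ _ fun σ => ?_
  rw [← map_mul, Equiv.coe_mulLeft, map_mul Equiv.Perm.sign, Equiv.Perm.sign_swap hij]
  simp

/-- The action of `w_r x`, where `x` is a nontrivial root element for the fundamental root `r`, on
the Steinberg element. -/
theorem swap_mul_rootElt_mul_steinbergElt {i j : Fin n} (hij : i ≠ j) {a : F} (ha : a ≠ 0) :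
    MonoidAlgebra.single (permGL n F (Equiv.swap i j) * rootElt i j hij a) 1 *
        steinbergElt n F R =
      MonoidAlgebra.single (rootElt i j hij a⁻¹) 1 * steinbergElt n F R - steinbergElt n F R := by
  set s := permGL n F (Equiv.swap i j) with hs
  have hss : s * s = 1 := by rw [hs, ← map_mul, Equiv.swap_mul_self, map_one]
  rw [← sub_eq_zero, single_mul_steinbergElt, single_mul_steinbergElt, steinbergElt_eq_sum,
    ← Finset.sum_sub_distrib, ← Finset.sum_sub_distrib]
  simp_rw [← smul_sub]
  -- The terms for σ and (i j)σ cancel. For σ the root elements are absorbed into σB; for (i j)σ the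
  -- rank one relation identifies the first two cosets, and the signs are opposite.
  have key : ∀ σ : Equiv.Perm (Fin n), σ⁻¹ i < σ⁻¹ j →
      ((Equiv.Perm.sign σ : ℤ) : R) • (cosetElt R (s * rootElt i j hij a * permGL n F σ) -
          (cosetElt R (rootElt i j hij a⁻¹ * permGL n F σ) - cosetElt R (permGL n F σ))) +
        ((Equiv.Perm.sign (Equiv.swap i j * σ) : ℤ) : R) •
          (cosetElt R (s * rootElt i j hij a * permGL n F (Equiv.swap i j * σ)) -
          (cosetElt R (rootElt i j hij a⁻¹ * permGL n F (Equiv.swap i j * σ)) -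
            cosetElt R (permGL n F (Equiv.swap i j * σ)))) = 0 := by
    intro σ hσ
    obtain ⟨y, hy, hyeq⟩ := swap_mul_rootElt_mul_swap hij ha
    have h1 : cosetElt R (s * rootElt i j hij a * permGL n F σ) = cosetElt R (s * permGL n F σ) :=
      cosetElt_mul_permGL (rootElt_support hij a) hσ s
    have h2 : cosetElt R (rootElt i j hij a⁻¹ * permGL n F σ) = cosetElt R (permGL n F σ) := by
      have := cosetElt_mul_permGL (R := R) (rootElt_support hij a⁻¹) hσ 1
      rwa [one_mul, one_mul] at this
    have h3 : cosetElt R (s * rootElt i j hij a * permGL n F (Equiv.swap i j * σ)) =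
        cosetElt R (rootElt i j hij a⁻¹ * permGL n F (Equiv.swap i j * σ)) := by
      rw [map_mul, ← mul_assoc, hyeq, cosetElt_mul_permGL hy hσ, mul_assoc]
    rw [h1, h2, h3, map_mul Equiv.Perm.sign, Equiv.Perm.sign_swap hij, map_mul, ← hs]
    simp
  refine Finset.sum_involution (fun σ _ => Equiv.swap i j * σ) (fun σ _ => ?_) (fun σ _ _ h => ?_)
    (fun _ _ => Finset.mem_univ _) (fun σ _ => ?_)
  · have hne : σ⁻¹ i ≠ σ⁻¹ j := fun h => hij (σ⁻¹.injective h)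
    rcases lt_or_gt_of_ne hne with h | h
    · exact key σ h
    · have h' := key (Equiv.swap i j * σ) (by
        rw [_root_.mul_inv_rev, Equiv.swap_inv]
        simpa using h)
      rw [← mul_assoc, Equiv.swap_mul_self, one_mul, add_comm] at h'
      exact h'
  · have := Equiv.swap_eq_one_iff.1 (mul_eq_right.1 h)
    exact hij this
  · rw [← mul_assoc, Equiv.swap_mul_self, one_mul]

end CosetElements

/-! ### The elements ue span the lattice -/

section LatticeRep

variable (n : ℕ) (F : Type*) [Field F] [Fintype F] (R : Type*) [CommRing R]

/-- The representation of `G` given by a module over its group algebra. -/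
noncomputable def moduleRep (K G V : Type*) [CommRing K] [Monoid G] [AddCommGroup V] [Module K V]
    [Module (MonoidAlgebra K G) V] [IsScalarTower K (MonoidAlgebra K G) V] :
    G →* Module.End K V where
  toFun g :=
    { toFun := fun x => (MonoidAlgebra.single g 1 : MonoidAlgebra K G) • x
      map_add' := smul_add _
      map_smul' := fun r x => by
        rw [RingHom.id_apply, ← algebraMap_smul (MonoidAlgebra K G) r x,
          ← algebraMap_smul (MonoidAlgebra K G) r (_ • x), ← mul_smul, ← mul_smul,
          Algebra.commutes] }
  map_one' := LinearMap.ext fun x => one_smul (MonoidAlgebra K G) x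
  map_mul' g h := LinearMap.ext fun x => by
    change (MonoidAlgebra.single (g * h) 1 : MonoidAlgebra K G) • x =
      (MonoidAlgebra.single g 1 : MonoidAlgebra K G) • (MonoidAlgebra.single h 1 : MonoidAlgebra K G) • x
    rw [← mul_smul, MonoidAlgebra.single_mul_single, one_mul]

/-- The representation of `G` on the lattice `I`. -/
noncomputable def latticeRep : GL (Fin n) F →* Module.End R (lattice n F R) :=
  moduleRep R (GL (Fin n) F) (lattice n F R)

variable {n F R}

theorem latticeRep_apply (g : GL (Fin n) F) (x : lattice n F R) :
    latticeRep n F R g x = (MonoidAlgebra.single g 1 : MonoidAlgebra R (GL (Fin n) F)) • x :=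
  rfl

theorem single_smul_eq (g : GL (Fin n) F) (r : R) (x : lattice n F R) :
    (MonoidAlgebra.single g r : MonoidAlgebra R (GL (Fin n) F)) • x =
      r • latticeRep n F R g x := by
  rw [latticeRep_apply, ← smul_assoc, MonoidAlgebra.smul_single, smul_eq_mul, mul_one]

theorem latticeRep_mul_apply (g h : GL (Fin n) F) (x : lattice n F R) :
    latticeRep n F R g (latticeRep n F R h x) = latticeRep n F R (g * h) x := by
  rw [map_mul, Module.End.mul_apply]

theorem coe_latticeGen :
    (latticeGen n F R : MonoidAlgebra R (GL (Fin n) F)) = steinbergElt n F R := rfl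

theorem coe_latticeRep_latticeGen (g : GL (Fin n) F) :
    (latticeRep n F R g (latticeGen n F R) : MonoidAlgebra R (GL (Fin n) F)) =
      MonoidAlgebra.single g 1 * steinbergElt n F R := rfl

theorem diagGL_latticeGen (d : Fin n → Fˣ) :
    latticeRep n F R (diagGL d) (latticeGen n F R) = latticeGen n F R :=
  Subtype.ext (by rw [coe_latticeRep_latticeGen, coe_latticeGen, diagGL_mul_steinbergElt])

/-- The `R`-span of the elements `ue`, `u ∈ U`. -/
noncomputable def unitriSpan (n : ℕ) (F : Type*) [Field F] [Fintype F] (R : Type*) [CommRing R] :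
    Submodule R (lattice n F R) :=
  Submodule.span R (Set.range fun u : unitri n F =>
    latticeRep n F R (u : GL (Fin n) F) (latticeGen n F R))

theorem unitri_smul_mem_unitriSpan {u : GL (Fin n) F} (hu : u ∈ unitri n F) :
    latticeRep n F R u (latticeGen n F R) ∈ unitriSpan n F R :=
  Submodule.subset_span ⟨⟨u, hu⟩, rfl⟩

theorem borel_smul_mem_unitriSpan {b : GL (Fin n) F} (hb : b ∈ borel n F) :
    latticeRep n F R b (latticeGen n F R) ∈ unitriSpan n F R := by
  obtain ⟨u, hu, d, rfl⟩ := exists_unitri_mul_diagGL hb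
  rw [← latticeRep_mul_apply, diagGL_latticeGen]
  exact unitri_smul_mem_unitriSpan hu

theorem map_mem_unitriSpan {f : Module.End R (lattice n F R)}
    (hf : ∀ u ∈ unitri n F, f (latticeRep n F R u (latticeGen n F R)) ∈ unitriSpan n F R)
    {x : lattice n F R} (hx : x ∈ unitriSpan n F R) : f x ∈ unitriSpan n F R := by
  induction hx using Submodule.span_induction with
  | mem x hx =>
    obtain ⟨u, rfl⟩ := hx
    exact hf u u.2
  | zero => rw [map_zero]; exact zero_mem _
  | add x y _ _ hx hy => rw [map_add]; exact add_mem hx hy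
  | smul r x _ hx => rw [map_smul]; exact Submodule.smul_mem _ r hx

/-- G is generated by B and the fundamental reflections s. Stability under B holds because the torus
fixes e. For s, split u = vx with svs ∈ U and x a root element; then sxe is −e or x'e − e. -/
theorem latticeRep_mem_unitriSpan (g : GL (Fin n) F) :
    ∀ x ∈ unitriSpan n F R, latticeRep n F R g x ∈ unitriSpan n F R := by
  have hborel : ∀ b ∈ borel n F, ∀ x ∈ unitriSpan n F R,
      latticeRep n F R b x ∈ unitriSpan n F R := fun b hb x hx =>
      map_mem_unitriSpan (fun u hu => by
    rw [latticeRep_mul_apply]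
    exact borel_smul_mem_unitriSpan (mul_mem hb (unitri_le_borel hu))) hx
  refine induction_left (p := fun g => ∀ x ∈ unitriSpan n F R,
    latticeRep n F R g x ∈ unitriSpan n F R) (fun x hx => by simpa using hx)
    (fun b hb g hg x hx => ?_) (fun r hr g hg x hx => ?_) g
  · rw [← latticeRep_mul_apply]
    exact hborel b hb _ (hg x hx)
  · rw [← latticeRep_mul_apply]
    refine map_mem_unitriSpan (fun u hu => ?_) (hg x hx)
    have hne := (lt_of_mem_simpleRoots hr).ne
    obtain ⟨v, hv, a, rfl, hsv⟩ := exists_unitri_eq_mul_rootElt hr hu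
    set s := permGL n F (Equiv.swap r.1 r.2) with hs
    have hss : s * s = 1 := by rw [hs, ← map_mul, Equiv.swap_mul_self, map_one]
    have e : s * (v * rootElt r.1 r.2 hne a) = (s * v * s) * (s * rootElt r.1 r.2 hne a) := by
      simp only [mul_assoc, ← mul_assoc s s, hss, one_mul]
    rw [latticeRep_mul_apply, e, ← latticeRep_mul_apply]
    refine hborel _ (unitri_le_borel hsv) _ ?_
    have hgen : latticeGen n F R ∈ unitriSpan n F R := by
      have := unitri_smul_mem_unitriSpan (R := R) (one_mem (unitri n F))
      rwa [map_one] at this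
    by_cases ha : a = 0
    · subst ha
      have : latticeRep n F R (s * rootElt r.1 r.2 hne 0) (latticeGen n F R) =
          -latticeGen n F R := by
        rw [rootElt_zero, mul_one]
        exact Subtype.ext (by
          rw [coe_latticeRep_latticeGen, Submodule.coe_neg, coe_latticeGen,
            swap_mul_steinbergElt hne])
      rw [this]
      exact neg_mem hgen
    · have : latticeRep n F R (s * rootElt r.1 r.2 hne a) (latticeGen n F R) =
          latticeRep n F R (rootElt r.1 r.2 hne a⁻¹) (latticeGen n F R) - latticeGen n F R :=
        Subtype.ext (by
          rw [coe_latticeRep_latticeGen, Submodule.coe_sub, coe_latticeRep_latticeGen,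
            coe_latticeGen, swap_mul_rootElt_mul_steinbergElt hne ha])
      rw [this]
      exact sub_mem (unitri_smul_mem_unitriSpan
        (rootElt_mem_unitri (lt_of_mem_simpleRoots hr) _)) hgen

/-- The elements `ue`, `u ∈ U`, span `I` over `R`. -/
theorem unitriSpan_eq_top : unitriSpan n F R = ⊤ := by
  rw [eq_top_iff]
  intro x hx
  clear hx
  obtain ⟨a, ha⟩ := Submodule.mem_span_singleton.1 x.2
  obtain rfl : a • latticeGen n F R = x := Subtype.ext ha
  clear ha
  induction a using MonoidAlgebra.induction_linear with
  | zero => rw [zero_smul]; exact zero_mem _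
  | add a b ha hb => rw [add_smul]; exact add_mem ha hb
  | single g r =>
    rw [single_smul_eq]
    refine Submodule.smul_mem _ _ (latticeRep_mem_unitriSpan g _ ?_)
    have := unitri_smul_mem_unitriSpan (R := R) (one_mem (unitri n F))
    rwa [map_one] at this

instance : Module.Finite R (lattice n F R) :=
  ⟨unitriSpan_eq_top (n := n) (F := F) (R := R) ▸
    Submodule.fg_span (Set.finite_range _)⟩

end LatticeRep

/-! ### Values of the form on the elements E_χ -/

section Form

variable {n : ℕ} {F : Type*} [Field F] [Fintype F] {R : Type*} [CommRing R]

theorem gowForm_comm (x y : lattice n F R) : gowForm x y = gowForm y x := by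
  simp only [gowForm, mul_comm]

theorem gowForm_smul_left (r : R) (x y : lattice n F R) :
    gowForm (r • x) y = r * gowForm x y := by
  rw [gowForm, gowForm, Finset.mul_sum]
  refine Finset.sum_congr rfl fun c _ => ?_
  rw [Submodule.coe_smul_of_tower, MonoidAlgebra.coeff_smul_apply, smul_eq_mul, mul_assoc]

variable (n F R) in
/-- The form `f` as a bilinear map. -/
noncomputable def gowBilin : lattice n F R →ₗ[R] lattice n F R →ₗ[R] R :=
  LinearMap.mk₂ R gowForm gowForm_add_left (fun r x y => gowForm_smul_left r x y)
    (fun x y z => by rw [gowForm_comm, gowForm_add_left, gowForm_comm y, gowForm_comm z])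
    (fun r x y => by rw [gowForm_comm, gowForm_smul_left, gowForm_comm]; rfl)

theorem gowBilin_apply (x y : lattice n F R) : gowBilin n F R x y = gowForm x y := rfl

theorem gowForm_latticeRep (g : GL (Fin n) F) (x y : lattice n F R) :
    gowForm (latticeRep n F R g x) y = gowForm x (latticeRep n F R g⁻¹ y) := by
  rw [latticeRep_apply, gowForm_single_smul, one_mul, latticeRep_apply]

open Classical in
theorem coeff_cosetElt (g h : GL (Fin n) F) :
    (cosetElt R g).coeff h =
      if (g : GL (Fin n) F ⧸ borel n F) = h then 1 else 0 := by
  have : cosetElt R g = ∑ b : borel n F,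
      MonoidAlgebra.single (g * (b : GL (Fin n) F)) (1 : R) := by
    rw [cosetElt, Finset.mul_sum]
    simp [MonoidAlgebra.single_mul_single]
  rw [this, MonoidAlgebra.coeff_sum, Finset.sum_apply']
  simp only [MonoidAlgebra.coeff_single, Finsupp.single_apply, QuotientGroup.eq]
  split_ifs with hb
  · rw [Finset.sum_eq_single ⟨g⁻¹ * h, hb⟩]
    · simp
    · intro b _ hne
      rw [if_neg]
      rintro rfl
      exact hne (Subtype.ext (by simp))
    · simp
  · refine Finset.sum_eq_zero fun b _ => if_neg ?_
    rintro rfl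
    exact hb (by simp)

theorem gowForm_latticeGen (x : lattice n F R) :
    gowForm x (latticeGen n F R) = ∑ σ : Equiv.Perm (Fin n), ((Equiv.Perm.sign σ : ℤ) : R) *
      (x : MonoidAlgebra R (GL (Fin n) F)).coeff (permGL n F σ) := by
  classical
  have hcoeff : ∀ g, (latticeGen n F R : MonoidAlgebra R (GL (Fin n) F)).coeff g =
      ∑ σ : Equiv.Perm (Fin n), ((Equiv.Perm.sign σ : ℤ) : R) *
        if (permGL n F σ : GL (Fin n) F ⧸ borel n F) = g then 1 else 0 := fun g => by
    rw [coe_latticeGen, steinbergElt_eq_sum, MonoidAlgebra.coeff_sum, Finset.sum_apply']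
    refine Finset.sum_congr rfl fun σ _ => ?_
    rw [MonoidAlgebra.coeff_smul_apply, coeff_cosetElt, smul_eq_mul]
  simp only [gowForm, hcoeff, Finset.mul_sum, QuotientGroup.out_eq']
  rw [Finset.sum_comm]
  refine Finset.sum_congr rfl fun σ _ => ?_
  rw [Finset.sum_eq_single (permGL n F σ : GL (Fin n) F ⧸ borel n F)]
  · obtain ⟨b, hb⟩ := QuotientGroup.mk_out_eq_mul (borel n F) (permGL n F σ)
    rw [if_pos rfl, mul_one, mul_comm, hb, coeff_mul_borel x.2 _ b.2]
  · intro c _ hc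
    rw [if_neg hc.symm, mul_zero, mul_zero]
  · simp

-- By disjointness of the Bruhat cells, uσB can only meet the support of e in σB itself, and the two
-- signs of σ multiply to 1.
open Classical in
theorem gowForm_unitri_smul (u : unitri n F) :
    gowForm (latticeRep n F R (u : GL (Fin n) F) (latticeGen n F R)) (latticeGen n F R) =
      ∑ σ : Equiv.Perm (Fin n), if u ∈ unitriConj F σ then 1 else 0 := by
  rw [gowForm_latticeGen]
  refine Finset.sum_congr rfl fun σ _ => ?_
  rw [coe_latticeRep_latticeGen, single_mul_steinbergElt, MonoidAlgebra.coeff_sum,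
    Finset.sum_apply', Finset.sum_eq_single σ]
  · rw [MonoidAlgebra.coeff_smul_apply, coeff_cosetElt, smul_eq_mul, ← mul_assoc]
    have h1 : (((u : GL (Fin n) F) * permGL n F σ : GL (Fin n) F) : GL (Fin n) F ⧸ borel n F) =
        permGL n F σ ↔ u ∈ unitriConj F σ := by
      rw [eq_comm, QuotientGroup.eq, mem_unitriConj_iff_conj, mul_assoc]
    have h2 : ((Equiv.Perm.sign σ : ℤ) : R) * ((Equiv.Perm.sign σ : ℤ) : R) = 1 := by
      rw [← Int.cast_mul, ← Units.val_mul, Int.units_mul_self]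
      simp
    rw [h2, one_mul]
    simp only [h1]
  · intro τ _ hτ
    rw [MonoidAlgebra.coeff_smul_apply, coeff_cosetElt, if_neg, smul_zero]
    intro h
    rw [eq_comm, QuotientGroup.eq, ← mul_assoc] at h
    exact hτ (perm_eq_of_conj_mem_borel u.2 h).symm
  · simp

open Classical in
theorem charElt_eq_sum (χ : unitri n F →* Rˣ) :
    charElt χ = ∑ u : unitri n F, (χ u : R) •
      latticeRep n F R (u : GL (Fin n) F) (latticeGen n F R) := by
  rw [charElt]
  exact Finset.sum_congr rfl fun u _ => single_smul_eq _ _ _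

theorem latticeRep_charElt (χ : unitri n F →* Rˣ) (v : unitri n F) :
    latticeRep n F R (v : GL (Fin n) F) (charElt χ) = ((χ v)⁻¹ : Rˣ) • charElt χ := by
  classical
  rw [charElt_eq_sum, map_sum, Finset.smul_sum]
  refine Fintype.sum_equiv (Equiv.mulLeft v) _ _ fun u => ?_
  rw [map_smul, latticeRep_mul_apply, Equiv.coe_mulLeft]
  dsimp only
  rw [map_mul χ, Units.val_mul, Subgroup.coe_mul, Units.smul_def, smul_smul, ← mul_assoc, Units.inv_mul, one_mul]

open Classical in
/-- The projection to the eigenspaces of `U`. -/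
theorem sum_char_smul_unitri (χ : unitri n F →* Rˣ) (v : unitri n F) :
    ∑ u : unitri n F, (χ u : R) • latticeRep n F R (u : GL (Fin n) F)
      (latticeRep n F R (v : GL (Fin n) F) (latticeGen n F R)) = ((χ v)⁻¹ : Rˣ) • charElt χ := by
  rw [charElt_eq_sum, Finset.smul_sum]
  refine Fintype.sum_equiv (Equiv.mulRight v) _ _ fun u => ?_
  rw [latticeRep_mul_apply, Equiv.coe_mulRight]
  dsimp only
  rw [map_mul χ, Units.val_mul, Subgroup.coe_mul, Units.smul_def, smul_smul, mul_comm (χ u : R), ← mul_assoc, Units.inv_mul,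
    one_mul]

-- The operator ∑ χ(u)u sends each spanning element ve to χ(v)⁻¹E_χ, so its image lies on the line
-- of E_χ.
open Classical in
theorem exists_sum_char_smul_eq (χ : unitri n F →* Rˣ) (x : lattice n F R) :
    ∃ r : R, ∑ u : unitri n F, (χ u : R) • latticeRep n F R (u : GL (Fin n) F) x =
      r • charElt χ := by
  have hx : x ∈ unitriSpan n F R := by rw [unitriSpan_eq_top]; trivial
  rw [unitriSpan] at hx
  induction hx using Submodule.span_induction with
  | mem x hx =>
    obtain ⟨v, rfl⟩ := hx
    exact ⟨_, sum_char_smul_unitri χ v⟩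
  | zero => exact ⟨0, by simp⟩
  | add x y _ _ hx hy =>
    obtain ⟨r, hr⟩ := hx
    obtain ⟨s, hs⟩ := hy
    exact ⟨r + s, by simp only [map_add, smul_add, Finset.sum_add_distrib, hr, hs, add_smul]⟩
  | smul a x _ hx =>
    obtain ⟨r, hr⟩ := hx
    refine ⟨a * r, ?_⟩
    rw [mul_smul, ← hr, Finset.smul_sum]
    exact Finset.sum_congr rfl fun u _ => by rw [map_smul, smul_comm]

theorem diagGL_conj_latticeGen (d : Fin n → Fˣ) (g : GL (Fin n) F) :
    latticeRep n F R (diagGL d)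
        (latticeRep n F R ((diagGL d)⁻¹ * g * diagGL d) (latticeGen n F R)) =
      latticeRep n F R g (latticeGen n F R) := by
  have h : diagGL d * ((diagGL d)⁻¹ * g * diagGL d) = g * diagGL d := by group
  rw [latticeRep_mul_apply, h, ← latticeRep_mul_apply, diagGL_latticeGen]

/-- The diagonal matrices permute the elements `E_χ`. -/
theorem diagGL_charElt {χ χ' : unitri n F →* Rˣ} (d : Fin n → Fˣ)
    (h : ∀ u : unitri n F, χ ⟨_, diagGL_conj_mem_unitri d u.2⟩ = χ' u) :
    latticeRep n F R (diagGL d) (charElt χ) = charElt χ' := by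
  classical
  rw [charElt_eq_sum, charElt_eq_sum, map_sum]
  symm
  let φ : unitri n F → unitri n F := fun u => ⟨_, diagGL_conj_mem_unitri d u.2⟩
  have hφ : Function.Injective φ := fun u v huv => by
    have h1 : (diagGL d)⁻¹ * (u : GL (Fin n) F) * diagGL d =
        (diagGL d)⁻¹ * (v : GL (Fin n) F) * diagGL d := congrArg Subtype.val huv
    exact Subtype.ext (mul_left_cancel (mul_right_cancel h1))
  refine Fintype.sum_bijective φ (Finite.injective_iff_bijective.1 hφ) _ _ fun u => ?_
  rw [map_smul, ← h, ← diagGL_conj_latticeGen d u]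

theorem sum_hom_subgroup {U : Type*} [Group U] [Fintype U] [IsDomain R] (χ : U →* Rˣ)
    (S : Subgroup U) [DecidablePred (· ∈ S)] [Decidable (∀ u ∈ S, χ u = 1)] :
    ∑ u, (if u ∈ S then (χ u : R) else 0) = if ∀ u ∈ S, χ u = 1 then (Nat.card S : R) else 0 := by
  classical
  rw [← Finset.sum_filter, Finset.sum_subtype (p := (· ∈ S)) _ (by simp)]
  let f : S →* R := (Units.coeHom R).comp (χ.comp S.subtype)
  have hf : f = 1 ↔ ∀ u ∈ S, χ u = 1 := by
    simp [f, DFunLike.ext_iff]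
  refine (sum_hom_units f).trans ?_
  simp only [hf, Nat.card_eq_fintype_card, Nat.cast_ite, Nat.cast_zero]

section Domain

variable [IsDomain R] {ψ : AddChar F R}

/-- The value χ(u) depends only on the entries u_{i,i+1} with root in J(χ). If σ⁻¹ reverses such a
root, that entry vanishes on U ∩ σBσ⁻¹; if not, the whole root subgroup lies in it. -/
theorem restrict_eq_one_iff (hq : (Fintype.card F : R) ≠ 0)
    (hψ : ∀ x : F, x ≠ 0 → ∑ a, ψ (x * a) = 0) (χ : unitri n F →* Rˣ)
    (σ : Equiv.Perm (Fin n)) :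
    (∀ u ∈ unitriConj F σ, χ u = 1) ↔ ∀ r ∈ rootSupport χ, σ⁻¹ r.2 < σ⁻¹ r.1 := by
  constructor
  · intro h r hr
    have hrs := rootSupport_subset χ hr
    have hlt := lt_of_mem_simpleRoots hrs
    obtain ⟨a, ha⟩ := (mem_rootSupport hrs).1 hr
    by_contra! hle
    have hlt' := hle.lt_of_ne fun he => hlt.ne (σ⁻¹.injective he)
    exact ha (h _ (mem_unitriConj_iff_conj.2
      (permGL_conj_mem_borel (rootElt_support hlt.ne a) hlt')))
  · intro h u hu
    obtain ⟨b, rfl⟩ := exists_eq_unitriChar hq hψ χ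
    rw [rootSupport_unitriChar hq hψ] at h
    apply Units.ext
    rw [coe_unitriChar, Units.val_one, superdiag, Finset.sum_eq_zero, AddChar.map_zero_eq_one]
    intro j _
    by_cases hb : b j = 0
    · rw [hb, zero_mul]
    · rw [prevCoord_eq_zero, mul_zero]
      intro i hi
      have hr : ((i, j) : Fin n × Fin n) ∈ simpleRoots n := hi
      exact mem_unitriConj.1 hu i j (lt_of_mem_simpleRoots hr) (h (i, j) ⟨hr, hb⟩)

/-- `f(E_χ, e) = [G : P_{J(χ)}]`. -/
theorem gowForm_charElt_latticeGen (hq : (Fintype.card F : R) ≠ 0)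
    (hψ : ∀ x : F, x ≠ 0 → ∑ a, ψ (x * a) = 0) (χ : unitri n F →* Rˣ) :
    gowForm (charElt χ) (latticeGen n F R) = ((parabolic n F (rootSupport χ)).index : R) := by
  classical
  have h1 : gowForm (charElt χ) (latticeGen n F R) =
      ∑ u : unitri n F, (χ u : R) * gowForm
        (latticeRep n F R (u : GL (Fin n) F) (latticeGen n F R)) (latticeGen n F R) := by
    rw [← gowBilin_apply, charElt_eq_sum, map_sum, LinearMap.sum_apply]
    refine Finset.sum_congr rfl fun u _ => ?_
    rw [map_smul, LinearMap.smul_apply, gowBilin_apply, smul_eq_mul]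
  rw [h1, index_parabolic_eq_sum_card (rootSupport_subset χ)]
  simp only [gowForm_unitri_smul, Finset.mul_sum, mul_ite, mul_one, mul_zero]
  -- For fixed σ, the sum of χ over U ∩ σBσ⁻¹ is its order or 0, according to whether χ is trivial
  -- on it.
  rw [Finset.sum_comm, Nat.cast_sum, Finset.sum_filter]
  refine Finset.sum_congr rfl fun σ _ => ?_
  rw [sum_hom_subgroup]
  simp only [restrict_eq_one_iff hq hψ]

theorem gowForm_charElt_unitri_smul (hq : (Fintype.card F : R) ≠ 0)
    (hψ : ∀ x : F, x ≠ 0 → ∑ a, ψ (x * a) = 0) (χ : unitri n F →* Rˣ) (u : unitri n F) :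
    gowForm (charElt χ) (latticeRep n F R (u : GL (Fin n) F) (latticeGen n F R)) =
      χ u * ((parabolic n F (rootSupport χ)).index : R) := by
  have h : gowForm (latticeRep n F R ((u⁻¹ : unitri n F) : GL (Fin n) F) (charElt χ))
      (latticeGen n F R) = _ := gowForm_latticeRep _ _ _
  rw [latticeRep_charElt, map_inv, inv_inv, Units.smul_def, gowForm_smul_left,
    gowForm_charElt_latticeGen hq hψ, Subgroup.coe_inv, inv_inv] at h
  exact h.symm

/-- `f(E_χ, I)` is contained in `[G : P_{J(χ)}] R`. -/
theorem index_dvd_gowForm_charElt (hq : (Fintype.card F : R) ≠ 0)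
    (hψ : ∀ x : F, x ≠ 0 → ∑ a, ψ (x * a) = 0) (χ : unitri n F →* Rˣ) (y : lattice n F R) :
    ((parabolic n F (rootSupport χ)).index : R) ∣ gowForm (charElt χ) y := by
  have hy : y ∈ unitriSpan n F R := by rw [unitriSpan_eq_top]; trivial
  rw [unitriSpan] at hy
  rw [← gowBilin_apply]
  induction hy using Submodule.span_induction with
  | mem y hy =>
    obtain ⟨u, rfl⟩ := hy
    rw [gowBilin_apply, gowForm_charElt_unitri_smul hq hψ]
    exact dvd_mul_left _ _
  | zero => simp
  | add x y _ _ hx hy => rw [map_add]; exact dvd_add hx hy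
  | smul r x _ hx => rw [map_smul]; exact hx.mul_left r

/-- The form is bilinear, so invariance under U pairs χ with χ⁻¹. Each of the |U| terms then
contributes the same index. -/
theorem gowForm_charElt_inv (hq : (Fintype.card F : R) ≠ 0)
    (hψ : ∀ x : F, x ≠ 0 → ∑ a, ψ (x * a) = 0) (χ : unitri n F →* Rˣ) :
    gowForm (charElt χ) (charElt χ⁻¹) =
      (Nat.card (unitri n F) : R) * ((parabolic n F (rootSupport χ)).index : R) := by
  classical
  rw [← gowBilin_apply, charElt_eq_sum χ⁻¹, map_sum]
  have h : ∀ u : unitri n F, gowBilin n F R (charElt χ) (((χ⁻¹ u : Rˣ) : R) •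
      latticeRep n F R (u : GL (Fin n) F) (latticeGen n F R)) =
      ((parabolic n F (rootSupport χ)).index : R) := fun u => by
    rw [map_smul, gowBilin_apply, gowForm_charElt_unitri_smul hq hψ, smul_eq_mul, ← mul_assoc,
      MonoidHom.inv_apply, Units.inv_mul, one_mul]
  rw [Finset.sum_congr rfl fun u _ => h u]
  simp

end Domain

end Form

/-! ### A simplicity criterion for modules with an invariant form -/

section SimpleCriterion

/-- A finite dimensional module with an invariant form is simple if it has an element `v` which
lies in all nonzero submodules and pairs nontrivially with the submodule it generates. -/
theorem isSimpleModule_of_form {K A V : Type*} [Field K] [Ring A] [Algebra K A] [AddCommGroup V]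
    [Module A V] [Module K V] [IsScalarTower K A V] [FiniteDimensional K V]
    (B : V →ₗ[K] V →ₗ[K] K)
    (hB : ∀ (S : Submodule A V) (v : V), (∀ s ∈ S, B v s = 0) → ∀ (a : A), ∀ s ∈ S, B (a • v) s = 0)
    {v w : V} (hv : ∀ N : Submodule A V, N ≠ ⊥ → v ∈ N) (hw : w ∈ Submodule.span A {v})
    (hvw : B v w ≠ 0) : IsSimpleModule A V := by
  have hv0 : v ≠ 0 := fun h => hvw (by rw [h, map_zero, LinearMap.zero_apply])
  set S := Submodule.span A {v} with hS
  have htop : S = ⊤ := by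
    by_contra hne
    let SK : Submodule K V := S.restrictScalars K
    have hSK : SK < ⊤ := by
      rw [lt_top_iff_ne_top]
      intro h
      apply hne
      rw [eq_top_iff]
      intro x _
      have : x ∈ SK := by rw [h]; trivial
      exact this
    -- Since dim S < dim V, the map V → S* has a nonzero kernel. It is S^⊥, an A-submodule by `hB`,
    -- so it contains v, contrary to B(v, w) ≠ 0.
    let φ : V →ₗ[K] Module.Dual K SK := (LinearMap.lcomp K K SK.subtype).comp B
    have hrank : Module.finrank K (Module.Dual K SK) < Module.finrank K V := by
      rw [Subspace.dual_finrank_eq]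
      exact Submodule.finrank_lt hSK.ne
    have hker := LinearMap.ker_ne_bot_of_finrank_lt (f := φ) hrank
    obtain ⟨x, hx, hx0⟩ := Submodule.exists_mem_ne_zero_of_ne_bot hker
    have hxS : ∀ s ∈ S, B x s = 0 := fun s hs => LinearMap.congr_fun (LinearMap.mem_ker.1 hx) ⟨s, hs⟩
    let N : Submodule A V :=
      { carrier := {y | ∀ s ∈ S, B y s = 0}
        zero_mem' := fun s _ => by simp
        add_mem' := fun {y z} hy hz s hs => by
          rw [map_add, LinearMap.add_apply, hy s hs, hz s hs, add_zero]
        smul_mem' := fun a y hy => hB S y hy a }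
    have hN : N ≠ ⊥ := fun h => hx0 (by
      have : x ∈ N := hxS
      rwa [h, Submodule.mem_bot] at this)
    exact hvw (hv N hN w hw)
  have : Nontrivial V := ⟨v, 0, hv0⟩
  refine isSimpleModule_iff _ _ |>.2 { eq_bot_or_eq_top := fun N => ?_ }
  rw [or_iff_not_imp_left]
  intro hN
  rw [eq_top_iff, ← htop, hS, Submodule.span_le, Set.singleton_subset_iff]
  exact hv N hN

end SimpleCriterion

/-! ### Divisibility by powers of ℓ in R -/

section LocalRing

variable {R : Type*} [CommRing R] [IsLocalRing R] {ℓ : ℕ}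

theorem not_isUnit_of_maximalIdeal_eq (hmax : IsLocalRing.maximalIdeal R = Ideal.span {(ℓ : R)}) :
    ¬IsUnit (ℓ : R) := by
  rw [← mem_nonunits_iff, ← IsLocalRing.mem_maximalIdeal, hmax]
  exact Ideal.mem_span_singleton_self _

theorem isUnit_of_not_dvd (hmax : IsLocalRing.maximalIdeal R = Ideal.span {(ℓ : R)}) {r : R}
    (h : ¬(ℓ : R) ∣ r) : IsUnit r := by
  by_contra hr
  rw [← mem_nonunits_iff, ← IsLocalRing.mem_maximalIdeal, hmax, Ideal.mem_span_singleton] at hr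
  exact h hr

theorem isUnit_natCast_of_coprime (hmax : IsLocalRing.maximalIdeal R = Ideal.span {(ℓ : R)})
    {m : ℕ} (h : m.Coprime ℓ) : IsUnit (m : R) := by
  refine isUnit_of_not_dvd hmax fun hdvd => not_isUnit_of_maximalIdeal_eq hmax ?_
  have : IsCoprime (m : R) (ℓ : R) := by
    have := (Nat.isCoprime_iff_coprime.2 h).map (Int.castRingHom R)
    simpa using this
  exact this.symm.isUnit_of_dvd' dvd_rfl hdvd

variable [IsDomain R] [CharZero R]

/-- Integers prime to ℓ become units of R while ℓ does not, so the ℓ-adic valuation of an integer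
can be read off in R. -/
theorem pow_dvd_natCast_iff (hℓ : ℓ.Prime)
    (hmax : IsLocalRing.maximalIdeal R = Ideal.span {(ℓ : R)}) {m k : ℕ} :
    (ℓ : R) ^ k ∣ (m : R) ↔ ℓ ^ k ∣ m := by
  refine ⟨fun h => ?_, fun h => by exact_mod_cast Nat.cast_dvd_cast (α := R) h⟩
  rcases eq_or_ne m 0 with rfl | hm
  · exact dvd_zero _
  obtain ⟨v, m', hm', rfl⟩ := Nat.exists_eq_pow_mul_and_not_dvd hm ℓ hℓ.ne_one
  by_cases hkv : k ≤ v
  · exact (pow_dvd_pow ℓ hkv).mul_right m'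
  · exfalso
    obtain ⟨d, rfl⟩ := Nat.exists_eq_add_of_lt (not_le.1 hkv)
    have hℓ0 : (ℓ : R) ^ v ≠ 0 := pow_ne_zero _ (Nat.cast_ne_zero.2 hℓ.ne_zero)
    rw [Nat.cast_mul, Nat.cast_pow, add_assoc, pow_add, mul_dvd_mul_iff_left hℓ0] at h
    have h1 : (ℓ : R) ∣ (m' : R) := (dvd_pow_self _ (Nat.succ_ne_zero d)).trans h
    have h2 := isUnit_natCast_of_coprime hmax ((hℓ.coprime_iff_not_dvd.2 hm').symm)
    exact not_isUnit_of_maximalIdeal_eq hmax (isUnit_of_dvd_unit h1 h2)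

theorem padicValNat_eq_iff (hℓ : ℓ.Prime)
    (hmax : IsLocalRing.maximalIdeal R = Ideal.span {(ℓ : R)}) {m k : ℕ} (hm : m ≠ 0) :
    padicValNat ℓ m = k ↔ (ℓ : R) ^ k ∣ (m : R) ∧ ¬(ℓ : R) ^ (k + 1) ∣ (m : R) := by
  have : Fact ℓ.Prime := ⟨hℓ⟩
  rw [pow_dvd_natCast_iff hℓ hmax, pow_dvd_natCast_iff hℓ hmax, padicValNat_dvd_iff_le hm,
    padicValNat_dvd_iff_le hm]
  omega

end LocalRing

/-! ### The induced form on M(k) -/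

section FactorModule

theorem redAlg_single {n : ℕ} {F : Type*} [Field F] {R : Type*} [CommRing R] {ℓ : ℕ}
    (g : GL (Fin n) F) (r : R) :
    redAlg n F R ℓ (MonoidAlgebra.single g r) =
      MonoidAlgebra.single g (Ideal.Quotient.mk (Ideal.span {(ℓ : R)}) r) := by
  simp [redAlg]

variable {n : ℕ} {F : Type*} [Field F] [Fintype F] {R : Type*} [CommRing R] {ℓ k : ℕ}

theorem toFactor_add {x y : lattice n F R} (hx : x ∈ filt n F R ℓ k) (hy : y ∈ filt n F R ℓ k) :
    toFactor ℓ k (x + y) (add_mem hx hy) = toFactor ℓ k x hx + toFactor ℓ k y hy := rfl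

theorem toFactor_smul (a : MonoidAlgebra R (GL (Fin n) F)) {x : lattice n F R}
    (hx : x ∈ filt n F R ℓ k) :
    toFactor ℓ k (a • x) (Submodule.smul_mem _ a hx) =
      redAlg n F R ℓ a • toFactor ℓ k x hx := by
  rw [toFactor, toFactor, ← Submodule.Quotient.mk_smul]
  congr 1
  apply Subtype.ext
  change toRed n F R ℓ (a • x) = redAlg n F R ℓ a • toRed n F R ℓ x
  rw [redAlg_smul, map_smul]

theorem toFactor_surjective (v : Factor n F R ℓ k) :
    ∃ (x : lattice n F R) (hx : x ∈ filt n F R ℓ k), toFactor ℓ k x hx = v := by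
  obtain ⟨⟨y, hy⟩, rfl⟩ := Submodule.Quotient.mk_surjective _ v
  obtain ⟨x, hx, rfl⟩ := hy
  exact ⟨x, hx, rfl⟩

theorem toFactor_eq_zero_iff {x : lattice n F R} (hx : x ∈ filt n F R ℓ k) :
    toFactor ℓ k x hx = 0 ↔ ∃ a ∈ filt n F R ℓ (k + 1), ∃ y : lattice n F R, x = a + ℓ • y := by
  rw [toFactor, Submodule.Quotient.mk_eq_zero]
  change (∃ a, a ∈ filt n F R ℓ (k + 1) ∧ toRed n F R ℓ a = toRed n F R ℓ x) ↔ _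
  refine exists_congr fun a => and_congr_right fun _ => ?_
  rw [eq_comm, ← sub_eq_zero, ← map_sub]
  change (ellMul n F R ℓ).mkQ (x - a) = 0 ↔ _
  rw [Submodule.mkQ_apply, Submodule.Quotient.mk_eq_zero]
  exact exists_congr fun y => sub_eq_iff_eq_add'

theorem toFactor_congr {x y : lattice n F R} (h : x = y) (hx : x ∈ filt n F R ℓ k) :
    toFactor ℓ k x hx = toFactor ℓ k y (h ▸ hx) := by
  subst h
  rfl

theorem toFactor_eq_iff {x y : lattice n F R} (hx : x ∈ filt n F R ℓ k)
    (hy : y ∈ filt n F R ℓ k) :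
    toFactor ℓ k x hx = toFactor ℓ k y hy ↔
      ∃ a ∈ filt n F R ℓ (k + 1), ∃ z : lattice n F R, x - y = a + ℓ • z := by
  rw [← toFactor_eq_zero_iff (sub_mem hx hy), ← sub_eq_zero]
  rfl

/-- Write x = a + ℓz with a ∈ I(k+1). Then f(a, y) is divisible by ℓ^{k+1}, and so is ℓf(z, y)
because y ∈ I(k). This makes ℓ^{-k}f well defined on M(k) modulo ℓ. -/
theorem dvd_of_toFactor_eq_zero {x y : lattice n F R} (hx : x ∈ filt n F R ℓ k)
    (h : toFactor ℓ k x hx = 0) (hy : y ∈ filt n F R ℓ k) : (ℓ : R) ^ (k + 1) ∣ gowForm x y := by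
  obtain ⟨a, ha, z, rfl⟩ := (toFactor_eq_zero_iff hx).1 h
  rw [gowForm_add_left, ← Nat.cast_smul_eq_nsmul R, gowForm_smul_left, gowForm_comm z]
  refine dvd_add (ha y) ?_
  rw [pow_succ']
  exact mul_dvd_mul_left _ (hy z)

theorem gowForm_sub_dvd {x x' y y' : lattice n F R} (hx : x ∈ filt n F R ℓ k)
    (hx' : x' ∈ filt n F R ℓ k) (hy : y ∈ filt n F R ℓ k) (hy' : y' ∈ filt n F R ℓ k)
    (h : toFactor ℓ k x hx = toFactor ℓ k x' hx') (h' : toFactor ℓ k y hy = toFactor ℓ k y' hy') :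
    (ℓ : R) ^ (k + 1) ∣ gowForm x y - gowForm x' y' := by
  have h1 : toFactor ℓ k (x - x') (sub_mem hx hx') = 0 :=
    (toFactor_eq_zero_iff _).2 ((toFactor_eq_iff hx hx').1 h)
  have h2 : toFactor ℓ k (y - y') (sub_mem hy hy') = 0 :=
    (toFactor_eq_zero_iff _).2 ((toFactor_eq_iff hy hy').1 h')
  have e : gowForm x y - gowForm x' y' = gowForm (x - x') y + gowForm (y - y') x' := by
    rw [gowForm_comm (y - y') x']
    simp only [← gowBilin_apply, map_sub, LinearMap.sub_apply]
    ring
  rw [e]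
  exact dvd_add (dvd_of_toFactor_eq_zero _ h1 hy) (dvd_of_toFactor_eq_zero _ h2 hx')

variable [IsDomain R] [CharZero R]

/-- The form on `M(k)` obtained by reducing `ℓ^{-k} f` modulo `ℓ`. -/
noncomputable def factorForm (v w : Factor n F R ℓ k) : Res R ℓ :=
  Ideal.Quotient.mk _ ((toFactor_surjective v).choose_spec.choose
    (toFactor_surjective w).choose).choose

theorem factorForm_toFactor (hℓ : ℓ ≠ 0) {x y : lattice n F R} (hx : x ∈ filt n F R ℓ k)
    (hy : y ∈ filt n F R ℓ k) {c : R} (hc : gowForm x y = (ℓ : R) ^ k * c) :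
    factorForm (toFactor ℓ k x hx) (toFactor ℓ k y hy) = Ideal.Quotient.mk _ c := by
  set X := toFactor_surjective (toFactor ℓ k x hx)
  set Y := toFactor_surjective (toFactor ℓ k y hy)
  have hc' := (X.choose_spec.choose Y.choose).choose_spec
  have h := gowForm_sub_dvd X.choose_spec.choose hx Y.choose_spec.choose hy
    X.choose_spec.choose_spec Y.choose_spec.choose_spec
  rw [factorForm, Ideal.Quotient.eq, Ideal.mem_span_singleton]
  rw [hc, hc', ← mul_sub, pow_succ, mul_dvd_mul_iff_left (pow_ne_zero _ (Nat.cast_ne_zero.2 hℓ))]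
    at h
  exact h

theorem exists_factorForm_eq (hℓ : ℓ ≠ 0) {x y : lattice n F R} (hx : x ∈ filt n F R ℓ k)
    (hy : y ∈ filt n F R ℓ k) : ∃ c, gowForm x y = (ℓ : R) ^ k * c ∧
      factorForm (toFactor ℓ k x hx) (toFactor ℓ k y hy) = Ideal.Quotient.mk _ c := by
  obtain ⟨c, hc⟩ := hx y
  exact ⟨c, hc, factorForm_toFactor hℓ hx hy hc⟩

theorem factorForm_comm (hℓ : ℓ ≠ 0) (v w : Factor n F R ℓ k) :
    factorForm v w = factorForm w v := by
  obtain ⟨x, hx, rfl⟩ := toFactor_surjective v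
  obtain ⟨y, hy, rfl⟩ := toFactor_surjective w
  obtain ⟨c, hc, h⟩ := exists_factorForm_eq hℓ hx hy
  rw [h, factorForm_toFactor hℓ hy hx (by rw [gowForm_comm, hc])]

theorem factorForm_add_left (hℓ : ℓ ≠ 0) (v v' w : Factor n F R ℓ k) :
    factorForm (v + v') w = factorForm v w + factorForm v' w := by
  obtain ⟨x, hx, rfl⟩ := toFactor_surjective v
  obtain ⟨x', hx', rfl⟩ := toFactor_surjective v'
  obtain ⟨y, hy, rfl⟩ := toFactor_surjective w
  obtain ⟨c, hc, h⟩ := exists_factorForm_eq hℓ hx hy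
  obtain ⟨c', hc', h'⟩ := exists_factorForm_eq hℓ hx' hy
  rw [h, h', ← toFactor_add, factorForm_toFactor hℓ (add_mem hx hx') hy
    (c := c + c') (by rw [gowForm_add_left, hc, hc', mul_add]), map_add]

theorem factorForm_single_smul_left (hℓ : ℓ ≠ 0) (g : GL (Fin n) F) (a : Res R ℓ)
    (v w : Factor n F R ℓ k) :
    factorForm ((MonoidAlgebra.single g a : MonoidAlgebra (Res R ℓ) (GL (Fin n) F)) • v) w =
      a * factorForm v
        ((MonoidAlgebra.single g⁻¹ 1 : MonoidAlgebra (Res R ℓ) (GL (Fin n) F)) • w) := by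
  obtain ⟨x, hx, rfl⟩ := toFactor_surjective v
  obtain ⟨y, hy, rfl⟩ := toFactor_surjective w
  obtain ⟨r, rfl⟩ := Ideal.Quotient.mk_surjective a
  have hy' := (filt n F R ℓ k).smul_mem (MonoidAlgebra.single g⁻¹ 1) hy
  obtain ⟨c, hc, h⟩ := exists_factorForm_eq hℓ hx hy'
  have h1 : (1 : Res R ℓ) = Ideal.Quotient.mk _ 1 := (map_one _).symm
  rw [h1, ← redAlg_single, ← redAlg_single, ← toFactor_smul, ← toFactor_smul _ hy, h,
    factorForm_toFactor hℓ _ hy (c := r * c) (by rw [gowForm_single_smul, hc]; ring), map_mul]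

/-- `factorForm` as a bilinear map. -/
noncomputable def factorBilin (hℓ : ℓ ≠ 0) [Module (Res R ℓ) (Factor n F R ℓ k)]
    [IsScalarTower (Res R ℓ) (MonoidAlgebra (Res R ℓ) (GL (Fin n) F)) (Factor n F R ℓ k)] :
    Factor n F R ℓ k →ₗ[Res R ℓ] Factor n F R ℓ k →ₗ[Res R ℓ] Res R ℓ :=
  have hsmul : ∀ (a : Res R ℓ) (v w : Factor n F R ℓ k),
      factorForm (a • v) w = a • factorForm v w := fun a v w => by
    rw [← algebraMap_smul (MonoidAlgebra (Res R ℓ) (GL (Fin n) F)) a v]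
    refine (factorForm_single_smul_left hℓ 1 a v w).trans ?_
    rw [inv_one, ← MonoidAlgebra.one_def, one_smul, smul_eq_mul]
  LinearMap.mk₂ _ factorForm (factorForm_add_left hℓ) hsmul
    (fun v w w' => by
      rw [factorForm_comm hℓ, factorForm_add_left hℓ, factorForm_comm hℓ w,
        factorForm_comm hℓ w'])
    (fun a v w => by rw [factorForm_comm hℓ, hsmul, factorForm_comm hℓ])

end FactorModule

/-! ### Elements E_χ in the submodules of M(k) -/

section Criterion

theorem rootSupport_inv {n : ℕ} {F : Type*} [Field F] {A : Type*} [CommRing A]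
    (χ : unitri n F →* Aˣ) :
    rootSupport χ⁻¹ = rootSupport χ := by
  ext r
  simp [rootSupport]

variable {n : ℕ} {F : Type*} [Field F] [Fintype F] {R : Type*} [CommRing R] {ℓ k : ℕ}

/-- A diagonal matrix conjugates one character to the other and fixes e. Hence the submodule
generated by E_χ depends only on J(χ), and the choice of χ for each parabolic is immaterial. -/
theorem exists_latticeRep_charElt_eq [IsDomain R] {ψ : AddChar F R}
    (hq : (Fintype.card F : R) ≠ 0) (hψ : ∀ x : F, x ≠ 0 → ∑ a, ψ (x * a) = 0)
    {χ χ' : unitri n F →* Rˣ} (h : rootSupport χ = rootSupport χ') :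
    ∃ g, latticeRep n F R g (charElt χ) = charElt χ' := by
  obtain ⟨b, rfl⟩ := exists_eq_unitriChar hq hψ χ
  obtain ⟨b', rfl⟩ := exists_eq_unitriChar hq hψ χ'
  rw [rootSupport_unitriChar hq hψ, rootSupport_unitriChar hq hψ] at h
  obtain ⟨d, hd⟩ := exists_superdiag_conj (b := b) (b' := b') fun r hr => by
    have : r ∈ {r | r ∈ simpleRoots n ∧ b r.2 ≠ 0} ↔ r ∈ {r | r ∈ simpleRoots n ∧ b' r.2 ≠ 0} := by
      rw [h]
    exact not_iff_not.1 (by simpa [hr] using this)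
  refine ⟨_, diagGL_charElt d fun u => Units.ext ?_⟩
  rw [coe_unitriChar, coe_unitriChar, hd]

theorem toFactor_mem_span_of_latticeRep_eq {x y : lattice n F R} {g : GL (Fin n) F}
    (h : latticeRep n F R g x = y) (hx : x ∈ filt n F R ℓ k) (hy : y ∈ filt n F R ℓ k) :
    toFactor ℓ k y hy ∈
      Submodule.span (MonoidAlgebra (Res R ℓ) (GL (Fin n) F)) {toFactor ℓ k x hx} := by
  subst h
  refine Submodule.mem_span_singleton.2 ⟨redAlg n F R ℓ (MonoidAlgebra.single g 1), ?_⟩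
  rw [← toFactor_smul]
  rfl

section Finiteness

variable [Module (Res R ℓ) (Factor n F R ℓ k)]
  [IsScalarTower (Res R ℓ) (MonoidAlgebra (Res R ℓ) (GL (Fin n) F)) (Factor n F R ℓ k)]

theorem toFactor_smul_scalar (r : R) {x : lattice n F R} (hx : x ∈ filt n F R ℓ k)
    (hrx : r • x ∈ filt n F R ℓ k) :
    toFactor ℓ k (r • x) hrx =
      (Ideal.Quotient.mk (Ideal.span {(ℓ : R)}) r : Res R ℓ) • toFactor ℓ k x hx := by
  have h : r • x = (MonoidAlgebra.single 1 r : MonoidAlgebra R (GL (Fin n) F)) • x := by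
    rw [single_smul_eq, map_one, Module.End.one_apply]
  rw [toFactor_congr h, toFactor_smul _ hx, redAlg_single,
    ← algebraMap_smul (MonoidAlgebra (Res R ℓ) (GL (Fin n) F))
      (Ideal.Quotient.mk (Ideal.span {(ℓ : R)}) r : Res R ℓ)]
  rfl

theorem finite_factor [IsNoetherianRing R] : Module.Finite (Res R ℓ) (Factor n F R ℓ k) := by
  let N : Submodule R (lattice n F R) := (filt n F R ℓ k).restrictScalars R
  let π : N →ₛₗ[Ideal.Quotient.mk (Ideal.span {(ℓ : R)})] Factor n F R ℓ k :=
    { toFun := fun x => toFactor ℓ k x.1 x.2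
      map_add' := fun x y => toFactor_add x.2 y.2
      map_smul' := fun r x => toFactor_smul_scalar r x.2 (N.smul_mem r x.2) }
  refine Module.Finite.of_surjective π fun v => ?_
  obtain ⟨x, hx, rfl⟩ := toFactor_surjective v
  exact ⟨⟨x, hx⟩, rfl⟩

end Finiteness

theorem isUnit_card_unitri (hq : IsUnit (Fintype.card F : R)) :
    IsUnit (Nat.card (unitri n F) : R) := by
  rw [card_unitri, Nat.cast_pow, Nat.card_eq_fintype_card]
  exact hq.pow _

theorem index_parabolic_ne_zero (J : Set (Fin n × Fin n)) : (parabolic n F J).index ≠ 0 :=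
  Subgroup.index_ne_zero_of_finite

variable {ψ : AddChar F R}

/-- Pairing with e alone already attains the index, which divides all other values f(E_χ, y). -/
theorem charElt_mem_filt_iff [IsDomain R] (hq : (Fintype.card F : R) ≠ 0)
    (hψ : ∀ x : F, x ≠ 0 → ∑ a, ψ (x * a) = 0) (χ : unitri n F →* Rˣ) :
    charElt χ ∈ filt n F R ℓ k ↔
      (ℓ : R) ^ k ∣ ((parabolic n F (rootSupport χ)).index : R) := by
  constructor
  · intro h
    rw [← gowForm_charElt_latticeGen hq hψ]
    exact h _
  · exact fun h y => h.trans (index_dvd_gowForm_charElt hq hψ χ y)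

variable [IsLocalRing R]

theorem isUnit_card_of_coprime (hmax : IsLocalRing.maximalIdeal R = Ideal.span {(ℓ : R)})
    {p : ℕ} [CharP F p] (hℓ : ℓ.Prime) (hℓp : ℓ ≠ p) : IsUnit (Fintype.card F : R) := by
  obtain ⟨m, hp, hm⟩ := FiniteField.card F p
  rw [hm, Nat.cast_pow]
  exact (isUnit_natCast_of_coprime hmax ((Nat.coprime_primes hp hℓ).2 hℓp.symm)).pow _

variable [IsDomain R] [CharZero R]

/-- `f_k(E_χ, E_{χ⁻¹}) ≠ 0` in `M(k)` for `k = ν_ℓ([G : P_{J(χ)}])`. -/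
theorem factorForm_charElt_inv_ne_zero (hℓ : ℓ.Prime)
    (hmax : IsLocalRing.maximalIdeal R = Ideal.span {(ℓ : R)})
    (hq : IsUnit (Fintype.card F : R)) (hψ : ∀ x : F, x ≠ 0 → ∑ a, ψ (x * a) = 0)
    {χ : unitri n F →* Rˣ} (hk : padicValNat ℓ (parabolic n F (rootSupport χ)).index = k)
    (h : charElt χ ∈ filt n F R ℓ k) (h' : charElt χ⁻¹ ∈ filt n F R ℓ k) :
    factorForm (toFactor ℓ k (charElt χ) h) (toFactor ℓ k (charElt χ⁻¹) h') ≠ 0 := by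
  obtain ⟨c, hc, hform⟩ := exists_factorForm_eq hℓ.ne_zero h h'
  rw [hform, Ne, Ideal.Quotient.eq_zero_iff_dvd]
  rintro ⟨d, rfl⟩
  rw [gowForm_charElt_inv hq.ne_zero hψ, ← mul_assoc, ← pow_succ] at hc
  refine ((padicValNat_eq_iff hℓ hmax (index_parabolic_ne_zero _)).1 hk).2 ?_
  exact (isUnit_card_unitri hq).dvd_mul_left.1 ⟨d, hc⟩

/-- Every nonzero submodule of `M(k)` contains the image of some `E_χ` such that
`k = ν_ℓ([G : P_{J(χ)}])`. -/
theorem exists_toFactor_charElt_mem (hℓ : ℓ.Prime)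
    (hmax : IsLocalRing.maximalIdeal R = Ideal.span {(ℓ : R)})
    (hq : IsUnit (Fintype.card F : R)) (hψ : ∀ x : F, x ≠ 0 → ∑ a, ψ (x * a) = 0)
    [Module (Res R ℓ) (Factor n F R ℓ k)]
    [IsScalarTower (Res R ℓ) (MonoidAlgebra (Res R ℓ) (GL (Fin n) F)) (Factor n F R ℓ k)]
    {N : Submodule (MonoidAlgebra (Res R ℓ) (GL (Fin n) F)) (Factor n F R ℓ k)} (hN : N ≠ ⊥) :
    ∃ (χ : unitri n F →* Rˣ) (h : charElt χ ∈ filt n F R ℓ k),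
      padicValNat ℓ (parabolic n F (rootSupport χ)).index = k ∧
        toFactor ℓ k (charElt χ) h ∈ N := by
  classical
  set mk := Ideal.Quotient.mk (Ideal.span {(ℓ : R)}) with hmk
  let ψK : AddChar F (Res R ℓ) := mk.toMonoidHom.compAddChar ψ
  have hψK : ∀ x : F, x ≠ 0 → ∑ a, ψK (x * a) = 0 := fun x hx => by
    have := congrArg mk (hψ x hx)
    rw [map_sum, map_zero] at this
    exact this
  have hqK : IsUnit (Fintype.card F : Res R ℓ) := by
    have := hq.map mk
    rwa [map_natCast] at this
  have : Nontrivial N := Submodule.nontrivial_iff_ne_bot.2 hN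
  obtain ⟨⟨v, hvN⟩, hv0, b, hb⟩ := exists_unitri_eigenvector
    (moduleRep (Res R ℓ) (GL (Fin n) F) N) hψK hqK
  have hv0 : v ≠ 0 := fun h => hv0 (Subtype.ext h)
  have hb : ∀ u : unitri n F, (MonoidAlgebra.single (u : GL (Fin n) F) 1 :
      MonoidAlgebra (Res R ℓ) (GL (Fin n) F)) • v =
        (MonoidAlgebra.single 1 (mk (unitriChar ψ b u)) :
          MonoidAlgebra (Res R ℓ) (GL (Fin n) F)) • v := fun u => by
    have h := congrArg Subtype.val (hb u u.2)
    refine h.trans ?_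
    change ψK (superdiag b u) • v = _
    rw [← algebraMap_smul (MonoidAlgebra (Res R ℓ) (GL (Fin n) F)) (ψK (superdiag b u)) v]
    rfl
  obtain ⟨x, hx, hxv⟩ := toFactor_surjective v
  -- The inverse appears because U acts on E_χ by χ⁻¹. With this choice, a = ∑ χ(u)u acts on v as
  -- the unit |U| and sends the lift x to a multiple of E_χ.
  set χ : unitri n F →* Rˣ := (unitriChar ψ b)⁻¹ with hχ
  let a : MonoidAlgebra R (GL (Fin n) F) :=
    ∑ u : unitri n F, MonoidAlgebra.single (u : GL (Fin n) F) (χ u : R)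
  have hav : redAlg n F R ℓ a • v = (MonoidAlgebra.single 1 (Nat.card (unitri n F) : Res R ℓ) :
      MonoidAlgebra (Res R ℓ) (GL (Fin n) F)) • v := by
    have h1 : ∀ u : unitri n F, redAlg n F R ℓ
        (MonoidAlgebra.single (u : GL (Fin n) F) (χ u : R)) • v = v := fun u => by
      have e : (MonoidAlgebra.single (u : GL (Fin n) F) (mk (χ u)) :
          MonoidAlgebra (Res R ℓ) (GL (Fin n) F)) =
          MonoidAlgebra.single 1 (mk (χ u)) * MonoidAlgebra.single (u : GL (Fin n) F) 1 := by
        rw [MonoidAlgebra.single_mul_single, one_mul, mul_one]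
      rw [redAlg_single, e, mul_smul, hb, ← mul_smul, MonoidAlgebra.single_mul_single, one_mul,
        ← map_mul, hχ, MonoidHom.inv_apply, Units.inv_mul, map_one, ← MonoidAlgebra.one_def,
        one_smul]
    rw [map_sum, Finset.sum_smul, Finset.sum_congr rfl fun u _ => h1 u, Finset.sum_const,
      Finset.card_univ, ← Nat.card_eq_fintype_card, ← MonoidAlgebra.natCast_def,
      Nat.cast_smul_eq_nsmul]
  obtain ⟨r, hr⟩ := exists_sum_char_smul_eq χ x
  have hax : a • x = r • charElt χ := by
    rw [← hr, Finset.sum_smul]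
    exact Finset.sum_congr rfl fun u _ => single_smul_eq _ _ _
  have haxF : a • x ∈ filt n F R ℓ k := Submodule.smul_mem _ a hx
  have hπ : toFactor ℓ k (a • x) haxF = redAlg n F R ℓ a • v := by
    rw [toFactor_smul a hx, hxv]
  have hne : toFactor ℓ k (a • x) haxF ≠ 0 := by
    rw [hπ, hav]
    intro h0
    have hu := (isUnit_card_unitri (n := n) hq).map mk
    rw [map_natCast] at hu
    exact hv0 (((hu.map MonoidAlgebra.singleOneRingHom).smul_eq_zero).1 h0)
  -- Otherwise ax = rE_χ would lie in ℓI and vanish in M(k).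
  have hrunit : IsUnit r := by
    refine isUnit_of_not_dvd hmax ?_
    rintro ⟨s, rfl⟩
    refine hne ((toFactor_eq_zero_iff _).2 ⟨0, zero_mem _, s • charElt χ, ?_⟩)
    rw [hax, zero_add, mul_smul, Nat.cast_smul_eq_nsmul]
  obtain ⟨r, rfl⟩ := hrunit
  have hE : charElt χ =
      (MonoidAlgebra.single 1 ((r⁻¹ : Rˣ) : R) : MonoidAlgebra R (GL (Fin n) F)) • a • x := by
    rw [hax, single_smul_eq, map_one, Module.End.one_apply, smul_smul, Units.inv_mul, one_smul]
  have hEF : charElt χ ∈ filt n F R ℓ k := hE ▸ Submodule.smul_mem _ _ haxF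
  refine ⟨χ, hEF, ?_, ?_⟩
  · rw [padicValNat_eq_iff hℓ hmax (index_parabolic_ne_zero _),
      ← charElt_mem_filt_iff hq.ne_zero hψ, ← charElt_mem_filt_iff hq.ne_zero hψ]
    -- If the valuation exceeded k, then E_χ, and with it ax, would lie in I(k+1) and vanish in
    -- M(k).
    refine ⟨hEF, fun h => hne ((toFactor_eq_zero_iff _).2 ⟨a • x, ?_, 0, by simp⟩)⟩
    rw [hax]
    exact ((filt n F R ℓ (k + 1)).restrictScalars R).smul_mem _ h
  · rw [toFactor_congr hE, toFactor_smul _ haxF, hπ]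
    exact N.smul_mem _ (N.smul_mem _ hvN)

end Criterion

end SteinbergLattice

theorem theorem6p5 {n : ℕ} (hn : 2 ≤ n) {p : ℕ} {F : Type*} [Field F] [Fintype F] [CharP F p]
    {ℓ : ℕ} (hℓ : ℓ.Prime) (hℓp : ℓ ≠ p)
    {R : Type*} [CommRing R] [IsDomain R] [IsPrincipalIdealRing R] [IsLocalRing R] [CharZero R]
    (hmax : IsLocalRing.maximalIdeal R = Ideal.span {(ℓ : R)})
    (hroot : ∃ ζ : R, IsPrimitiveRoot ζ p) :
    (∀ P : Subgroup (GL (Fin n) F), SteinbergLattice.borel n F ≤ P →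
      ∃ χ : SteinbergLattice.unitri n F →* Rˣ,
        SteinbergLattice.parabolic n F (SteinbergLattice.rootSupport χ) = P) ∧
    ∃ hE : ∀ (χ : SteinbergLattice.unitri n F →* Rˣ) (k : ℕ),
        padicValNat ℓ
          (SteinbergLattice.parabolic n F (SteinbergLattice.rootSupport χ)).index = k →
        SteinbergLattice.charElt χ ∈ SteinbergLattice.filt n F R ℓ k,
      ∀ (χ : Subgroup (GL (Fin n) F) → (SteinbergLattice.unitri n F →* Rˣ))
        (hχ : ∀ P, SteinbergLattice.borel n F ≤ P →
          SteinbergLattice.parabolic n F (SteinbergLattice.rootSupport (χ P)) = P)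
        (k : ℕ),
        (∃ P : Subgroup (GL (Fin n) F),
          SteinbergLattice.borel n F ≤ P ∧ padicValNat ℓ P.index = k) →
        (IsSimpleModule (MonoidAlgebra (SteinbergLattice.Res R ℓ) (GL (Fin n) F))
            (SteinbergLattice.Factor n F R ℓ k) ↔
          ∃ (P : Subgroup (GL (Fin n) F)) (hBP : SteinbergLattice.borel n F ≤ P)
            (hP : padicValNat ℓ P.index = k),
            ∀ (Q : Subgroup (GL (Fin n) F)) (hBQ : SteinbergLattice.borel n F ≤ Q)
              (hQ : padicValNat ℓ Q.index = k), Q ≠ P →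
              SteinbergLattice.toFactor ℓ k (SteinbergLattice.charElt (χ P))
                  (hE (χ P) k (by rw [hχ P hBP]; exact hP)) ∈
                Submodule.span (MonoidAlgebra (SteinbergLattice.Res R ℓ) (GL (Fin n) F))
                  {SteinbergLattice.toFactor ℓ k (SteinbergLattice.charElt (χ Q))
                    (hE (χ Q) k (by rw [hχ Q hBQ]; exact hQ))}) := by
  open SteinbergLattice in
  obtain ⟨ζ, hζ⟩ := hroot
  obtain ⟨ψ, hψ⟩ := exists_addChar_sum_eq_zero F hζ
  have hq : IsUnit (Fintype.card F : R) := isUnit_card_of_coprime hmax hℓ hℓp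
  have hE : ∀ (χ : unitri n F →* Rˣ) (k : ℕ),
      padicValNat ℓ (parabolic n F (rootSupport χ)).index = k →
      charElt χ ∈ filt n F R ℓ k := fun χ k hk =>
    (charElt_mem_filt_iff hq.ne_zero hψ χ).2
      ((padicValNat_eq_iff hℓ hmax (index_parabolic_ne_zero _)).1 hk).1
  refine ⟨fun P hP => ?_, hE, fun χ hχ k hk => ?_⟩
  · classical
    -- The coefficient at j is 1 exactly when the reflection swapping j − 1 and j lies in P, so the
    -- support is the set J with P = P_J.
    let b : Fin n → F := fun j =>
      if ∃ i, (i, j) ∈ simpleRoots n ∧ permGL n F (Equiv.swap i j) ∈ P then 1 else 0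
    refine ⟨unitriChar ψ b, ?_⟩
    rw [rootSupport_unitriChar hq.ne_zero hψ]
    conv_rhs => rw [← eq_parabolic_of_borel_le hP]
    congr 1
    ext ⟨i, j⟩
    refine and_congr_right fun hij => ?_
    simp only [b, ne_eq, ite_eq_right_iff, one_ne_zero, imp_false, not_not]
    refine ⟨?_, fun h => ⟨i, hij, h⟩⟩
    rintro ⟨i', hi', h⟩
    have h1 : (i : ℕ) + 1 = j := hij
    have h2 : (i' : ℕ) + 1 = j := hi'
    obtain rfl : i' = i := Fin.ext (by omega)
    exact h
  have hmaximal : (Ideal.span {(ℓ : R)}).IsMaximal := hmax ▸ inferInstance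
  let _ : Module (Res R ℓ) (Factor n F R ℓ k) :=
    Module.compHom _ (algebraMap (Res R ℓ) (MonoidAlgebra (Res R ℓ) (GL (Fin n) F)))
  have : IsScalarTower (Res R ℓ) (MonoidAlgebra (Res R ℓ) (GL (Fin n) F)) (Factor n F R ℓ k) :=
    ⟨fun r a x => by rw [Algebra.smul_def, mul_smul]; rfl⟩
  have hinv : ∀ χ : unitri n F →* Rˣ,
      padicValNat ℓ (parabolic n F (rootSupport χ)).index = k → charElt χ⁻¹ ∈ filt n F R ℓ k :=
    fun χ hk => hE _ _ (by rwa [rootSupport_inv])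
  constructor
  · intro hsimple
    obtain ⟨P, hBP, hP⟩ := hk
    refine ⟨P, hBP, hP, fun Q hBQ hQ _ => ?_⟩
    have hQ' : padicValNat ℓ (parabolic n F (rootSupport (χ Q))).index = k := by rwa [hχ Q hBQ]
    -- The image of E_Q is nonzero since it pairs nontrivially, so it generates the irreducible
    -- module M(k).
    have hne : toFactor ℓ k (charElt (χ Q)) (hE (χ Q) k hQ') ≠ 0 := fun h => by
      refine factorForm_charElt_inv_ne_zero hℓ hmax hq hψ hQ' (hE _ _ hQ')
        (hinv _ hQ') ?_
      rw [h]
      exact LinearMap.congr_fun (map_zero (factorBilin hℓ.ne_zero)) _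
    have htop := (eq_bot_or_eq_top (Submodule.span (MonoidAlgebra (Res R ℓ) (GL (Fin n) F))
      {toFactor ℓ k (charElt (χ Q)) (hE (χ Q) k hQ')})).resolve_left
      fun h => hne (Submodule.span_singleton_eq_bot.1 h)
    rw [htop]
    trivial
  · rintro ⟨P, hBP, hP, hPQ⟩
    have hP' : padicValNat ℓ (parabolic n F (rootSupport (χ P))).index = k := by rwa [hχ P hBP]
    let _ : Field (Res R ℓ) := Ideal.Quotient.field _
    have : Module.Finite (Res R ℓ) (Factor n F R ℓ k) := finite_factor
    refine isSimpleModule_of_form (K := Res R ℓ) (factorBilin hℓ.ne_zero) ?_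
      (v := toFactor ℓ k (charElt (χ P)) (hE (χ P) k hP'))
      (w := toFactor ℓ k (charElt (χ P)⁻¹) (hinv _ hP')) ?_ ?_
      (factorForm_charElt_inv_ne_zero hℓ hmax hq hψ hP' _ _)
    · intro S v hv a
      induction a using MonoidAlgebra.induction_linear with
      | zero => simp
      | add a b ha hb =>
        intro s hs
        rw [add_smul, map_add, LinearMap.add_apply, ha s hs, hb s hs, add_zero]
      | single g r =>
        intro s hs
        refine (factorForm_single_smul_left hℓ.ne_zero g r v s).trans ?_
        have := hv _ (S.smul_mem (MonoidAlgebra.single g⁻¹ 1) hs)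
        exact (congrArg (r * ·) this).trans (mul_zero r)
    · intro N hN
      obtain ⟨μ, hμ, hμk, hμN⟩ := exists_toFactor_charElt_mem hℓ hmax hq hψ hN
      set Q := parabolic n F (rootSupport μ) with hQ
      have hBQ : borel n F ≤ Q := borel_le_parabolic _
      -- A parabolic determines its set J, so μ and the chosen character of Q are conjugate under
      -- the torus.
      have hsupp : rootSupport μ = rootSupport (χ Q) :=
        parabolic_injective (F := F) (rootSupport_subset _) (rootSupport_subset _)
          (hQ.symm.trans (hχ Q hBQ).symm)
      obtain ⟨g, hg⟩ := exists_latticeRep_charElt_eq hq.ne_zero hψ hsupp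
      have hχQ : padicValNat ℓ (parabolic n F (rootSupport (χ Q))).index = k := by rwa [hχ Q hBQ]
      have hQN : toFactor ℓ k (charElt (χ Q)) (hE (χ Q) k hχQ) ∈ N :=
        (Submodule.span_singleton_le_iff_mem _ N).2 hμN
          (toFactor_mem_span_of_latticeRep_eq hg hμ _)
      by_cases hQP : Q = P
      · have : ∀ (P' : Subgroup (GL (Fin n) F)) (h : charElt (χ P') ∈ filt n F R ℓ k), P' = P →
            toFactor ℓ k (charElt (χ P')) h ∈ N →
            toFactor ℓ k (charElt (χ P)) (hE (χ P) k hP') ∈ N := by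
          rintro _ _ rfl h
          exact h
        exact this Q _ hQP hQN
      · exact (Submodule.span_singleton_le_iff_mem _ N).2 hQN (hPQ Q hBQ hμk hQP)
    -- A character and its inverse have the same support, so w is a torus translate of v.
    · obtain ⟨g, hg⟩ := exists_latticeRep_charElt_eq hq.ne_zero hψ (rootSupport_inv (χ P)).symm
      exact toFactor_mem_span_of_latticeRep_eq hg _ _
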